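/- Let $m\ge 0$, $g\in\mathbb{R}$, $P\in\mathbb{R}^3$, $\omega(k)=\sqrt{k^2+m^2}$ and $v(k)=g\,\omega(k)^{-1/2}$. Let $\mathscr{H}_P=\bigoplus_{n\ge 0}L^2(\mathbb{R}^3)^{\otimes_{\mathrm{sym}}n}$ be the symmetric Fock space, with $n$-particle wavefunctions $\psi^{(n)}(K)$, $K=(k_1,\dots,k_n)$, and let $\hat K_j$ denote $K$ with $k_j$ removed. Let $L_P$ be the operator of multiplication by $$L_P(K)=\Big(P-\sum_{j=1}^n k_j\Big)^2+\sum_{j=1}^n\omega(k_j)$$ on its maximal domain $D(L_P)$, let $\mathrm{d}\Gamma(\omega)$ be multiplication by $\sum_{j=1}^n\omega(k_j)$, and let $(a(v)\psi)^{(n)}(K)=\sqrt{n+1}\int_{\mathbb{R}^3} v(\xi)\,\psi^{(n+1)}(K,\xi)\,\mathrm{d}\xi$. For $\lambda>0$ let $G_\lambda$ be the adjoint of $G_\lambda^*=-a(v)(L_P+\lambda)^{-1}$, let $$T_{\mathrm{d},\lambda}(K)=\int_{\mathbb{R}^3}|v(\xi)|^2\Big(\frac{1}{\xi^2+\omega(\xi)}-\frac{1}{L_P(K,\xi)+\lambda}\Big)\mathrm{d}\xi,\qquad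 (T_{\mathrm{od},\lambda}\psi^{(n)})(K)=-\sum_{j=1}^n\int_{\mathbb{R}^3}\frac{v(\xi)v(k_j)\psi^{(n)}(\hat K_j,\xi)}{L_P(K,\xi)+\lambda}\,\mathrm{d}\xi ,$$ with $T_{\mathrm{od},\lambda}\psi^{(0)}=0$, and let $T_\lambda=T_{\mathrm{d},\lambda}+T_{\mathrm{od},\lambda}$ (the first term being multiplication by $T_{\mathrm{d},\lambda}(K)$) on $D(T_\lambda)=D(L_P^{\varepsilon}+\mathrm{d}\Gamma(\omega)^{1/2})$, where $\varepsilon\in(0,1/4)$ is fixed and arbitrary. For any $\mu>0$ the renormalised Nelson Hamiltonian is $$H_P=(1-G_\mu)^*(L_P+\mu)(1-G_\mu)+T_\mu-\mu,\qquad D(H_P)=\{\psi\in\mathscr{H}_P:(1-G_\mu)\psi\in D(L_P)\}.$$ Let $\tau_{+,\lambda}(K)=\max(T_{\mathrm{d},\lambda}(K),0)$ and $\tau_{-,\lambda}=T_{\mathrm{d},\lambda}-\tau_{+,\lambda}$, and let $F_\lambda$ be the adjoint of $F_\lambda^*=-a(v)(L_P+\tau_{+,\lambda}+\lambda)^{-1}$.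 Then for every $\lambda>0$ and every $\mu>0$ used in the definition of $H_P$: the integrals defining $T_{\mathrm{d},\lambda}(K)$ and $S_{\mathrm{d},\lambda}(K)$ (below) converge absolutely for all $K$; $G_\lambda$, $F_\lambda$ and their adjoints are bounded and everywhere defined; $T_\lambda$ and $S_\lambda$ are well defined on all of $D(L_P^{\varepsilon}+\mathrm{d}\Gamma(\omega)^{1/2})$; the expression for $H_P$ is defined exactly on $D(H_P)$; and, as an identity of unbounded operators including their domains, $$H_P=(1-F_\lambda)^*(L_P+\tau_{+,\lambda}+\lambda)(1-F_\lambda)+S_\lambda-\lambda ,$$ where $S_\lambda=S_{\mathrm{d},\lambda}+S_{\mathrm{od},\lambda}$, $D(S_\lambda)=D(T_\lambda)$, is given by multiplication by $$S_{\mathrm{d},\lambda}(K)=\tau_{-,\lambda}(K)+\int_{\mathbb{R}^3}\frac{|v(\xi)|^2\,\tau_{+,\lambda}(K,\xi)}{(L_P(K,\xi)+\lambda)(L_P(K,\xi)+\tau_{+,\lambda}(K,\xi)+\lambda)}\,\mathrm{d}\xi$$ and $$(S_{\mathrm{od},\lambda}\psi^{(n)})(K)=-\sum_{j=1}^n\int_{\mathbb{R}^3}\frac{v(\xi)v(k_j)\,\psi^{(n)}(\hat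 K_j,\xi)}{L_P(K,\xi)+\tau_{+,\lambda}(K,\xi)+\lambda}\,\mathrm{d}\xi\quad(n>0),\qquad S_{\mathrm{od},\lambda}\psi^{(0)}=0 .$$ The off-diagonal kernel $-v(\xi)v(k_j)/(L_P(K,\xi)+\tau_{+,\lambda}(K,\xi)+\lambda)$ is $\le 0$, and it is $<0$ whenever $g\ne 0$, $\xi\ne 0$ and $k_j\neq 0$. -/

import Mathlib

open MeasureTheory Filter

noncomputable section

namespace Nelson

/-- Momentum space `ℝ³` with the Euclidean norm. -/
abbrev E3 : Type := EuclideanSpace ℝ (Fin 3)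

/-- Configurations `K = (k₁, …, kₙ)` of `n` boson momenta, with Lebesgue measure. -/
abbrev Conf (n : ℕ) : Type := Fin n → E3

/-! ### Null sets of configurations -/

theorem mp_perm {n : ℕ} (σ : Equiv.Perm (Fin n)) :
    MeasurePreserving (fun K : Conf n => K ∘ σ) volume volume := by
  have h := volume_measurePreserving_piCongrLeft (fun _ : Fin n => E3) σ.symm
  have e : (fun K : Conf n => K ∘ σ)
      = (MeasurableEquiv.piCongrLeft (fun _ : Fin n => E3) σ.symm : Conf n → Conf n) := by
    funext K i
    have := MeasurableEquiv.piCongrLeft_apply_apply (β := fun _ : Fin n => E3) σ.symm K (σ i)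
    simp only [Equiv.symm_apply_apply] at this
    simpa using this.symm
  rw [e]; exact h

/-- A property of almost every `(n+1)`-particle configuration holds at `(K, ξ)` for almost every
`K` and then almost every `ξ`. -/
theorem ae_slice {n : ℕ} {p : Conf (n + 1) → Prop} (h : ∀ᵐ K, p K) :
    ∀ᵐ K : Conf n, ∀ᵐ ξ : E3, p (Fin.snoc K ξ) := by
  have h1 := (volume_preserving_piFinSuccAbove (fun _ : Fin (n + 1) => E3) (Fin.last n)).symm
  have h2 := h1.quasiMeasurePreserving.ae h
  have h3 : ∀ᵐ z : Conf n × E3, p (Fin.snoc z.1 z.2) := by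
    have h4 := (Measure.measurePreserving_swap (μ := (volume : Measure (Conf n)))
      (ν := (volume : Measure E3))).quasiMeasurePreserving.ae h2
    filter_upwards [h4] with z hz
    have e : (MeasurableEquiv.piFinSuccAbove (fun _ : Fin (n + 1) => E3) (Fin.last n)).symm z.swap
        = Fin.snoc z.1 z.2 := by
      exact Fin.insertNth_last' z.2 z.1
    rw [e] at hz
    exact hz
  exact Measure.ae_ae_of_ae_prod h3

/-- A property of almost every `n`-particle configuration holds after removal of one momentum from
almost every `(n+1)`-particle configuration. -/
theorem ae_remove {n : ℕ} (j : Fin (n + 1)) {q : Conf n → Prop} (h : ∀ᵐ K, q K) :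
    ∀ᵐ K : Conf (n + 1), q (j.removeNth K) := by
  have h1 := volume_preserving_piFinSuccAbove (fun _ : Fin (n + 1) => E3) j
  have h2 : ∀ᵐ z : E3 × Conf n, q z.2 := Measure.quasiMeasurePreserving_snd.ae h
  exact h1.quasiMeasurePreserving.ae h2

/-! ### The symmetric Fock space -/

/-- The `n`-particle space: elements of `L²(ℝ³ⁿ)` that are symmetric under permutations of the
`n` momenta. -/
def symL2 (n : ℕ) : Submodule ℂ (Lp ℂ 2 (volume : Measure (Conf n))) where
  carrier := {f | ∀ σ : Equiv.Perm (Fin n), (fun K : Conf n => f (K ∘ σ)) =ᵐ[volume] f}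
  zero_mem' := by
    intro σ
    have h := Lp.coeFn_zero ℂ 2 (volume : Measure (Conf n))
    filter_upwards [h, (mp_perm σ).quasiMeasurePreserving.ae h] with K h1 h2
    rw [h1, h2]; rfl
  add_mem' := by
    intro f g hf hg σ
    have h := Lp.coeFn_add f g
    filter_upwards [h, (mp_perm σ).quasiMeasurePreserving.ae h, hf σ, hg σ] with K h1 h2 h3 h4
    rw [h1, h2, Pi.add_apply, Pi.add_apply, h3, h4]
  smul_mem' := by
    intro c f hf σ
    have h := Lp.coeFn_smul c f
    filter_upwards [h, (mp_perm σ).quasiMeasurePreserving.ae h, hf σ] with K h1 h2 h3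
    rw [h1, h2, Pi.smul_apply, Pi.smul_apply, h3]

theorem isClosed_symL2 (n : ℕ) :
    IsClosed (symL2 n : Set (Lp ℂ 2 (volume : Measure (Conf n)))) := by
  have e : (symL2 n : Set (Lp ℂ 2 (volume : Measure (Conf n)))) =
      ⋂ σ : Equiv.Perm (Fin n), {f | Lp.compMeasurePreserving _ (mp_perm σ) f = f} := by
    ext f
    simp only [Set.mem_iInter, Set.mem_ofPred_eq]
    refine forall_congr' fun σ => ?_
    have h := Lp.coeFn_compMeasurePreserving f (mp_perm σ)
    exact ⟨fun h' => Lp.ext (h.trans h'), fun h' => by rw [h'] at h; exact h.symm⟩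
  rw [e]
  exact isClosed_iInter fun σ =>
    isClosed_eq (Lp.isometry_compMeasurePreserving (mp_perm σ)).continuous continuous_id

instance (n : ℕ) : CompleteSpace (symL2 n) :=
  (isClosed_symL2 n).completeSpace_coe

/-- The bosonic Fock space `⨁ₙ L²(ℝ³)^{⊗ₛ n}` (Hilbert space direct sum). -/
abbrev Fock : Type := lp (fun n : ℕ => symL2 n) 2

/-- The `n`-particle wavefunction of a Fock space vector. -/
def fn (ψ : Fock) (n : ℕ) : Conf n → ℂ := ((ψ n : symL2 n) : Lp ℂ 2 (volume : Measure (Conf n)))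

theorem fn_ext {ψ φ : Fock} (h : ∀ n, fn ψ n =ᵐ[volume] fn φ n) : ψ = φ := by
  apply lp.ext
  funext n
  exact Subtype.ext (Lp.ext (h n))

theorem fn_zero (n : ℕ) : fn 0 n =ᵐ[volume] 0 := Lp.coeFn_zero ℂ 2 volume

theorem fn_add (ψ φ : Fock) (n : ℕ) : fn (ψ + φ) n =ᵐ[volume] fn ψ n + fn φ n :=
  Lp.coeFn_add _ _

theorem fn_smul (c : ℂ) (ψ : Fock) (n : ℕ) : fn (c • ψ) n =ᵐ[volume] c • fn ψ n :=
  Lp.coeFn_smul _ _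

/-! ### Unbounded operators on Fock space -/

/-- A possibly unbounded operator: a linear map on a subspace of Fock space. -/
abbrev Op : Type := Fock →ₗ.[ℂ] Fock

/-- The identity operator. -/
def one : Op := (LinearMap.id : Fock →ₗ[ℂ] Fock).toPMap ⊤

/-- Composition `A B` on its natural domain `{ψ ∈ D(B) | B ψ ∈ D(A)}`. -/
def comp {X : Type} [AddCommGroup X] [Module ℂ X] (A B : X →ₗ.[ℂ] X) : X →ₗ.[ℂ] X where
  domain := (A.domain.comap B.toFun).map B.domain.subtype
  toFun :=
    { toFun := fun ψ => A ⟨B ⟨ψ.1, by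
          obtain ⟨x, -, hx⟩ := ψ.2; rw [← hx]; exact x.2⟩, by
          obtain ⟨x, hx, hx'⟩ := ψ.2
          have e : (⟨ψ.1, by rw [← hx']; exact x.2⟩ : B.domain) = x := Subtype.ext hx'.symm
          rw [e]; exact hx⟩
      map_add' := fun ψ φ => by
        rw [← LinearPMap.map_add]; congr 1; apply Subtype.ext
        exact B.map_add ⟨ψ.1, _⟩ ⟨φ.1, _⟩
      map_smul' := fun c ψ => by
        rw [RingHom.id_apply, ← LinearPMap.map_smul]; congr 1; apply Subtype.ext
        exact B.map_smul c ⟨ψ.1, _⟩ }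

theorem mem_comp_domain {X : Type} [AddCommGroup X] [Module ℂ X] (A B : X →ₗ.[ℂ] X) (ψ : X) :
    ψ ∈ (comp A B).domain ↔ ∃ h : ψ ∈ B.domain, B ⟨ψ, h⟩ ∈ A.domain := by
  constructor
  · rintro ⟨x, hx, rfl⟩; exact ⟨x.2, hx⟩
  · rintro ⟨h, h'⟩; exact ⟨⟨ψ, h⟩, h', rfl⟩

/-- Defined on the whole Fock space and bounded. -/
def IsBoundedOp (A : Op) : Prop :=
  A.domain = ⊤ ∧ ∃ C : ℝ, ∀ ψ : A.domain, ‖A ψ‖ ≤ C * ‖(ψ : Fock)‖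

/-! ### Multiplication operators -/

/-- Graph of the maximal multiplication operator by `f`. -/
def mulGraph (f : ∀ n, Conf n → ℝ) : Submodule ℂ (Fock × Fock) where
  carrier := {z | ∀ n, fn z.2 n =ᵐ[volume] fun K => (f n K : ℂ) * fn z.1 n K}
  zero_mem' := by
    intro n
    filter_upwards [fn_zero n] with K h
    simp [h]
  add_mem' := by
    intro x y hx hy n
    filter_upwards [hx n, hy n, fn_add x.1 y.1 n, fn_add x.2 y.2 n] with K h1 h2 h3 h4
    simp [h1, h2, h3, h4, mul_add]
  smul_mem' := by
    intro c x hx n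
    filter_upwards [hx n, fn_smul c x.1 n, fn_smul c x.2 n] with K h1 h2 h3
    simp [h1, h2, h3, mul_left_comm]

theorem mulGraph_isGraph (f : ∀ n, Conf n → ℝ) :
    ∀ z ∈ mulGraph f, z.1 = 0 → z.2 = 0 := by
  rintro ⟨ψ, φ⟩ hz (rfl : ψ = 0)
  refine fn_ext fun n => ?_
  filter_upwards [hz n, fn_zero n] with K h1 h2
  simp [h1, h2]

/-- Multiplication by `f n` on the `n`-particle sector, `n ∈ ℕ₀`, on its maximal domain (those `ψ`
for which the product is again in Fock space). -/
def mulOp (f : ∀ n, Conf n → ℝ) : Op := (mulGraph f).toLinearPMap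

theorem mulOp_graph (f : ∀ n, Conf n → ℝ) : (mulOp f).graph = mulGraph f :=
  (mulGraph f).toLinearPMap_graph_eq (mulGraph_isGraph f)

/-! ### The annihilation operator -/

/-- Graph of the annihilation operator, defined wherever the integral converges absolutely and
yields an element of Fock space. -/
def annGraph (v : E3 → ℝ) : Submodule ℂ (Fock × Fock) where
  carrier := {z | ∀ n,
    (∀ᵐ K : Conf n, Integrable (fun ξ : E3 => (v ξ : ℂ) * fn z.1 (n + 1) (Fin.snoc K ξ))) ∧
    fn z.2 n =ᵐ[volume] fun K =>
      (Real.sqrt (n + 1) : ℂ) * ∫ ξ : E3, (v ξ : ℂ) * fn z.1 (n + 1) (Fin.snoc K ξ)}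
  zero_mem' := by
    intro n
    have h0 := ae_slice (fn_zero (n + 1))
    have h : ∀ᵐ K : Conf n,
        (fun ξ : E3 => (v ξ : ℂ) * fn 0 (n + 1) (Fin.snoc K ξ)) =ᵐ[volume] 0 := by
      filter_upwards [h0] with K hK
      filter_upwards [hK] with ξ hξ
      simp [hξ]
    refine ⟨?_, ?_⟩
    · filter_upwards [h] with K hK
      exact (integrable_zero _ _ _).congr hK.symm
    · filter_upwards [h, fn_zero n] with K hK h2
      simp only [Prod.fst_zero, Prod.snd_zero]
      rw [h2, integral_congr_ae hK]; simp
  add_mem' := by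
    intro x y hx hy n
    obtain ⟨ix, ex⟩ := hx n
    obtain ⟨iy, ey⟩ := hy n
    have h : ∀ᵐ K : Conf n,
        (fun ξ : E3 => (v ξ : ℂ) * fn (x.1 + y.1) (n + 1) (Fin.snoc K ξ)) =ᵐ[volume]
          fun ξ : E3 => (v ξ : ℂ) * fn x.1 (n + 1) (Fin.snoc K ξ)
            + (v ξ : ℂ) * fn y.1 (n + 1) (Fin.snoc K ξ) := by
      filter_upwards [ae_slice (fn_add x.1 y.1 (n + 1))] with K hK
      filter_upwards [hK] with ξ hξ
      simp [hξ, mul_add]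
    refine ⟨?_, ?_⟩
    · filter_upwards [h, ix, iy] with K hK h1 h2
      exact (h1.add h2).congr hK.symm
    · filter_upwards [h, ix, iy, ex, ey, fn_add x.2 y.2 n] with K hK h1 h2 h3 h4 h5
      simp only [Prod.fst_add, Prod.snd_add]
      rw [h5, integral_congr_ae hK, integral_add h1 h2, Pi.add_apply, h3, h4, mul_add]
  smul_mem' := by
    intro c x hx n
    obtain ⟨ix, ex⟩ := hx n
    have h : ∀ᵐ K : Conf n,
        (fun ξ : E3 => (v ξ : ℂ) * fn (c • x.1) (n + 1) (Fin.snoc K ξ)) =ᵐ[volume]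
          fun ξ : E3 => c * ((v ξ : ℂ) * fn x.1 (n + 1) (Fin.snoc K ξ)) := by
      filter_upwards [ae_slice (fn_smul c x.1 (n + 1))] with K hK
      filter_upwards [hK] with ξ hξ
      simp [hξ, mul_left_comm]
    refine ⟨?_, ?_⟩
    · filter_upwards [h, ix] with K hK h1
      exact (h1.const_mul c).congr hK.symm
    · filter_upwards [h, ex, fn_smul c x.2 n] with K hK h1 h2
      simp only [Prod.smul_fst, Prod.smul_snd]
      rw [h2, integral_congr_ae hK, integral_const_mul, Pi.smul_apply, h1, smul_eq_mul,
        mul_left_comm]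

theorem annGraph_isGraph (v : E3 → ℝ) : ∀ z ∈ annGraph v, z.1 = 0 → z.2 = 0 := by
  rintro ⟨ψ, φ⟩ hz (rfl : ψ = 0)
  refine fn_ext fun n => ?_
  filter_upwards [(hz n).2, ((annGraph v).zero_mem n).2, fn_zero n] with K h1 h2 h3
  simp only [Prod.fst_zero, Prod.snd_zero] at h1 h2
  rw [h1, ← h2]

/-- The annihilation operator
`(a(v)ψ)⁽ⁿ⁾(K) = √(n+1) ∫ v(ξ) ψ⁽ⁿ⁺¹⁾(K, ξ) dξ`. -/
def ann (v : E3 → ℝ) : Op := (annGraph v).toLinearPMap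

theorem ann_graph (v : E3 → ℝ) : (ann v).graph = annGraph v :=
  (annGraph v).toLinearPMap_graph_eq (annGraph_isGraph v)

/-! ### Off-diagonal integral operators -/

/-- Graph of the off-diagonal integral operator with kernels `κ`, defined wherever the integrals
converge absolutely and yield an element of Fock space. -/
def offGraph (κ : ∀ n, Conf n → Fin n → E3 → ℝ) : Submodule ℂ (Fock × Fock) where
  carrier := {z | fn z.2 0 =ᵐ[volume] 0 ∧ ∀ n,
    (∀ᵐ K : Conf (n + 1), ∀ j, Integrable (fun ξ : E3 =>
      (κ (n + 1) K j ξ : ℂ) * fn z.1 (n + 1) (Fin.snoc (j.removeNth K) ξ))) ∧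
    fn z.2 (n + 1) =ᵐ[volume] fun K => ∑ j, ∫ ξ : E3,
      (κ (n + 1) K j ξ : ℂ) * fn z.1 (n + 1) (Fin.snoc (j.removeNth K) ξ)}
  zero_mem' := by
    refine ⟨fn_zero 0, fun n => ?_⟩
    have h : ∀ᵐ K : Conf (n + 1), ∀ j : Fin (n + 1),
        (fun ξ : E3 => (κ (n + 1) K j ξ : ℂ) * fn 0 (n + 1) (Fin.snoc (j.removeNth K) ξ))
          =ᵐ[volume] 0 := by
      refine ae_all_iff.2 fun j => ?_
      filter_upwards [ae_remove j (ae_slice (fn_zero (n + 1)))] with K hK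
      filter_upwards [hK] with ξ hξ
      simp [hξ]
    refine ⟨?_, ?_⟩
    · filter_upwards [h] with K hK j
      exact (integrable_zero _ _ _).congr (hK j).symm
    · filter_upwards [h, fn_zero (n + 1)] with K hK h2
      simp only [Prod.fst_zero, Prod.snd_zero]
      rw [h2, Finset.sum_congr rfl fun j _ => integral_congr_ae (hK j)]; simp
  add_mem' := by
    rintro x y ⟨x0, hx⟩ ⟨y0, hy⟩
    refine ⟨?_, fun n => ?_⟩
    · filter_upwards [x0, y0, fn_add x.2 y.2 0] with K h1 h2 h3
      simp [h1, h2, h3]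
    obtain ⟨ix, ex⟩ := hx n
    obtain ⟨iy, ey⟩ := hy n
    have h : ∀ᵐ K : Conf (n + 1), ∀ j : Fin (n + 1),
        (fun ξ : E3 => (κ (n + 1) K j ξ : ℂ)
            * fn (x.1 + y.1) (n + 1) (Fin.snoc (j.removeNth K) ξ)) =ᵐ[volume]
          fun ξ : E3 => (κ (n + 1) K j ξ : ℂ) * fn x.1 (n + 1) (Fin.snoc (j.removeNth K) ξ)
            + (κ (n + 1) K j ξ : ℂ) * fn y.1 (n + 1) (Fin.snoc (j.removeNth K) ξ) := by
      refine ae_all_iff.2 fun j => ?_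
      filter_upwards [ae_remove j (ae_slice (fn_add x.1 y.1 (n + 1)))] with K hK
      filter_upwards [hK] with ξ hξ
      simp [hξ, mul_add]
    refine ⟨?_, ?_⟩
    · filter_upwards [h, ix, iy] with K hK h1 h2 j
      exact ((h1 j).add (h2 j)).congr (hK j).symm
    · filter_upwards [h, ix, iy, ex, ey, fn_add x.2 y.2 (n + 1)] with K hK h1 h2 h3 h4 h5
      simp only [Prod.fst_add, Prod.snd_add]
      rw [h5, Finset.sum_congr rfl fun j _ =>
        (integral_congr_ae (hK j)).trans (integral_add (h1 j) (h2 j)), Finset.sum_add_distrib,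
        Pi.add_apply, h3, h4]
  smul_mem' := by
    rintro c x ⟨x0, hx⟩
    refine ⟨?_, fun n => ?_⟩
    · filter_upwards [x0, fn_smul c x.2 0] with K h1 h2
      simp [h1, h2]
    obtain ⟨ix, ex⟩ := hx n
    have h : ∀ᵐ K : Conf (n + 1), ∀ j : Fin (n + 1),
        (fun ξ : E3 => (κ (n + 1) K j ξ : ℂ)
            * fn (c • x.1) (n + 1) (Fin.snoc (j.removeNth K) ξ)) =ᵐ[volume]
          fun ξ : E3 =>
            c * ((κ (n + 1) K j ξ : ℂ) * fn x.1 (n + 1) (Fin.snoc (j.removeNth K) ξ)) := by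
      refine ae_all_iff.2 fun j => ?_
      filter_upwards [ae_remove j (ae_slice (fn_smul c x.1 (n + 1)))] with K hK
      filter_upwards [hK] with ξ hξ
      simp [hξ, mul_left_comm]
    refine ⟨?_, ?_⟩
    · filter_upwards [h, ix] with K hK h1 j
      exact ((h1 j).const_mul c).congr (hK j).symm
    · filter_upwards [h, ex, fn_smul c x.2 (n + 1)] with K hK h1 h2
      simp only [Prod.smul_fst, Prod.smul_snd]
      rw [h2, Finset.sum_congr rfl fun j _ =>
        (integral_congr_ae (hK j)).trans (integral_const_mul c _), ← Finset.mul_sum,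
        Pi.smul_apply, h1, smul_eq_mul]

theorem offGraph_isGraph (κ : ∀ n, Conf n → Fin n → E3 → ℝ) :
    ∀ z ∈ offGraph κ, z.1 = 0 → z.2 = 0 := by
  rintro ⟨ψ, φ⟩ hz (rfl : ψ = 0)
  refine fn_ext fun n => ?_
  cases n with
  | zero =>
    filter_upwards [hz.1, fn_zero 0] with K h1 h2
    rw [h1, h2]
  | succ n =>
    filter_upwards [(hz.2 n).2, ((offGraph κ).zero_mem.2 n).2, fn_zero (n + 1)] with K h1 h2 h3
    simp only [Prod.fst_zero, Prod.snd_zero] at h1 h2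
    rw [h1, ← h2]

/-- The operator `(Aψ)⁽ⁿ⁾(K) = ∑ⱼ ∫ κₙ(K, j, ξ) ψ⁽ⁿ⁾(K̂ⱼ, ξ) dξ` for `n > 0` and `(Aψ)⁽⁰⁾ = 0`,
where `K̂ⱼ` is `K` with the entry `kⱼ` removed. -/
def offOp (κ : ∀ n, Conf n → Fin n → E3 → ℝ) : Op := (offGraph κ).toLinearPMap

theorem offOp_graph (κ : ∀ n, Conf n → Fin n → E3 → ℝ) : (offOp κ).graph = offGraph κ :=
  (offGraph κ).toLinearPMap_graph_eq (offGraph_isGraph κ)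

/-! ### The Nelson model at total momentum `P`

Parameters: boson mass `m ≥ 0`, coupling constant `g ∈ ℝ`, total momentum `P ∈ ℝ³`. -/

/-- Dispersion relation `ω(k) = √(k² + m²)`. -/
def omega (m : ℝ) (k : E3) : ℝ := Real.sqrt (‖k‖ ^ 2 + m ^ 2)

/-- Form factor `v(k) = g ω(k)^{-1/2}`. -/
def v (m g : ℝ) (k : E3) : ℝ := g * omega m k ^ (-(1 / 2) : ℝ)

/-- The symbol of `dΓ(ω)`: `∑ⱼ ω(kⱼ)`. -/
def Om (m : ℝ) (n : ℕ) (K : Conf n) : ℝ := ∑ j, omega m (K j)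

/-- `L_P(K) = (P - ∑ⱼ kⱼ)² + ∑ⱼ ω(kⱼ)`. -/
def L (m : ℝ) (P : E3) (n : ℕ) (K : Conf n) : ℝ := ‖P - ∑ j, K j‖ ^ 2 + Om m n K

/-- The integrand of `T_{d,λ}(K)`. -/
def TdIntegrand (m g : ℝ) (P : E3) (lam : ℝ) (n : ℕ) (K : Conf n) (ξ : E3) : ℝ :=
  |v m g ξ| ^ 2 * (1 / (‖ξ‖ ^ 2 + omega m ξ) - 1 / (L m P (n + 1) (Fin.snoc K ξ) + lam))

/-- The function `T_{d,λ}(K)`. -/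
def Td (m g : ℝ) (P : E3) (lam : ℝ) (n : ℕ) (K : Conf n) : ℝ :=
  ∫ ξ : E3, TdIntegrand m g P lam n K ξ

/-- `τ_{+,λ}(K)`, the positive part of `T_{d,λ}(K)`. -/
def tauPos (m g : ℝ) (P : E3) (lam : ℝ) (n : ℕ) (K : Conf n) : ℝ := max (Td m g P lam n K) 0

/-- `τ_{-,λ} = T_{d,λ} - τ_{+,λ} ≤ 0`. -/
def tauNeg (m g : ℝ) (P : E3) (lam : ℝ) (n : ℕ) (K : Conf n) : ℝ :=
  Td m g P lam n K - tauPos m g P lam n K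

/-- The off-diagonal kernel of `T_{od,λ}`. -/
def TodKernel (m g : ℝ) (P : E3) (lam : ℝ) (n : ℕ) (K : Conf n) (j : Fin n) (ξ : E3) : ℝ :=
  -(v m g ξ * v m g (K j) / (L m P (n + 1) (Fin.snoc K ξ) + lam))

/-- The integrand in `S_{d,λ}(K)`. -/
def SdIntegrand (m g : ℝ) (P : E3) (lam : ℝ) (n : ℕ) (K : Conf n) (ξ : E3) : ℝ :=
  |v m g ξ| ^ 2 * tauPos m g P lam (n + 1) (Fin.snoc K ξ) /
    ((L m P (n + 1) (Fin.snoc K ξ) + lam) *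
      (L m P (n + 1) (Fin.snoc K ξ) + tauPos m g P lam (n + 1) (Fin.snoc K ξ) + lam))

/-- The function by which `S_{d,λ}` multiplies. -/
def Sd (m g : ℝ) (P : E3) (lam : ℝ) (n : ℕ) (K : Conf n) : ℝ :=
  tauNeg m g P lam n K + ∫ ξ : E3, SdIntegrand m g P lam n K ξ

/-- The off-diagonal kernel of `S_{od,λ}`. -/
def SodKernel (m g : ℝ) (P : E3) (lam : ℝ) (n : ℕ) (K : Conf n) (j : Fin n) (ξ : E3) : ℝ :=
  -(v m g ξ * v m g (K j) /
    (L m P (n + 1) (Fin.snoc K ξ) + tauPos m g P lam (n + 1) (Fin.snoc K ξ) + lam))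

/-- The free operator `L_P` on its maximal domain. -/
def LOp (m : ℝ) (P : E3) : Op := mulOp (L m P)

/-- The operator `τ_{+,λ}` of multiplication by `τ_{+,λ}(K)`. -/
def tauPosOp (m g : ℝ) (P : E3) (lam : ℝ) : Op := mulOp (tauPos m g P lam)

/-- `G_λ^* = -a(v) (L_P + λ)⁻¹`. -/
def GStar (m g : ℝ) (P : E3) (lam : ℝ) : Op :=
  -comp (ann (v m g)) (mulOp fun n K => (L m P n K + lam)⁻¹)

/-- `G_λ`, the adjoint of `-a(v) (L_P + λ)⁻¹`. -/
def G (m g : ℝ) (P : E3) (lam : ℝ) : Op := (GStar m g P lam).adjoint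

/-- `F_λ^* = -a(v) (L_P + τ_{+,λ} + λ)⁻¹`. -/
def FStar (m g : ℝ) (P : E3) (lam : ℝ) : Op :=
  -comp (ann (v m g)) (mulOp fun n K => (L m P n K + tauPos m g P lam n K + lam)⁻¹)

/-- `F_λ`, the adjoint of `-a(v) (L_P + τ_{+,λ} + λ)⁻¹`. -/
def F (m g : ℝ) (P : E3) (lam : ℝ) : Op := (FStar m g P lam).adjoint

/-- `D(T_λ) = D(S_λ) = D(L_P^ε + dΓ(ω)^{1/2})`. -/
def DT (m : ℝ) (P : E3) (ε : ℝ) : Submodule ℂ Fock :=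
  (mulOp fun n K => L m P n K ^ ε + Real.sqrt (Om m n K)).domain

/-- `T_λ = T_{d,λ} + T_{od,λ}` on `D(L_P^ε + dΓ(ω)^{1/2})`. -/
def T (m g : ℝ) (P : E3) (ε lam : ℝ) : Op :=
  (mulOp (Td m g P lam) + offOp (TodKernel m g P lam)).domRestrict (DT m P ε)

/-- `S_λ = S_{d,λ} + S_{od,λ}` on `D(L_P^ε + dΓ(ω)^{1/2})`. -/
def S (m g : ℝ) (P : E3) (ε lam : ℝ) : Op :=
  (mulOp (Sd m g P lam) + offOp (SodKernel m g P lam)).domRestrict (DT m P ε)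

/-- The domain `D(H_P) = {ψ | (1 - G_λ) ψ ∈ D(L_P)}` given by the interior boundary condition. -/
def DH (m g : ℝ) (P : E3) (lam : ℝ) : Submodule ℂ Fock :=
  (comp (LOp m P) (one - G m g P lam)).domain

/-- The renormalised Nelson Hamiltonian
`H_P = (1 - G_λ)^* (L_P + λ) (1 - G_λ) + T_λ - λ`. -/
def H (m g : ℝ) (P : E3) (ε lam : ℝ) : Op :=
  comp (one - G m g P lam).adjoint
      (comp (LOp m P + (lam : ℂ) • one) (one - G m g P lam))
    + T m g P ε lam - (lam : ℂ) • one

/-- `(1 - F_λ)^* (L_P + τ_{+,λ} + λ) (1 - F_λ) + S_λ - λ`. -/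
def HF (m g : ℝ) (P : E3) (ε lam : ℝ) : Op :=
  comp (one - F m g P lam).adjoint
      (comp (LOp m P + tauPosOp m g P lam + (lam : ℂ) • one) (one - F m g P lam))
    + S m g P ε lam - (lam : ℂ) • one

end Nelson

end

/-!
Fix a symbol `W ≥ c (L_P + 1)` with `c > 0` (`IsWeight`), such as `L_P + μ` or `L_P + τ₊ + λ`. The
operator `-a(v) W⁻¹` is bounded, and its adjoint `G_W` is `-W⁻¹ a*(v)` (`exists_resStar_eq_ofCLM`,
`adjoint_resStar`), although `a*(v)` itself maps no vector but zero into Fock space unless `g = 0`.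
At the level of functions,

  `W (1 - G_W) ψ = W ψ + a*(v) ψ`,

and only the first term on the right depends on `W`. Hence, for two weights whose difference is
defined on `ψ`, the interior boundary condition `(1 - G_W) ψ ∈ D(W)` holds for both or for neither
(`mem_mulGraph_of_sub`), and the vectors `W (1 - G_W) ψ` differ by the difference of the weights
applied to `ψ`. Since `(1 - G_W)^* = 1 + a(v) W⁻¹`, the two representations of the Hamiltonian
differ, apart from these terms, by

  `a(v) ((1 - G) ψ - (1 - F) ψ) = a(v) ((L_P + μ)⁻¹ - (L_P + τ₊ + λ)⁻¹) a*(v) ψ`.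

Normal ordering (`fn_ann_crFun_succ`) splits this into a multiplication operator and an off-diagonal
integral operator. A partial fraction decomposition identifies the former with `S_d + τ₊ - T_d`
(`integral_v_sq_mul_invDiff`) and the latter with `S_od - T_od` (`offKernel_sub`); this is
`ann_sub_eq`, from which `sandwich_eq` and `H_eq_HF` follow.

The analysis consists in showing that all terms are defined separately.

* The diagonal functions grow more slowly than any positive power of `L_P` (`exists_abs_Td_le`,
  `exists_abs_Sd_le`), so that they multiply `D(L_P^ε)` into Fock space.
* The off-diagonal operators are defined on `D(dΓ(ω)^{1/2})` (`exists_offGraph`). This is a Schur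
  test with weight `|ξ|⁻¹ |q - ξ|^{-1/2}`, `q` being the total momentum `P` less that of the particles
  not taking part; the relevant integral is bounded uniformly by dilation invariance
  (`lintegral_schurKer_le`).
* Vectors satisfying the boundary condition belong to the domain of `T` and `S`
  (`mem_DT_of_boundary`). For `D(L_P^ε)` this holds because `L_P^ε W⁻¹ a*(v)` is bounded for
  `ε < 1/4` (`nsq_crFun_ne_top`). For `D(dΓ(ω)^{1/2})`, the weight is changed to `L_P + l⁴` with large
  `l`; then the form of `dΓ(ω)` in the sector with `n + 1` particles is at most half of that in the
  sector with `n` particles, up to summable terms (`tsum_omMass_ne_top`).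
-/

noncomputable section

namespace Nelson

/-! ### Integrals over momentum space -/

/-- The radial function `|x|^{-α} (x² + 1)^{-β}` on momentum space. -/
def radial (α β : ℝ) (x : E3) : ℝ := ‖x‖ ^ (-α) * (‖x‖ ^ 2 + 1) ^ (-β)

theorem radial_nonneg (α β : ℝ) (x : E3) : 0 ≤ radial α β x := by
  unfold radial; positivity

theorem integrable_radial {α β : ℝ} (h1 : α < 3) (h2 : 3 < α + 2 * β) :
    Integrable (radial α β) := by
  have hd : Module.finrank ℝ E3 = 3 := by simp
  have key := integrable_fun_norm_addHaar (volume : Measure E3)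
    (f := fun r : ℝ => r ^ (-α) * (r ^ 2 + 1) ^ (-β))
  rw [hd] at key
  refine key.2 ?_
  have hm : Measurable fun y : ℝ => y ^ (3 - 1) • (y ^ (-α) * (y ^ 2 + 1) ^ (-β)) := by
    fun_prop
  rw [← Set.Ioc_union_Ioi_eq_Ioi (zero_le_one' ℝ)]
  refine IntegrableOn.union ?_ ?_
  · have hi : IntegrableOn (fun y : ℝ => y ^ (2 - α)) (Set.Ioc 0 1) :=
      (intervalIntegrable_iff_integrableOn_Ioc_of_le zero_le_one).1
        (intervalIntegral.intervalIntegrable_rpow' (by linarith))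
    refine Integrable.mono' hi hm.aestronglyMeasurable ?_
    filter_upwards [ae_restrict_mem measurableSet_Ioc] with y hy
    have hy0 : 0 < y := hy.1
    rw [Real.norm_of_nonneg (by simp only [smul_eq_mul]; positivity), smul_eq_mul]
    have h3 : (y ^ 2 + 1) ^ (-β) ≤ 1 :=
      Real.rpow_le_one_of_one_le_of_nonpos (by nlinarith) (by linarith)
    have h4 : y ^ (2 - α) = y ^ 2 * y ^ (-α) := by
      rw [sub_eq_add_neg, Real.rpow_add hy0]; norm_num
    rw [h4]
    calc y ^ 2 * (y ^ (-α) * (y ^ 2 + 1) ^ (-β)) ≤ y ^ 2 * (y ^ (-α) * 1) := by gcongr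
      _ = _ := by ring
  · have hi : IntegrableOn (fun y : ℝ => y ^ (2 - α - 2 * β)) (Set.Ioi 1) :=
      integrableOn_Ioi_rpow_of_lt (by linarith) one_pos
    refine Integrable.mono' hi hm.aestronglyMeasurable ?_
    filter_upwards [ae_restrict_mem measurableSet_Ioi] with y hy
    have hy0 : 0 < y := one_pos.trans hy
    rw [Real.norm_of_nonneg (by simp only [smul_eq_mul]; positivity), smul_eq_mul]
    have h3 : (y ^ 2 + 1) ^ (-β) ≤ y ^ (-2 * β) := by
      calc (y ^ 2 + 1) ^ (-β) ≤ (y ^ 2) ^ (-β) :=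
            Real.rpow_le_rpow_of_nonpos (by positivity) (by linarith) (by linarith)
        _ = y ^ (-2 * β) := by
            rw [← Real.rpow_natCast, ← Real.rpow_mul hy0.le]; norm_num
    have h4 : y ^ (2 - α - 2 * β) = y ^ 2 * y ^ (-α) * y ^ (-2 * β) := by
      rw [show 2 - α - 2 * β = 2 + -α + -2 * β by ring, Real.rpow_add hy0, Real.rpow_add hy0]
      norm_num
    rw [h4]
    calc y ^ 2 * (y ^ (-α) * (y ^ 2 + 1) ^ (-β)) ≤ y ^ 2 * (y ^ (-α) * y ^ (-2 * β)) := by gcongr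
      _ = _ := by ring

/-- The integral of `|x|^{-α} (x² + 1)^{-β}`. -/
def radialInt (α β : ℝ) : ENNReal := ∫⁻ x : E3, ENNReal.ofReal (radial α β x)

theorem radialInt_ne_top {α β : ℝ} (h1 : α < 3) (h2 : 3 < α + 2 * β) :
    radialInt α β ≠ ⊤ := by
  have h := (integrable_radial h1 h2).lintegral_lt_top
  exact h.ne

theorem ae_ne (x : E3) : ∀ᵐ ξ : E3, ξ ≠ x := by
  simp [ae_iff]

theorem lintegral_sub_left (f : E3 → ENNReal) (q : E3) : ∫⁻ ξ, f (q - ξ) = ∫⁻ ξ, f ξ :=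
  lintegral_sub_left_eq_self f q

/-- Moving the centre of one of the two factors does not increase the integral by more than a
factor two, uniformly in the distance of the centres. -/
theorem lintegral_two_centre {α β : ℝ} (hα : 0 ≤ α) (hβ : 0 ≤ β) (q : E3) :
    ∫⁻ ξ : E3, ENNReal.ofReal (‖ξ‖ ^ (-α) * (‖q - ξ‖ ^ 2 + 1) ^ (-β)) ≤ 2 * radialInt α β := by
  have hm : Measurable fun ξ : E3 => ENNReal.ofReal (radial α β ξ) := by
    unfold radial; fun_prop
  calc ∫⁻ ξ : E3, ENNReal.ofReal (‖ξ‖ ^ (-α) * (‖q - ξ‖ ^ 2 + 1) ^ (-β))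
      ≤ ∫⁻ ξ : E3, (ENNReal.ofReal (radial α β ξ) + ENNReal.ofReal (radial α β (q - ξ))) := by
        refine lintegral_mono_ae ?_
        filter_upwards [ae_ne q] with ξ hξ
        have hy : 0 < ‖q - ξ‖ := norm_pos_iff.2 (sub_ne_zero.2 hξ.symm)
        rcases le_total ‖ξ‖ ‖q - ξ‖ with h | h
        · refine le_trans (ENNReal.ofReal_le_ofReal ?_) le_self_add
          unfold radial
          gcongr ?_ * ?_
          exact Real.rpow_le_rpow_of_nonpos (by positivity) (by gcongr) (by linarith)
        · refine le_trans (ENNReal.ofReal_le_ofReal ?_) le_add_self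
          unfold radial
          gcongr ?_ * ?_
          exact Real.rpow_le_rpow_of_nonpos hy h (by linarith)
    _ = 2 * radialInt α β := by
        rw [lintegral_add_left hm, lintegral_sub_left (fun ξ => ENNReal.ofReal (radial α β ξ)) q,
          two_mul]; rfl

theorem lintegral_dilation (f : E3 → ENNReal) (hf : Measurable f) {r : ℝ} (hr : 0 < r) :
    ∫⁻ x, f x = ENNReal.ofReal (r ^ 3) * ∫⁻ y : E3, f (r • y) := by
  have h := Measure.map_addHaar_smul (volume : Measure E3) hr.ne'
  have h2 : ∫⁻ y : E3, f (r • y) = ∫⁻ x, f x ∂(Measure.map (r • ·) (volume : Measure E3)) :=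
    (lintegral_map hf (by fun_prop)).symm
  rw [h2, h, lintegral_smul_measure, smul_eq_mul, ← mul_assoc, ← ENNReal.ofReal_mul (by positivity)]
  have hd : Module.finrank ℝ E3 = 3 := by simp
  rw [hd, abs_of_pos (by positivity), mul_inv_cancel₀ (by positivity)]
  simp

/-- A dilation-invariant normalisation of `|x|^{-a} (|x| + r)^{-b}`. -/
def dilated (a b r : ℝ) (x : E3) : ℝ := r ^ (a + b - 3) * (‖x‖ ^ (-a) * (‖x‖ + r) ^ (-b))

/-- The bound does not depend on `r`: a dilation reduces the claim to `r = 1`, and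
`x² + 1 ≤ (|x| + 1)²`. -/
theorem lintegral_dilated_le {a b r : ℝ} (hb : 0 ≤ b) (hr : 0 < r) :
    ∫⁻ x : E3, ENNReal.ofReal (dilated a b r x) ≤ radialInt a (b / 2) := by
  rw [lintegral_dilation _ (by unfold dilated; fun_prop) hr,
    ← lintegral_const_mul _ (by unfold dilated; fun_prop)]
  refine lintegral_mono fun y => ?_
  rw [← ENNReal.ofReal_mul (by positivity)]
  refine ENNReal.ofReal_le_ofReal ?_
  unfold dilated radial
  rw [norm_smul, Real.norm_of_nonneg hr.le, show r * ‖y‖ + r = r * (‖y‖ + 1) by ring,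
    Real.mul_rpow hr.le (norm_nonneg _), Real.mul_rpow hr.le (by positivity)]
  have h1 : r ^ 3 * (r ^ (a + b - 3) * (r ^ (-a) * ‖y‖ ^ (-a) * (r ^ (-b) * (‖y‖ + 1) ^ (-b))))
      = ‖y‖ ^ (-a) * (‖y‖ + 1) ^ (-b) := by
    have : r ^ 3 * r ^ (a + b - 3) * r ^ (-a) * r ^ (-b) = 1 := by
      rw [← Real.rpow_natCast, ← Real.rpow_add hr, ← Real.rpow_add hr, ← Real.rpow_add hr]
      norm_num
    linear_combination (‖y‖ ^ (-a) * (‖y‖ + 1) ^ (-b)) * this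
  rw [h1]
  gcongr ?_ * ?_
  have h2 : (‖y‖ + 1) ^ (-b) = ((‖y‖ + 1) ^ 2) ^ (-(b / 2)) := by
    rw [← Real.rpow_natCast, ← Real.rpow_mul (by positivity)]; norm_num
    congr 1; ring
  rw [h2]
  refine Real.rpow_le_rpow_of_nonpos (by positivity) ?_ (by linarith)
  nlinarith [norm_nonneg y]

/-- The kernel of the Schur test for the off-diagonal operators: it is
`1 / (|k| |ξ| |q - k - ξ|)` multiplied by the quotient `w(ξ) / w(k)` of the weights
`w(ξ) = |ξ|⁻¹ |q - ξ|^{-1/2}`. -/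
def schurKer (q k ξ : E3) : ℝ :=
  ‖q - k‖ ^ (1 / 2 : ℝ) *
    (‖ξ‖ ^ (-2 : ℝ) * ‖q - ξ‖ ^ (-(1 / 2) : ℝ) * ‖q - k - ξ‖ ^ (-1 : ℝ))

theorem schurKer_nonneg (q k ξ : E3) : 0 ≤ schurKer q k ξ := by
  unfold schurKer; positivity

/-- If `x + z ≥ 2 r`, one of `x`, `z` is at least `r`; the corresponding factor is replaced by a
power of its sum with `r`, and all others by powers of the least of `x`, `y`, `z`. -/
theorem three_centre_le {x y z r : ℝ} (hx : 0 < x) (hy : 0 < y) (hz : 0 < z) (hr : 0 < r)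
    (h : 2 * r ≤ x + z) {f g : ℝ → ℝ}
    (hf : f = fun t => t ^ (-(3 / 2) : ℝ) * (t + r) ^ (-2 : ℝ))
    (hg : g = fun t => t ^ (-(5 / 2) : ℝ) * (t + r) ^ (-1 : ℝ)) :
    x ^ (-2 : ℝ) * y ^ (-(1 / 2) : ℝ) * z ^ (-1 : ℝ) ≤
      4 * (f x + f y + f z) + 2 * (g x + g y + g z) := by
  have hf0 : ∀ t, 0 < t → 0 ≤ f t := by intro t ht; rw [hf]; positivity
  have hg0 : ∀ t, 0 < t → 0 ≤ g t := by intro t ht; rw [hg]; positivity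
  obtain ⟨t, ht, htx, hty, htz, htf, htg⟩ : ∃ t, 0 < t ∧ t ≤ x ∧ t ≤ y ∧ t ≤ z ∧
      f t ≤ f x + f y + f z ∧ g t ≤ g x + g y + g z := by
    have a1 := hf0 x hx; have a2 := hf0 y hy; have a3 := hf0 z hz
    have b1 := hg0 x hx; have b2 := hg0 y hy; have b3 := hg0 z hz
    rcases le_total x y with h1 | h1 <;> rcases le_total y z with h2 | h2 <;>
      rcases le_total x z with h3 | h3
    all_goals first
      | exact ⟨x, hx, le_rfl, by linarith, by linarith, by linarith, by linarith⟩
      | exact ⟨y, hy, by linarith, le_rfl, by linarith, by linarith, by linarith⟩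
      | exact ⟨z, hz, by linarith, by linarith, le_rfl, by linarith, by linarith⟩
  have anti : ∀ {s u c : ℝ}, 0 < s → s ≤ u → 0 ≤ c → u ^ (-c) ≤ s ^ (-c) := fun hs hu hc =>
    Real.rpow_le_rpow_of_nonpos hs hu (by linarith)
  have hfS : 0 ≤ f x + f y + f z := by
    linarith [hf0 x hx, hf0 y hy, hf0 z hz]
  have hgS : 0 ≤ g x + g y + g z := by
    linarith [hg0 x hx, hg0 y hy, hg0 z hz]
  rcases le_or_gt r x with hrx | hrx
  · have h1 : x ^ (-2 : ℝ) ≤ 4 * (t + r) ^ (-2 : ℝ) := by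
      calc x ^ (-2 : ℝ) ≤ ((t + r) / 2) ^ (-2 : ℝ) := anti (by positivity) (by linarith) two_pos.le
        _ = 4 * (t + r) ^ (-2 : ℝ) := by
          rw [Real.div_rpow (by positivity) two_pos.le, Real.rpow_neg two_pos.le]; norm_num; ring
    calc x ^ (-2 : ℝ) * y ^ (-(1 / 2) : ℝ) * z ^ (-1 : ℝ)
        ≤ (4 * (t + r) ^ (-2 : ℝ)) * t ^ (-(1 / 2) : ℝ) * t ^ (-1 : ℝ) := by
          exact mul_le_mul (mul_le_mul h1 (anti ht hty (by norm_num)) (by positivity)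
            (by positivity)) (anti ht htz (by norm_num)) (by positivity) (by positivity)
      _ = 4 * f t := by
          simp only [hf]; rw [show (-(3 / 2) : ℝ) = -(1 / 2) + -1 by norm_num, Real.rpow_add ht]; ring
      _ ≤ _ := by linarith
  · have h1 : z ^ (-1 : ℝ) ≤ 2 * (t + r) ^ (-1 : ℝ) := by
      calc z ^ (-1 : ℝ) ≤ ((t + r) / 2) ^ (-1 : ℝ) :=
            anti (by positivity) (by linarith) zero_le_one
        _ = 2 * (t + r) ^ (-1 : ℝ) := by
          rw [Real.div_rpow (by positivity) two_pos.le, Real.rpow_neg two_pos.le]; norm_num; ring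
    calc x ^ (-2 : ℝ) * y ^ (-(1 / 2) : ℝ) * z ^ (-1 : ℝ)
        ≤ t ^ (-2 : ℝ) * t ^ (-(1 / 2) : ℝ) * (2 * (t + r) ^ (-1 : ℝ)) := by
          exact mul_le_mul (mul_le_mul (anti ht htx (by norm_num)) (anti ht hty (by norm_num))
            (by positivity) (by positivity)) h1 (by positivity) (by positivity)
      _ = 2 * g t := by
          simp only [hg]; rw [show (-(5 / 2) : ℝ) = -2 + -(1 / 2) by norm_num, Real.rpow_add ht]; ring
      _ ≤ _ := by linarith

/-- The constant of the Schur test. -/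
def schurConst : ENNReal :=
  ENNReal.ofReal 8 * (3 * radialInt (3 / 2) 1) + ENNReal.ofReal 4 * (3 * radialInt (5 / 2) (1 / 2))

theorem schurConst_ne_top : schurConst ≠ ⊤ := by
  have h1 := radialInt_ne_top (α := 3 / 2) (β := 1) (by norm_num) (by norm_num)
  have h2 := radialInt_ne_top (α := 5 / 2) (β := 1 / 2) (by norm_num) (by norm_num)
  unfold schurConst
  finiteness

/-- The Schur test: the bound does not depend on `q` and `k`. With `r = |q - k| / 2`, the triangle
inequality gives `|ξ| + |q - k - ξ| ≥ 2 r`, so that `three_centre_le` applies, and the prefactor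
`|q - k|^{1/2}` supplies the power of `r` that makes the resulting integrals dilation invariant. -/
theorem lintegral_schurKer_le (q k : E3) :
    ∫⁻ ξ : E3, ENNReal.ofReal (schurKer q k ξ) ≤ schurConst := by
  -- for `k = q` the kernel vanishes, since `0 ^ (1 / 2) = 0`
  by_cases hp : q - k = 0
  · simp [schurKer, hp]
  set p := q - k with hpdef
  set r := ‖p‖ / 2 with hrdef
  have hr : 0 < r := by have := norm_pos_iff.2 hp; positivity
  have hm : ∀ a b, Measurable fun ξ : E3 => ENNReal.ofReal (dilated a b r ξ) := by
    intro a b; unfold dilated; fun_prop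
  have three : ∀ a b, 0 ≤ b → ∫⁻ ξ : E3, (ENNReal.ofReal (dilated a b r ξ)
      + ENNReal.ofReal (dilated a b r (q - ξ)) + ENNReal.ofReal (dilated a b r (p - ξ)))
        ≤ 3 * radialInt a (b / 2) := by
    intro a b hb
    have hm2 : ∀ q : E3, Measurable fun ξ : E3 => ENNReal.ofReal (dilated a b r (q - ξ)) :=
      fun q => (hm a b).comp (by fun_prop)
    rw [lintegral_add_right _ (hm2 p), lintegral_add_left (hm a b),
      lintegral_sub_left (fun ξ => ENNReal.ofReal (dilated a b r ξ)),
      lintegral_sub_left (fun ξ => ENNReal.ofReal (dilated a b r ξ))]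
    have := lintegral_dilated_le (a := a) hb hr
    calc _ ≤ radialInt a (b / 2) + radialInt a (b / 2) + radialInt a (b / 2) := by gcongr
      _ = _ := by ring
  calc ∫⁻ ξ : E3, ENNReal.ofReal (schurKer q k ξ)
      ≤ ∫⁻ ξ : E3, (ENNReal.ofReal 8 * (ENNReal.ofReal (dilated (3 / 2) 2 r ξ)
        + ENNReal.ofReal (dilated (3 / 2) 2 r (q - ξ))
        + ENNReal.ofReal (dilated (3 / 2) 2 r (p - ξ)))
        + ENNReal.ofReal 4 * (ENNReal.ofReal (dilated (5 / 2) 1 r ξ)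
        + ENNReal.ofReal (dilated (5 / 2) 1 r (q - ξ))
        + ENNReal.ofReal (dilated (5 / 2) 1 r (p - ξ)))) := by
        refine lintegral_mono_ae ?_
        filter_upwards [ae_ne 0, ae_ne q, ae_ne p] with ξ h0 h1 h2
        have hx : 0 < ‖ξ‖ := norm_pos_iff.2 h0
        have hy : 0 < ‖q - ξ‖ := norm_pos_iff.2 (sub_ne_zero.2 h1.symm)
        have hz : 0 < ‖p - ξ‖ := norm_pos_iff.2 (sub_ne_zero.2 h2.symm)
        have hd : ∀ a b x, 0 ≤ dilated a b r x := by intro a b x; unfold dilated; positivity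
        have tri : 2 * r ≤ ‖ξ‖ + ‖p - ξ‖ := by
          have := norm_add_le ξ (p - ξ)
          rw [add_sub_cancel] at this
          rw [hrdef]; linarith
        have key := three_centre_le hx hy hz hr tri rfl rfl
        rw [← ENNReal.ofReal_add (hd _ _ _) (hd _ _ _),
          ← ENNReal.ofReal_add (add_nonneg (hd _ _ _) (hd _ _ _)) (hd _ _ _),
          ← ENNReal.ofReal_add (hd _ _ _) (hd _ _ _),
          ← ENNReal.ofReal_add (add_nonneg (hd _ _ _) (hd _ _ _)) (hd _ _ _),
          ← ENNReal.ofReal_mul (by norm_num), ← ENNReal.ofReal_mul (by norm_num),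
          ← ENNReal.ofReal_add (by have := hd (3/2) 2; simp [add_nonneg, this])
            (by have := hd (5/2) 1; simp [add_nonneg, this])]
        refine ENNReal.ofReal_le_ofReal ?_
        have h2r : ‖p‖ ^ (1 / 2 : ℝ) ≤ 2 * r ^ (1 / 2 : ℝ) := by
          have e : ‖p‖ = 2 * r := by rw [hrdef]; ring
          rw [e, Real.mul_rpow two_pos.le hr.le]
          gcongr
          calc (2 : ℝ) ^ (1 / 2 : ℝ) ≤ 2 ^ (1 : ℝ) :=
                Real.rpow_le_rpow_of_exponent_le one_le_two (by norm_num)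
            _ = 2 := Real.rpow_one 2
        unfold schurKer dilated
        rw [← hpdef]
        norm_num at key ⊢
        calc _ ≤ 2 * r ^ (1 / 2 : ℝ) * _ :=
              mul_le_mul h2r key (by positivity) (by positivity)
          _ = _ := by ring
    _ ≤ schurConst := by
        have hm2 : ∀ a b (q : E3), Measurable fun ξ : E3 => ENNReal.ofReal (dilated a b r (q - ξ)) :=
          fun a b q => (hm a b).comp (by fun_prop)
        have hM : ∀ a b, Measurable fun ξ : E3 => (ENNReal.ofReal (dilated a b r ξ)
          + ENNReal.ofReal (dilated a b r (q - ξ)) + ENNReal.ofReal (dilated a b r (p - ξ))) :=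
          fun a b => ((hm a b).add (hm2 a b q)).add (hm2 a b p)
        rw [lintegral_add_left ((hM _ _).const_mul _), lintegral_const_mul _ (hM _ _),
          lintegral_const_mul _ (hM _ _)]
        unfold schurConst
        have h1 := three (3 / 2) 2 (by norm_num)
        have h2 := three (5 / 2) 1 (by norm_num)
        rw [show (2 : ℝ) / 2 = 1 by norm_num] at h1
        gcongr

/-! ### Permutations and removal of momenta -/

/-- The permutation that moves the `j`-th entry to the end. -/
theorem exists_perm_snoc_removeNth {n : ℕ} (j : Fin (n + 1)) : ∃ σ : Equiv.Perm (Fin (n + 1)),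
    ∀ K : Conf (n + 1), (Fin.snoc (j.removeNth K) (K j) : Conf (n + 1)) = K ∘ σ := by
  let s : Fin (n + 1) → Fin (n + 1) := Fin.lastCases j (fun i => j.succAbove i)
  have hs : Function.Injective s := by
    intro a b
    induction a using Fin.lastCases with
    | last =>
      induction b using Fin.lastCases with
      | last => simp
      | cast b => intro h; simp [s] at h
    | cast a =>
      induction b using Fin.lastCases with
      | last => intro h; simp [s] at h
      | cast b => simp [s]
  refine ⟨Equiv.ofBijective s (Finite.injective_iff_bijective.1 hs), fun K => ?_⟩
  funext i
  induction i using Fin.lastCases with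
  | last => simp [s]
  | cast i => simp [s, Fin.removeNth]

theorem exists_perm_snoc_comp {n : ℕ} (σ : Equiv.Perm (Fin n)) :
    ∃ σ' : Equiv.Perm (Fin (n + 1)), ∀ (K : Conf n) (ξ : E3),
      (Fin.snoc (K ∘ σ) ξ : Conf (n + 1)) = (Fin.snoc K ξ : Conf (n + 1)) ∘ σ' := by
  let s : Fin (n + 1) → Fin (n + 1) := Fin.lastCases (Fin.last n) (fun i => (σ i).castSucc)
  have hs : Function.Injective s := by
    intro a b
    induction a using Fin.lastCases with
    | last =>
      induction b using Fin.lastCases with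
      | last => simp
      | cast b => intro h; simp [s] at h; exact absurd h.symm (Fin.castSucc_lt_last _).ne
    | cast a =>
      induction b using Fin.lastCases with
      | last => intro h; simp [s] at h
      | cast b => simp [s]
  refine ⟨Equiv.ofBijective s (Finite.injective_iff_bijective.1 hs), fun K ξ => ?_⟩
  funext i
  induction i using Fin.lastCases with
  | last => simp [s]
  | cast i => simp [s]

theorem exists_perm_removeNth_comp {n : ℕ} (j : Fin (n + 1)) (σ : Equiv.Perm (Fin (n + 1))) :
    ∃ ρ : Equiv.Perm (Fin n), ∀ K : Conf (n + 1),
      j.removeNth (K ∘ σ) = (σ j).removeNth K ∘ ρ := by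
  have h : ∀ i : Fin n, ∃ i', (σ j).succAbove i' = σ (j.succAbove i) := fun i =>
    Fin.exists_succAbove_eq fun h => Fin.succAbove_ne j i (σ.injective h)
  choose s hs using h
  have hi : Function.Injective s := by
    intro a b hab
    have : σ (j.succAbove a) = σ (j.succAbove b) := by rw [← hs, ← hs, hab]
    exact Fin.succAbove_right_injective (σ.injective this)
  refine ⟨Equiv.ofBijective s (Finite.injective_iff_bijective.1 hi), fun K => ?_⟩
  funext i
  simp [Fin.removeNth, hs]

theorem removeNth_castSucc_snoc {n : ℕ} (j : Fin (n + 1)) (K : Conf (n + 1)) (ξ : E3) :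
    (j.castSucc).removeNth (Fin.snoc K ξ : Conf (n + 2)) = Fin.snoc (j.removeNth K) ξ := by
  funext i
  induction i using Fin.lastCases with
  | last => simp [Fin.removeNth]
  | cast i => 
    rw [Fin.removeNth, Fin.castSucc_succAbove_castSucc, Fin.snoc_castSucc, Fin.snoc_castSucc]
    rfl

theorem removeNth_last_snoc {n : ℕ} (K : Conf n) (ξ : E3) :
    (Fin.last n).removeNth (Fin.snoc K ξ : Conf (n + 1)) = K := by
  funext i
  simp [Fin.removeNth]

theorem measurable_snoc {n : ℕ} :
    Measurable fun z : Conf n × E3 => (Fin.snoc z.1 z.2 : Conf (n + 1)) :=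
  (Continuous.finSnoc continuous_fst continuous_snd).measurable

theorem measurable_snoc_right {n : ℕ} (K : Conf n) :
    Measurable fun ξ : E3 => (Fin.snoc K ξ : Conf (n + 1)) :=
  measurable_snoc.comp measurable_prodMk_left

theorem measurable_removeNth {n : ℕ} (j : Fin (n + 1)) :
    Measurable fun K : Conf (n + 1) => j.removeNth K :=
  measurable_pi_iff.2 fun _ => measurable_pi_apply _

/-! ### Integration over configurations -/

theorem lintegral_removeNth {n : ℕ} (j : Fin (n + 1)) {f : Conf n → E3 → ENNReal}
    (hf : Measurable fun z : Conf n × E3 => f z.1 z.2) :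
    ∫⁻ K : Conf (n + 1), f (j.removeNth K) (K j) = ∫⁻ K, ∫⁻ ξ, f K ξ := by
  have h := volume_preserving_piFinSuccAbove (fun _ : Fin (n + 1) => E3) j
  have hf' : Measurable fun z : E3 × Conf n => f z.2 z.1 := hf.comp measurable_swap
  have h2 := h.lintegral_comp hf'
  refine Eq.trans h2 ?_
  rw [Measure.volume_eq_prod]
  exact lintegral_prod_symm' _ hf'

/-- For a symmetric density, the total contribution of a one-particle observable is the number of
particles times the contribution of the last one. -/
theorem lintegral_sum_mul {n : ℕ} {a : E3 → ENNReal} (ha : Measurable a)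
    {H : Conf (n + 1) → ENNReal} (hH : Measurable H)
    (hs : ∀ σ : Equiv.Perm (Fin (n + 1)), (fun K => H (K ∘ σ)) =ᵐ[volume] H) :
    ∫⁻ K, (∑ j, a (K j)) * H K
      = (n + 1 : ENNReal) * ∫⁻ K : Conf n, ∫⁻ ξ, a ξ * H (Fin.snoc K ξ) := by
  have h1 : ∀ j : Fin (n + 1), ∫⁻ K : Conf (n + 1), a (K j) * H K
      = ∫⁻ K : Conf n, ∫⁻ ξ, a ξ * H (Fin.snoc K ξ) := by
    intro j
    rw [← lintegral_removeNth j (f := fun K ξ => a ξ * H (Fin.snoc K ξ))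
      ((ha.comp measurable_snd).mul (hH.comp measurable_snoc))]
    obtain ⟨σ, hσ⟩ := exists_perm_snoc_removeNth j
    refine lintegral_congr_ae ?_
    filter_upwards [hs σ] with K hK
    rw [hσ K, hK]
  simp_rw [Finset.sum_mul]
  have h2 : ∀ j : Fin (n + 1), Measurable fun K : Conf (n + 1) => a (K j) * H K := fun j =>
    (ha.comp (measurable_pi_apply j)).mul hH
  rw [lintegral_finsetSum _ fun j _ => h2 j]
  simp [h1]

theorem integral_removeNth {n : ℕ} (j : Fin (n + 1)) {f : Conf n → E3 → ℂ}
    (hf : Integrable fun K : Conf (n + 1) => f (j.removeNth K) (K j)) :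
    ∫ K : Conf (n + 1), f (j.removeNth K) (K j) = ∫ K, ∫ ξ, f K ξ := by
  have h := volume_preserving_piFinSuccAbove (fun _ : Fin (n + 1) => E3) j
  have e := MeasurableEquiv.measurableEmbedding
    (MeasurableEquiv.piFinSuccAbove (fun _ : Fin (n + 1) => E3) j)
  have h2 := h.integral_comp e (fun z : E3 × Conf n => f z.2 z.1)
  have h3 : Integrable (fun z : E3 × Conf n => f z.2 z.1) :=
    (h.integrable_comp_emb e).1 hf
  refine Eq.trans h2 ?_
  rw [Measure.volume_eq_prod] at h3 ⊢
  exact integral_prod_symm _ h3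

/-! ### Wavefunctions and vectors -/

/-- Measurable functions of configurations that are invariant under permutations. -/
structure IsSymbol (f : ∀ n, Conf n → ℝ) : Prop where
  meas : ∀ n, Measurable (f n)
  symm : ∀ n (σ : Equiv.Perm (Fin n)) K, f n (K ∘ σ) = f n K

theorem measurable_fn (ψ : Fock) (n : ℕ) : Measurable (fn ψ n) :=
  (Lp.stronglyMeasurable _).measurable

theorem fn_symm (ψ : Fock) (n : ℕ) (σ : Equiv.Perm (Fin n)) :
    (fun K => fn ψ n (K ∘ σ)) =ᵐ[volume] fn ψ n := (ψ n).2 σ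

theorem fn_sub (ψ φ : Fock) (n : ℕ) : fn (ψ - φ) n =ᵐ[volume] fn ψ n - fn φ n :=
  Lp.coeFn_sub _ _

theorem fn_neg (ψ : Fock) (n : ℕ) : fn (-ψ) n =ᵐ[volume] -fn ψ n :=
  Lp.coeFn_neg _

/-- The squared `L²` norm of a sequence of wavefunctions, possibly infinite. -/
def nsq (f : ∀ n, Conf n → ℂ) : ENNReal := ∑' n, ∫⁻ K, ‖f n K‖ₑ ^ 2

theorem nsq_congr {f h : ∀ n, Conf n → ℂ} (hfh : ∀ n, f n =ᵐ[volume] h n) : nsq f = nsq h := by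
  unfold nsq
  congr 1; funext n
  refine lintegral_congr_ae ?_
  filter_upwards [hfh n] with K hK
  rw [hK]

theorem eLpNorm_two_sq {α : Type*} [MeasurableSpace α] {μ : Measure α} (f : α → ℂ) :
    eLpNorm f 2 μ ^ 2 = ∫⁻ K, ‖f K‖ₑ ^ 2 ∂μ := by
  have := eLpNorm_nnreal_pow_eq_lintegral (f := f) (μ := μ) (p := 2) two_ne_zero
  simpa using this

theorem enorm_sector_sq (ψ : Fock) (n : ℕ) : ‖ψ n‖ₑ ^ 2 = ∫⁻ K, ‖fn ψ n K‖ₑ ^ 2 := by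
  rw [← eLpNorm_two_sq]
  congr 1
  have : ‖ψ n‖ₑ = ‖((ψ n : symL2 n) : Lp ℂ 2 (volume : Measure (Conf n)))‖ₑ := rfl
  rw [this, Lp.enorm_def]; rfl

theorem nsq_fn (ψ : Fock) : nsq (fn ψ) = ENNReal.ofReal (‖ψ‖ ^ 2) := by
  have h1 := lp.norm_rpow_eq_tsum (p := 2) (by norm_num) ψ
  have h2 := (lp.memℓp ψ).summable (by norm_num)
  norm_num at h1 h2
  rw [h1, ENNReal.ofReal_tsum_of_nonneg (fun n => by positivity) h2]
  unfold nsq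
  congr 1; funext n
  rw [← enorm_sector_sq, ENNReal.ofReal_pow (norm_nonneg _), ofReal_norm]
  rfl

theorem nsq_fn_ne_top (ψ : Fock) : nsq (fn ψ) ≠ ⊤ := by
  rw [nsq_fn]; exact ENNReal.ofReal_ne_top

/-- Symmetric wavefunctions of finite total norm define a Fock space vector. -/
theorem exists_fock {f : ∀ n, Conf n → ℂ} (hm : ∀ n, Measurable (f n))
    (hs : ∀ n (σ : Equiv.Perm (Fin n)), (fun K => f n (K ∘ σ)) =ᵐ[volume] f n)
    (hf : nsq f ≠ ⊤) : ∃ ψ : Fock, ∀ n, fn ψ n =ᵐ[volume] f n := by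
  have h1 : ∀ n, ∫⁻ K, ‖f n K‖ₑ ^ 2 ≠ ⊤ := fun n => ENNReal.ne_top_of_tsum_ne_top hf n
  have h2 : ∀ n, MemLp (f n) 2 := fun n => by
    refine ⟨(hm n).aestronglyMeasurable, lt_top_iff_ne_top.2 fun h => h1 n ?_⟩
    rw [← eLpNorm_two_sq, h]; rfl
  have h3 : ∀ n, (h2 n).toLp ∈ symL2 n := by
    intro n σ
    have e := (h2 n).coeFn_toLp
    filter_upwards [e, (mp_perm σ).quasiMeasurePreserving.ae e, hs n σ] with K a b c
    rw [a, b, c]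
  let x : ∀ n, symL2 n := fun n => ⟨(h2 n).toLp, h3 n⟩
  have hx : ∀ n, ‖x n‖ₑ ^ 2 = ∫⁻ K, ‖f n K‖ₑ ^ 2 := by
    intro n
    have : ‖x n‖ₑ = ‖(h2 n).toLp‖ₑ := rfl
    rw [this, Lp.enorm_toLp, eLpNorm_two_sq]
  have hmem : Memℓp x 2 := by
    refine memℓp_gen ?_
    have h4 : ∀ n, ‖x n‖ ^ (2 : ENNReal).toReal = (∫⁻ K, ‖f n K‖ₑ ^ 2).toReal := by
      intro n
      rw [← hx n]
      simp
    simp_rw [h4]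
    exact ENNReal.summable_toReal hf
  exact ⟨⟨x, hmem⟩, fun n => (h2 n).coeFn_toLp⟩

theorem exists_mul {f : ∀ n, Conf n → ℝ} (hf : IsSymbol f) {ψ : Fock}
    (h : nsq (fun n K => (f n K : ℂ) * fn ψ n K) ≠ ⊤) : ∃ χ, (ψ, χ) ∈ mulGraph f := by
  refine exists_fock (fun n => ?_) (fun n σ => ?_) h
  · exact (Complex.measurable_ofReal.comp (hf.meas n)).mul (measurable_fn ψ n)
  · filter_upwards [fn_symm ψ n σ] with K hK
    rw [hf.symm, hK]

theorem mem_mulOp_domain {f : ∀ n, Conf n → ℝ} {ψ : Fock} :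
    ψ ∈ (mulOp f).domain ↔ ∃ χ, (ψ, χ) ∈ mulGraph f := by
  rw [LinearPMap.mem_domain_iff, mulOp_graph]

theorem nsq_mul_ne_top {f : ∀ n, Conf n → ℝ} {ψ χ : Fock} (h : (ψ, χ) ∈ mulGraph f) :
    nsq (fun n K => (f n K : ℂ) * fn ψ n K) ≠ ⊤ := by
  rw [← nsq_congr h]; exact nsq_fn_ne_top χ

theorem nsq_mono {f h : ∀ n, Conf n → ℂ} {C : ℝ}
    (hC : ∀ n, ∀ᵐ K, ‖f n K‖ ≤ C * ‖h n K‖) : nsq f ≤ ENNReal.ofReal (C ^ 2) * nsq h := by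
  unfold nsq
  rw [← ENNReal.tsum_mul_left]
  refine ENNReal.tsum_le_tsum fun n => ?_
  rw [← lintegral_const_mul' _ _ ENNReal.ofReal_ne_top]
  refine lintegral_mono_ae ?_
  filter_upwards [hC n] with K hK
  rw [← ofReal_norm, ← ofReal_norm, ← ENNReal.ofReal_pow (norm_nonneg _),
    ← ENNReal.ofReal_pow (norm_nonneg _), ← ENNReal.ofReal_mul (sq_nonneg _), ← mul_pow]
  exact ENNReal.ofReal_le_ofReal (pow_le_pow_left₀ (norm_nonneg _) hK 2)

theorem nsq_add_ne_top {f h : ∀ n, Conf n → ℂ} (hhm : ∀ n, Measurable (h n))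
    (hf : nsq f ≠ ⊤) (hh : nsq h ≠ ⊤) : nsq (fun n K => f n K + h n K) ≠ ⊤ := by
  have : nsq (fun n K => f n K + h n K) ≤ 2 * nsq f + 2 * nsq h := by
    unfold nsq
    rw [← ENNReal.tsum_mul_left, ← ENNReal.tsum_mul_left, ← ENNReal.tsum_add]
    refine ENNReal.tsum_le_tsum fun n => ?_
    rw [← lintegral_const_mul' _ _ (by simp), ← lintegral_const_mul' _ _ (by simp),
      ← lintegral_add_right _ (((hhm n).enorm.pow_const 2).const_mul 2)]
    refine lintegral_mono fun K => ?_
    calc ‖f n K + h n K‖ₑ ^ 2 ≤ (‖f n K‖ₑ + ‖h n K‖ₑ) ^ 2 := by gcongr; exact enorm_add_le _ _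
      _ ≤ 2 * ‖f n K‖ₑ ^ 2 + 2 * ‖h n K‖ₑ ^ 2 := by
        rw [← mul_add]
        have := add_sq_le (a := ‖f n K‖₊) (b := ‖h n K‖₊)
        simp only [enorm_eq_nnnorm]
        exact_mod_cast this
  refine ne_top_of_le_ne_top ?_ this
  finiteness

/-- The domain of a multiplication operator contains that of every larger one. -/
theorem mulOp_domain_mono {f h : ∀ n, Conf n → ℝ} (hf : IsSymbol f) {ψ : Fock} (C : ℝ)
    (hC : ∀ n K, |f n K| ≤ C * |h n K|) (hψ : ψ ∈ (mulOp h).domain) : ψ ∈ (mulOp f).domain := by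
  obtain ⟨χ, hχ⟩ := mem_mulOp_domain.1 hψ
  refine mem_mulOp_domain.2 (exists_mul hf ?_)
  refine ne_top_of_le_ne_top ?_ (nsq_mono (C := C) (h := fun n K => (h n K : ℂ) * fn ψ n K)
    fun n => .of_forall fun K => ?_)
  · exact ENNReal.mul_ne_top ENNReal.ofReal_ne_top (nsq_mul_ne_top hχ)
  · rw [norm_mul, norm_mul, ← mul_assoc]
    gcongr
    simpa using hC n K

/-- The Cauchy–Schwarz inequality for a finite sum. -/
theorem sq_sum_le {ι : Type*} (s : Finset ι) (a p y : ι → ENNReal)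
    (h : ∀ j ∈ s, a j ^ 2 ≤ p j * y j) : (∑ j ∈ s, a j) ^ 2 ≤ (∑ j ∈ s, p j) * ∑ j ∈ s, y j := by
  have h2 : (2 : ℝ) ≠ 0 := two_ne_zero
  have h1 : ∀ j ∈ s, a j ≤ p j ^ (1 / 2 : ℝ) * y j ^ (1 / 2 : ℝ) := by
    intro j hj
    rw [← ENNReal.mul_rpow_of_nonneg _ _ (by norm_num)]
    calc a j = (a j ^ 2) ^ (1 / 2 : ℝ) := by
          rw [← ENNReal.rpow_natCast, ← ENNReal.rpow_mul]; norm_num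
      _ ≤ _ := by gcongr; exact h j hj
  have hc := ENNReal.inner_le_Lp_mul_Lq s (fun j => p j ^ (1 / 2 : ℝ)) (fun j => y j ^ (1 / 2 : ℝ))
    Real.HolderConjugate.two_two
  have hp : ∀ z : ENNReal, (z ^ (1 / 2 : ℝ)) ^ (2 : ℝ) = z := fun z => by
    rw [← ENNReal.rpow_mul]; norm_num
  simp_rw [hp] at hc
  calc (∑ j ∈ s, a j) ^ 2 ≤ ((∑ j ∈ s, p j) ^ (1 / 2 : ℝ) * (∑ j ∈ s, y j) ^ (1 / 2 : ℝ)) ^ 2 := by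
        gcongr
        exact (Finset.sum_le_sum h1).trans hc
    _ = _ := by
        rw [mul_pow, ← ENNReal.rpow_natCast, ← ENNReal.rpow_natCast]
        push_cast
        rw [hp, hp]

/-- The Cauchy–Schwarz inequality for an integral. -/
theorem sq_lintegral_le {α : Type*} [MeasurableSpace α] {μ : Measure α} {a p y : α → ENNReal}
    (hp : AEMeasurable p μ) (hy : AEMeasurable y μ) (h : ∀ᵐ x ∂μ, a x ^ 2 ≤ p x * y x) :
    (∫⁻ x, a x ∂μ) ^ 2 ≤ (∫⁻ x, p x ∂μ) * ∫⁻ x, y x ∂μ := by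
  have h1 : ∀ᵐ x ∂μ, a x ≤ p x ^ (1 / 2 : ℝ) * y x ^ (1 / 2 : ℝ) := by
    filter_upwards [h] with x hx
    rw [← ENNReal.mul_rpow_of_nonneg _ _ (by norm_num)]
    calc a x = (a x ^ 2) ^ (1 / 2 : ℝ) := by
          rw [← ENNReal.rpow_natCast, ← ENNReal.rpow_mul]; norm_num
      _ ≤ _ := by gcongr
  have hc := ENNReal.lintegral_mul_le_Lp_mul_Lq μ Real.HolderConjugate.two_two
    (hp.pow_const (1 / 2 : ℝ)) (hy.pow_const (1 / 2 : ℝ))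
  have hpp : ∀ z : ENNReal, (z ^ (1 / 2 : ℝ)) ^ (2 : ℝ) = z := fun z => by
    rw [← ENNReal.rpow_mul]; norm_num
  simp_rw [hpp] at hc
  calc (∫⁻ x, a x ∂μ) ^ 2
      ≤ ((∫⁻ x, p x ∂μ) ^ (1 / 2 : ℝ) * (∫⁻ x, y x ∂μ) ^ (1 / 2 : ℝ)) ^ 2 := by
        gcongr
        exact (lintegral_mono_ae h1).trans hc
    _ = _ := by
        rw [mul_pow, ← ENNReal.rpow_natCast, ← ENNReal.rpow_natCast]
        push_cast
        rw [hpp, hpp]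

/-! ### Dispersion relation, form factor and free symbol -/

theorem omega_nonneg (m : ℝ) (k : E3) : 0 ≤ omega m k := Real.sqrt_nonneg _

theorem norm_le_omega (m : ℝ) (k : E3) : ‖k‖ ≤ omega m k :=
  Real.le_sqrt_of_sq_le (le_add_of_nonneg_right (sq_nonneg m))

theorem omega_pos (m : ℝ) {k : E3} (hk : k ≠ 0) : 0 < omega m k :=
  (norm_pos_iff.2 hk).trans_le (norm_le_omega m k)

theorem measurable_omega (m : ℝ) : Measurable (omega m) := by
  unfold omega; fun_prop

theorem measurable_v (m g : ℝ) : Measurable (v m g) :=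
  ((measurable_omega m).pow_const _).const_mul g

theorem v_sq (m g : ℝ) (k : E3) : v m g k ^ 2 = g ^ 2 * (omega m k)⁻¹ := by
  unfold v
  rw [mul_pow, ← Real.rpow_natCast (omega m k ^ _), ← Real.rpow_mul (omega_nonneg m k)]
  norm_num [Real.rpow_neg_one]

/-- Also where `ω(k) = 0`: both sides vanish there, as `0⁻¹ = 0`. -/
theorem v_sq_eq (m g : ℝ) (k : E3) :
    v m g k ^ 2 = omega m k * (g ^ 2 * (omega m k ^ 2)⁻¹) := by
  rw [v_sq]
  by_cases h : omega m k = 0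
  · simp [h]
  · field_simp

theorem v_sq_le (m g : ℝ) {k : E3} (hk : k ≠ 0) : v m g k ^ 2 ≤ g ^ 2 * ‖k‖⁻¹ := by
  have := norm_pos_iff.2 hk
  rw [v_sq]
  gcongr
  exact norm_le_omega m k

theorem Om_nonneg (m : ℝ) (n : ℕ) (K : Conf n) : 0 ≤ Om m n K :=
  Finset.sum_nonneg fun j _ => omega_nonneg m (K j)

theorem Om_le_L (m : ℝ) (P : E3) (n : ℕ) (K : Conf n) : Om m n K ≤ L m P n K :=
  le_add_of_nonneg_left (sq_nonneg _)

theorem L_nonneg (m : ℝ) (P : E3) (n : ℕ) (K : Conf n) : 0 ≤ L m P n K :=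
  (Om_nonneg m n K).trans (Om_le_L m P n K)

theorem isSymbol_Om (m : ℝ) : IsSymbol (Om m) where
  meas n := by
    unfold Om
    exact Finset.measurable_fun_sum _ fun j _ => (measurable_omega m).comp (measurable_pi_apply j)
  symm n σ K := Equiv.sum_comp σ fun j => omega m (K j)

theorem isSymbol_L (m : ℝ) (P : E3) : IsSymbol (L m P) where
  meas n := by
    have := (isSymbol_Om m).meas n
    unfold L
    fun_prop
  symm n σ K := by
    unfold L
    rw [(isSymbol_Om m).symm]
    congr 4
    exact Equiv.sum_comp σ K

theorem IsSymbol.add {f h : ∀ n, Conf n → ℝ} (hf : IsSymbol f) (hh : IsSymbol h) :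
    IsSymbol fun n K => f n K + h n K where
  meas n := (hf.meas n).add (hh.meas n)
  symm n σ K := by rw [hf.symm, hh.symm]

theorem IsSymbol.sub {f h : ∀ n, Conf n → ℝ} (hf : IsSymbol f) (hh : IsSymbol h) :
    IsSymbol fun n K => f n K - h n K where
  meas n := (hf.meas n).sub (hh.meas n)
  symm n σ K := by rw [hf.symm, hh.symm]

theorem IsSymbol.comp {f : ∀ n, Conf n → ℝ} (hf : IsSymbol f) {φ : ℝ → ℝ} (hφ : Measurable φ) :
    IsSymbol fun n K => φ (f n K) where
  meas n := hφ.comp (hf.meas n)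
  symm n σ K := by rw [hf.symm]

theorem IsSymbol.add_const {f : ∀ n, Conf n → ℝ} (hf : IsSymbol f) (c : ℝ) :
    IsSymbol fun n K => f n K + c := hf.comp (measurable_id.add_const c)

theorem IsSymbol.snoc_symm {f : ∀ n, Conf n → ℝ} (hf : IsSymbol f) {n : ℕ}
    (σ : Equiv.Perm (Fin n)) (K : Conf n) (ξ : E3) :
    f (n + 1) (Fin.snoc (K ∘ σ) ξ) = f (n + 1) (Fin.snoc K ξ) := by
  obtain ⟨σ', hσ'⟩ := exists_perm_snoc_comp σ
  rw [hσ', hf.symm]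

/-- The integral over the last momentum of a symbol times a function of that momentum. -/
theorem IsSymbol.integral {f : ∀ n, Conf n → E3 → ℝ}
    (hm : ∀ n, Measurable fun z : Conf n × E3 => f n z.1 z.2)
    (hs : ∀ n (σ : Equiv.Perm (Fin n)) K ξ, f n (K ∘ σ) ξ = f n K ξ) :
    IsSymbol fun n K => ∫ ξ, f n K ξ where
  meas n := ((hm n).stronglyMeasurable.integral_prod_right').measurable
  symm n σ K := by simp_rw [hs]

theorem Om_snoc (m : ℝ) {n : ℕ} (K : Conf n) (ξ : E3) :
    Om m (n + 1) (Fin.snoc K ξ) = Om m n K + omega m ξ := by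
  unfold Om
  rw [Fin.sum_univ_castSucc]
  simp

theorem L_snoc (m : ℝ) (P : E3) {n : ℕ} (K : Conf n) (ξ : E3) :
    L m P (n + 1) (Fin.snoc K ξ) = ‖P - ∑ j, K j - ξ‖ ^ 2 + Om m n K + omega m ξ := by
  unfold L
  rw [Om_snoc, Fin.sum_univ_castSucc]
  simp [sub_sub, add_assoc]

/-- Any symbol may be evaluated with the `j`-th momentum moved to the end. -/
theorem IsSymbol.removeNth {f : ∀ n, Conf n → ℝ} (hf : IsSymbol f) {n : ℕ} (j : Fin (n + 1))
    (K : Conf (n + 1)) : f (n + 1) (Fin.snoc (j.removeNth K) (K j)) = f (n + 1) K := by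
  obtain ⟨σ, hσ⟩ := exists_perm_snoc_removeNth j
  rw [hσ, hf.symm]

theorem min_one_mul_le {x l : ℝ} (hx : 0 ≤ x) : min 1 l * (x + 1) ≤ x + l := by
  have h1 : min 1 l ≤ 1 := min_le_left _ _
  have h2 : min 1 l ≤ l := min_le_right _ _
  nlinarith

theorem le_max_one_mul {x l : ℝ} (hx : 0 ≤ x) : x + l ≤ max 1 l * (x + 1) := by
  have h1 : 1 ≤ max 1 l := le_max_left _ _
  have h2 : l ≤ max 1 l := le_max_right _ _
  nlinarith

/-! ### The diagonal terms -/

/-- Interpolation between the trivial bound `max (1/a) (1/b)` and the bound obtained from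
`|b - a| ≤ 2 M (√a + √b)`. -/
theorem abs_inv_sub_inv_le {a b M s : ℝ} (ha : 0 < a) (hb : 0 < b) (hM : 0 ≤ M)
    (h : |b - a| ≤ 2 * M * (Real.sqrt a + Real.sqrt b)) (hs : 0 ≤ s) (hs' : s ≤ 1 / 2) :
    |1 / a - 1 / b| ≤ (4 * M) ^ (2 * s) * (a ^ (-(1 + s)) + b ^ (-(1 + s))) := by
  wlog hab : a ≤ b generalizing a b
  · have := this hb ha (by rw [abs_sub_comm, add_comm]; exact h) (le_of_not_ge hab)
    rwa [abs_sub_comm, add_comm (b ^ _)] at this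
  have hsa : 0 < Real.sqrt a := Real.sqrt_pos.2 ha
  have hsb : Real.sqrt a ≤ Real.sqrt b := Real.sqrt_le_sqrt hab
  set u := 4 * M / Real.sqrt a with hu
  have hu0 : 0 ≤ u := by positivity
  have e : |1 / a - 1 / b| = 1 / a - 1 / b := by
    rw [abs_of_nonneg]
    exact sub_nonneg.2 (one_div_le_one_div_of_le ha hab)
  have h1 : |1 / a - 1 / b| ≤ 1 / a * 1 := by
    rw [e]
    have : 0 < 1 / b := by positivity
    linarith
  have h2 : |1 / a - 1 / b| ≤ 1 / a * u := by
    rw [abs_of_nonneg (sub_nonneg.2 hab)] at h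
    have h3 : b - a ≤ 4 * M * Real.sqrt b := by nlinarith
    have hb2 : b = Real.sqrt b * Real.sqrt b := (Real.mul_self_sqrt hb.le).symm
    have hsb0 : 0 < Real.sqrt b := hsa.trans_le hsb
    have e2 : 1 / a - 1 / b = 1 / a * ((b - a) / b) := by field_simp
    rw [e, e2, hu]
    have : (b - a) / b ≤ 4 * M / Real.sqrt b := by
      rw [div_le_div_iff₀ hb hsb0]
      calc (b - a) * Real.sqrt b ≤ 4 * M * Real.sqrt b * Real.sqrt b := by gcongr
        _ = 4 * M * b := by rw [mul_assoc, ← hb2]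
    refine mul_le_mul_of_nonneg_left (this.trans ?_) (by positivity)
    gcongr
  have h4 : |1 / a - 1 / b| ≤ 1 / a * u ^ (2 * s) := by
    rcases le_total u 1 with hu1 | hu1
    · refine h2.trans (by
        gcongr
        rcases hu0.eq_or_lt with h0 | h0
        · rw [← h0]; positivity
        · calc u = u ^ (1 : ℝ) := (Real.rpow_one u).symm
            _ ≤ u ^ (2 * s) := Real.rpow_le_rpow_of_exponent_ge h0 hu1 (by linarith))
    · refine h1.trans (by
        gcongr
        exact Real.one_le_rpow hu1 (by linarith))
  have e3 : 1 / a * u ^ (2 * s) = (4 * M) ^ (2 * s) * a ^ (-(1 + s)) := by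
    rw [hu, Real.div_rpow (by positivity) hsa.le, Real.sqrt_eq_rpow, ← Real.rpow_mul ha.le,
      show -(1 + s) = -1 + -(1 / 2 * (2 * s)) by ring, Real.rpow_add ha, Real.rpow_neg ha.le,
      Real.rpow_neg ha.le, Real.rpow_one]
    ring
  rw [e3] at h4
  have : 0 ≤ (4 * M) ^ (2 * s) * b ^ (-(1 + s)) := by positivity
  linarith

/-- The denominators `a = ξ² + ω(ξ)` and `b = L_P(K, ξ) + λ` satisfy `|b - a| ≤ 2 M (√a + √b)` with
`M = (L_P(K) + λ)^{1/2}`. By `abs_inv_sub_inv_le`, a growth `M^{2s}` buys an additional decay of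
order `2s`, which for `s > 0` makes the integral converge at infinity. -/
theorem abs_TdIntegrand_le {m g : ℝ} {P : E3} {lam : ℝ} (hlam : 0 < lam) {s : ℝ} (hs : 0 ≤ s)
    (hs' : s ≤ 1 / 2) (n : ℕ) (K : Conf n) {ξ : E3} (hξ : ξ ≠ 0) :
    |TdIntegrand m g P lam n K ξ| ≤ g ^ 2 * (4 * Real.sqrt (L m P n K + lam)) ^ (2 * s) *
      (radial (2 + s) ((1 + s) / 2) ξ + (min 1 lam) ^ (-(1 + s)) *
        (‖ξ‖ ^ (-1 : ℝ) * (‖P - ∑ j, K j - ξ‖ ^ 2 + 1) ^ (-(1 + s)))) := by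
  set q := P - ∑ j, K j with hq
  set M := Real.sqrt (L m P n K + lam) with hM
  have hx : 0 < ‖ξ‖ := norm_pos_iff.2 hξ
  have hω := norm_le_omega m ξ
  have hω0 := omega_nonneg m ξ
  have hOm := Om_nonneg m n K
  have hc : 0 < min 1 lam := lt_min one_pos hlam
  set a := ‖ξ‖ ^ 2 + omega m ξ with ha
  set b := L m P (n + 1) (Fin.snoc K ξ) + lam with hb
  have hb' : b = ‖q - ξ‖ ^ 2 + Om m n K + omega m ξ + lam := by rw [hb, L_snoc]
  have ha0 : 0 < a := by positivity
  have hb0 : 0 < b := by rw [hb']; positivity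
  have hM2 : M ^ 2 = ‖q‖ ^ 2 + Om m n K + lam := by
    rw [hM, Real.sq_sqrt (by have := L_nonneg m P n K; positivity)]; rfl
  have hM0 : 0 ≤ M := Real.sqrt_nonneg _
  have hsa : ‖ξ‖ ≤ Real.sqrt a := Real.le_sqrt_of_sq_le (by rw [ha]; linarith)
  have hsb : ‖q - ξ‖ ≤ Real.sqrt b := Real.le_sqrt_of_sq_le (by rw [hb']; linarith)
  have hqM : ‖q‖ ≤ M := by nlinarith [norm_nonneg q]
  have key : |b - a| ≤ 2 * M * (Real.sqrt a + Real.sqrt b) := by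
    have h1 : |‖q - ξ‖ - ‖ξ‖| ≤ ‖q‖ := by
      have h := abs_norm_sub_norm_le (q - ξ) (-ξ)
      rw [norm_neg] at h
      simpa using h
    have h2 : |‖q - ξ‖ ^ 2 - ‖ξ‖ ^ 2| ≤ M * (Real.sqrt a + Real.sqrt b) := by
      rw [sq_sub_sq, abs_mul, abs_of_nonneg (by positivity : 0 ≤ ‖q - ξ‖ + ‖ξ‖), mul_comm]
      refine mul_le_mul (h1.trans hqM) (by linarith) (by positivity) hM0
    have h3 : Om m n K + lam ≤ M * Real.sqrt b := by
      have h4 : Real.sqrt (Om m n K + lam) ≤ M :=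
        Real.sqrt_le_sqrt (by have := Om_le_L m P n K; linarith)
      have h5 : Real.sqrt (Om m n K + lam) ≤ Real.sqrt b :=
        Real.sqrt_le_sqrt (by rw [hb']; nlinarith [sq_nonneg ‖q - ξ‖])
      calc Om m n K + lam = Real.sqrt (Om m n K + lam) * Real.sqrt (Om m n K + lam) :=
            (Real.mul_self_sqrt (by positivity)).symm
        _ ≤ _ := mul_le_mul h4 h5 (Real.sqrt_nonneg _) hM0
    have e : b - a = (‖q - ξ‖ ^ 2 - ‖ξ‖ ^ 2) + (Om m n K + lam) := by rw [hb', ha]; ring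
    rw [e]
    refine (abs_add_le _ _).trans ?_
    rw [abs_of_nonneg (by positivity : 0 ≤ Om m n K + lam)]
    nlinarith [mul_nonneg hM0 (Real.sqrt_nonneg a)]
  have hmain := abs_inv_sub_inv_le ha0 hb0 hM0 key hs hs'
  have hA : ‖ξ‖ ^ (-1 : ℝ) * a ^ (-(1 + s)) ≤ radial (2 + s) ((1 + s) / 2) ξ := by
    have h1 : ‖ξ‖ * (‖ξ‖ + 1) ≤ a := by rw [ha]; nlinarith
    have h2 : a ^ (-(1 + s)) ≤ ‖ξ‖ ^ (-(1 + s)) * (‖ξ‖ + 1) ^ (-(1 + s)) := by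
      rw [← Real.mul_rpow hx.le (by positivity)]
      exact Real.rpow_le_rpow_of_nonpos (by positivity) h1 (by linarith)
    have h3 : (‖ξ‖ + 1) ^ (-(1 + s)) ≤ (‖ξ‖ ^ 2 + 1) ^ (-((1 + s) / 2)) := by
      have : (‖ξ‖ + 1) ^ (-(1 + s)) = ((‖ξ‖ + 1) ^ 2) ^ (-((1 + s) / 2)) := by
        rw [← Real.rpow_natCast, ← Real.rpow_mul (by positivity)]
        congr 1; push_cast; ring
      rw [this]
      exact Real.rpow_le_rpow_of_nonpos (by positivity) (by nlinarith) (by linarith)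
    calc ‖ξ‖ ^ (-1 : ℝ) * a ^ (-(1 + s))
        ≤ ‖ξ‖ ^ (-1 : ℝ) * (‖ξ‖ ^ (-(1 + s)) * (‖ξ‖ ^ 2 + 1) ^ (-((1 + s) / 2))) := by
          gcongr ?_ * ?_
          exact h2.trans (by gcongr ?_ * ?_)
      _ = _ := by
          unfold radial
          rw [← mul_assoc, ← Real.rpow_add hx]
          congr 2; ring
  have hB : b ^ (-(1 + s)) ≤ (min 1 lam) ^ (-(1 + s)) * (‖q - ξ‖ ^ 2 + 1) ^ (-(1 + s)) := by
    rw [← Real.mul_rpow hc.le (by positivity)]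
    refine Real.rpow_le_rpow_of_nonpos (by positivity) ?_ (by linarith)
    refine (min_one_mul_le (l := lam) (sq_nonneg _)).trans ?_
    rw [hb']; linarith
  unfold TdIntegrand
  rw [abs_mul, abs_of_nonneg (sq_nonneg _), sq_abs, ← ha, ← hb]
  calc v m g ξ ^ 2 * |1 / a - 1 / b|
      ≤ (g ^ 2 * ‖ξ‖ ^ (-1 : ℝ)) * ((4 * M) ^ (2 * s) * (a ^ (-(1 + s)) + b ^ (-(1 + s)))) := by
        rw [Real.rpow_neg_one]
        exact mul_le_mul (v_sq_le m g hξ) hmain (abs_nonneg _) (by positivity)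
    _ = g ^ 2 * (4 * M) ^ (2 * s) *
        (‖ξ‖ ^ (-1 : ℝ) * a ^ (-(1 + s)) + ‖ξ‖ ^ (-1 : ℝ) * b ^ (-(1 + s))) := by ring
    _ ≤ g ^ 2 * (4 * M) ^ (2 * s) * (radial (2 + s) ((1 + s) / 2) ξ + ‖ξ‖ ^ (-1 : ℝ) *
        ((min 1 lam) ^ (-(1 + s)) * (‖q - ξ‖ ^ 2 + 1) ^ (-(1 + s)))) := by
        gcongr ?_ * (?_ + ?_ * ?_)
    _ = _ := by ring

theorem measurable_L_snoc (m : ℝ) (P : E3) (n : ℕ) :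
    Measurable fun z : Conf n × E3 => L m P (n + 1) (Fin.snoc z.1 z.2) :=
  ((isSymbol_L m P).meas (n + 1)).comp measurable_snoc

theorem measurable_TdIntegrand (m g : ℝ) (P : E3) (lam : ℝ) (n : ℕ) :
    Measurable fun z : Conf n × E3 => TdIntegrand m g P lam n z.1 z.2 := by
  have h1 := measurable_L_snoc m P n
  have h2 : Measurable fun z : Conf n × E3 => v m g z.2 := (measurable_v m g).comp measurable_snd
  have h3 : Measurable fun z : Conf n × E3 => omega m z.2 :=
    (measurable_omega m).comp measurable_snd
  have h4 : Measurable fun z : Conf n × E3 => |v m g z.2| := by fun_prop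
  unfold TdIntegrand
  fun_prop

theorem isSymbol_Td (m g : ℝ) (P : E3) (lam : ℝ) : IsSymbol (Td m g P lam) :=
  IsSymbol.integral (measurable_TdIntegrand m g P lam) fun n σ K ξ => by
    unfold TdIntegrand
    rw [(isSymbol_L m P).snoc_symm]

theorem isSymbol_tauPos (m g : ℝ) (P : E3) (lam : ℝ) : IsSymbol (tauPos m g P lam) :=
  (isSymbol_Td m g P lam).comp (measurable_id.max measurable_const)

theorem isSymbol_tauNeg (m g : ℝ) (P : E3) (lam : ℝ) : IsSymbol (tauNeg m g P lam) :=
  (isSymbol_Td m g P lam).sub (isSymbol_tauPos m g P lam)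

theorem tauPos_nonneg (m g : ℝ) (P : E3) (lam : ℝ) (n : ℕ) (K : Conf n) :
    0 ≤ tauPos m g P lam n K := le_max_right _ _

theorem tauPos_le_abs (m g : ℝ) (P : E3) (lam : ℝ) (n : ℕ) (K : Conf n) :
    tauPos m g P lam n K ≤ |Td m g P lam n K| := max_le (le_abs_self _) (abs_nonneg _)

theorem abs_tauNeg_le (m g : ℝ) (P : E3) (lam : ℝ) (n : ℕ) (K : Conf n) :
    |tauNeg m g P lam n K| ≤ |Td m g P lam n K| := by
  unfold tauNeg tauPos
  rcases le_total (Td m g P lam n K) 0 with h | h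
  · simp [h]
  · simp [h]

/-- `T_{d,λ}` grows more slowly than every positive power of `L_P`. -/
theorem exists_lintegral_TdIntegrand_le (m g : ℝ) (P : E3) {lam : ℝ} (hlam : 0 < lam) {s : ℝ}
    (hs : 0 < s) (hs' : s ≤ 1 / 2) : ∃ C : ℝ, 0 ≤ C ∧ ∀ n (K : Conf n),
      ∫⁻ ξ, ‖TdIntegrand m g P lam n K ξ‖ₑ ≤ ENNReal.ofReal (C * (L m P n K + 1) ^ s) := by
  have hR1 := radialInt_ne_top (α := 2 + s) (β := (1 + s) / 2) (by linarith) (by linarith)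
  have hR2 := radialInt_ne_top (α := 1) (β := 1 + s) (by linarith) (by linarith)
  set c : ℝ := (min 1 lam) ^ (-(1 + s)) with hc
  have hc0 : 0 ≤ c := by have := lt_min one_pos hlam; positivity
  set R : ENNReal := radialInt (2 + s) ((1 + s) / 2) + ENNReal.ofReal c * (2 * radialInt 1 (1 + s))
    with hR
  have hRt : R ≠ ⊤ := by rw [hR]; finiteness
  refine ⟨g ^ 2 * (16 * max 1 lam) ^ s * R.toReal, by positivity, fun n K => ?_⟩
  have hL := L_nonneg m P n K
  set A := g ^ 2 * (4 * Real.sqrt (L m P n K + lam)) ^ (2 * s) with hA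
  have hAle : A ≤ g ^ 2 * (16 * max 1 lam) ^ s * (L m P n K + 1) ^ s := by
    have h4 : (4 * Real.sqrt (L m P n K + lam)) ^ (2 * s) = (16 * (L m P n K + lam)) ^ s := by
      rw [Real.rpow_mul (by positivity), Real.rpow_two, mul_pow, Real.sq_sqrt (by positivity)]
      norm_num
    rw [hA, h4, mul_assoc, ← Real.mul_rpow (by positivity) (by positivity)]
    gcongr ?_ * ?_ ^ _
    have := le_max_one_mul (l := lam) hL
    linarith
  calc ∫⁻ ξ, ‖TdIntegrand m g P lam n K ξ‖ₑ
      ≤ ∫⁻ ξ : E3, ENNReal.ofReal A * (ENNReal.ofReal (radial (2 + s) ((1 + s) / 2) ξ) +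
        ENNReal.ofReal c * ENNReal.ofReal
          (‖ξ‖ ^ (-1 : ℝ) * (‖P - ∑ j, K j - ξ‖ ^ 2 + 1) ^ (-(1 + s)))) := by
        refine lintegral_mono_ae ?_
        filter_upwards [ae_ne 0] with ξ hξ
        rw [← ofReal_norm, ← ENNReal.ofReal_mul hc0,
          ← ENNReal.ofReal_add (radial_nonneg _ _ _) (by positivity),
          ← ENNReal.ofReal_mul (by positivity), Real.norm_eq_abs]
        exact ENNReal.ofReal_le_ofReal (abs_TdIntegrand_le hlam hs.le hs' n K hξ)
    _ ≤ ENNReal.ofReal A * R := by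
        rw [lintegral_const_mul _ (by unfold radial; fun_prop),
          lintegral_add_left (by unfold radial; fun_prop), lintegral_const_mul _ (by fun_prop)]
        exact mul_le_mul' le_rfl (add_le_add le_rfl (mul_le_mul' le_rfl
          (lintegral_two_centre (α := 1) (β := 1 + s) zero_le_one (by linarith) _)))
    _ ≤ _ := by
        rw [← ENNReal.ofReal_toReal hRt, ← ENNReal.ofReal_mul (by positivity)]
        refine ENNReal.ofReal_le_ofReal ?_
        rw [ENNReal.toReal_ofReal ENNReal.toReal_nonneg]
        nlinarith [mul_le_mul_of_nonneg_right hAle (ENNReal.toReal_nonneg (a := R))]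

theorem integrable_TdIntegrand (m g : ℝ) (P : E3) {lam : ℝ} (hlam : 0 < lam) (n : ℕ)
    (K : Conf n) : Integrable (TdIntegrand m g P lam n K) := by
  obtain ⟨C, -, hC⟩ := exists_lintegral_TdIntegrand_le m g P hlam one_half_pos le_rfl
  exact ⟨((measurable_TdIntegrand m g P lam n).comp measurable_prodMk_left).aestronglyMeasurable,
    (hC n K).trans_lt ENNReal.ofReal_lt_top⟩

theorem exists_abs_Td_le (m g : ℝ) (P : E3) {lam : ℝ} (hlam : 0 < lam) {s : ℝ}
    (hs : 0 < s) (hs' : s ≤ 1 / 2) : ∃ C : ℝ, 0 ≤ C ∧ ∀ n (K : Conf n),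
      |Td m g P lam n K| ≤ C * (L m P n K + 1) ^ s := by
  obtain ⟨C, hC0, hC⟩ := exists_lintegral_TdIntegrand_le m g P hlam hs hs'
  refine ⟨C, hC0, fun n K => ?_⟩
  have h := (enorm_integral_le_lintegral_enorm (TdIntegrand m g P lam n K)).trans (hC n K)
  rw [← ofReal_norm] at h
  have hL := L_nonneg m P n K
  exact (ENNReal.ofReal_le_ofReal_iff (by positivity)).1 h

theorem measurable_SdIntegrand (m g : ℝ) (P : E3) (lam : ℝ) (n : ℕ) :
    Measurable fun z : Conf n × E3 => SdIntegrand m g P lam n z.1 z.2 := by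
  have h1 := measurable_L_snoc m P n
  have h2 : Measurable fun z : Conf n × E3 => |v m g z.2| := by
    have : Measurable fun z : Conf n × E3 => v m g z.2 := (measurable_v m g).comp measurable_snd
    fun_prop
  have h3 : Measurable fun z : Conf n × E3 => tauPos m g P lam (n + 1) (Fin.snoc z.1 z.2) :=
    ((isSymbol_tauPos m g P lam).meas (n + 1)).comp measurable_snoc
  unfold SdIntegrand
  fun_prop

theorem exists_lintegral_SdIntegrand_le (m g : ℝ) (P : E3) {lam : ℝ} (hlam : 0 < lam) :
    ∃ C : ℝ, 0 ≤ C ∧ ∀ n (K : Conf n),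
      ∫⁻ ξ, ‖SdIntegrand m g P lam n K ξ‖ₑ ≤ ENNReal.ofReal C := by
  obtain ⟨C, hC0, hC⟩ := exists_abs_Td_le m g P hlam (s := 1 / 4) (by norm_num) (by norm_num)
  have hR := radialInt_ne_top (α := 1) (β := 7 / 4) (by norm_num) (by norm_num)
  have hc := lt_min one_pos hlam
  set c := min 1 lam with hcdef
  set A := g ^ 2 * C * (c ^ 2)⁻¹ with hA
  refine ⟨A * (2 * radialInt 1 (7 / 4)).toReal, by positivity, fun n K => ?_⟩
  calc ∫⁻ ξ, ‖SdIntegrand m g P lam n K ξ‖ₑ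
      ≤ ∫⁻ ξ : E3, ENNReal.ofReal A * ENNReal.ofReal
          (‖ξ‖ ^ (-1 : ℝ) * (‖P - ∑ j, K j - ξ‖ ^ 2 + 1) ^ (-(7 / 4) : ℝ)) := by
        refine lintegral_mono_ae ?_
        filter_upwards [ae_ne 0] with ξ hξ
        rw [← ofReal_norm, ← ENNReal.ofReal_mul (by positivity)]
        refine ENNReal.ofReal_le_ofReal ?_
        unfold SdIntegrand
        set ℓ := L m P (n + 1) (Fin.snoc K ξ) with hℓ
        set τ := tauPos m g P lam (n + 1) (Fin.snoc K ξ) with hτ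
        have hℓ0 : 0 ≤ ℓ := L_nonneg m P _ _
        have hτ0 : 0 ≤ τ := tauPos_nonneg m g P lam _ _
        have hτle : τ ≤ C * (ℓ + 1) ^ (1 / 4 : ℝ) := (tauPos_le_abs m g P lam _ _).trans (hC _ _)
        have h1 : c * (ℓ + 1) ≤ ℓ + lam := min_one_mul_le hℓ0
        have h2 : ‖P - ∑ j, K j - ξ‖ ^ 2 + 1 ≤ ℓ + 1 := by
          rw [hℓ, L_snoc]
          linarith [Om_nonneg m n K, omega_nonneg m ξ]
        have hx := norm_pos_iff.2 hξ
        rw [Real.norm_of_nonneg (by positivity), sq_abs]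
        calc v m g ξ ^ 2 * τ / ((ℓ + lam) * (ℓ + τ + lam))
            ≤ (g ^ 2 * ‖ξ‖⁻¹) * (C * (ℓ + 1) ^ (1 / 4 : ℝ)) /
                ((c * (ℓ + 1)) * (c * (ℓ + 1))) := by
              gcongr
              · exact v_sq_le m g hξ
              · linarith
          _ = A * (‖ξ‖ ^ (-1 : ℝ) * (ℓ + 1) ^ (-(7 / 4) : ℝ)) := by
              rw [show (-(7 / 4) : ℝ) = 1 / 4 + -2 by norm_num, Real.rpow_add (by positivity),
                Real.rpow_neg (by positivity : 0 ≤ ℓ + 1) 2, Real.rpow_neg_one, hA, Real.rpow_two]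
              field_simp
          _ ≤ _ := by
              gcongr ?_ * (?_ * ?_)
              exact Real.rpow_le_rpow_of_nonpos (by positivity) h2 (by norm_num)
    _ ≤ ENNReal.ofReal A * (2 * radialInt 1 (7 / 4)) := by
        rw [lintegral_const_mul _ (by fun_prop)]
        gcongr
        exact lintegral_two_centre (α := 1) (β := 7 / 4) zero_le_one (by norm_num) _
    _ = _ := by
        rw [ENNReal.ofReal_mul (p := A) (by positivity), ENNReal.ofReal_toReal (by finiteness)]

theorem integrable_SdIntegrand (m g : ℝ) (P : E3) {lam : ℝ} (hlam : 0 < lam) (n : ℕ)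
    (K : Conf n) : Integrable (SdIntegrand m g P lam n K) := by
  obtain ⟨C, -, hC⟩ := exists_lintegral_SdIntegrand_le m g P hlam
  exact ⟨((measurable_SdIntegrand m g P lam n).comp measurable_prodMk_left).aestronglyMeasurable,
    (hC n K).trans_lt ENNReal.ofReal_lt_top⟩

theorem isSymbol_Sd (m g : ℝ) (P : E3) (lam : ℝ) : IsSymbol (Sd m g P lam) :=
  (isSymbol_tauNeg m g P lam).add <|
    IsSymbol.integral (measurable_SdIntegrand m g P lam) fun n σ K ξ => by
      unfold SdIntegrand
      rw [(isSymbol_L m P).snoc_symm, (isSymbol_tauPos m g P lam).snoc_symm]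

theorem exists_abs_Sd_le (m g : ℝ) (P : E3) {lam : ℝ} (hlam : 0 < lam) {s : ℝ}
    (hs : 0 < s) (hs' : s ≤ 1 / 2) : ∃ C : ℝ, 0 ≤ C ∧ ∀ n (K : Conf n),
      |Sd m g P lam n K| ≤ C * (L m P n K + 1) ^ s := by
  obtain ⟨C, hC0, hC⟩ := exists_abs_Td_le m g P hlam hs hs'
  obtain ⟨C', hC0', hC'⟩ := exists_lintegral_SdIntegrand_le m g P hlam
  refine ⟨C + C', by positivity, fun n K => ?_⟩
  have h := (enorm_integral_le_lintegral_enorm (SdIntegrand m g P lam n K)).trans (hC' n K)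
  rw [← ofReal_norm, ENNReal.ofReal_le_ofReal_iff hC0', Real.norm_eq_abs] at h
  have h1 : 1 ≤ (L m P n K + 1) ^ s :=
    Real.one_le_rpow (by linarith [L_nonneg m P n K]) hs.le
  unfold Sd
  refine (abs_add_le _ _).trans ?_
  have h2 := (abs_tauNeg_le m g P lam n K).trans (hC n K)
  nlinarith

/-! ### Creation followed by a multiplication operator -/

/-- The wavefunctions of `U a*(v) ψ`, where `U` is multiplication by a symbol:
`n^{-1/2} ∑ⱼ v(kⱼ) ψ⁽ⁿ⁻¹⁾(K̂ⱼ) U(K)` in the `n`-particle sector. -/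
def crFun (m g : ℝ) (U : ∀ n, Conf n → ℝ) (ψ : Fock) : ∀ n, Conf n → ℂ
  | 0, _ => 0
  | n + 1, K => ((Real.sqrt (n + 1))⁻¹ : ℝ) *
      ∑ j, (v m g (K j) : ℂ) * fn ψ n (j.removeNth K) * (U (n + 1) K : ℂ)

theorem measurable_crTerm (m g : ℝ) {U : ∀ n, Conf n → ℝ} (hU : IsSymbol U) (ψ : Fock) {n : ℕ}
    (j : Fin (n + 1)) : Measurable fun K : Conf (n + 1) =>
      (v m g (K j) : ℂ) * fn ψ n (j.removeNth K) * (U (n + 1) K : ℂ) :=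
  ((Complex.measurable_ofReal.comp ((measurable_v m g).comp (measurable_pi_apply j))).mul
    ((measurable_fn ψ n).comp (measurable_removeNth j))).mul
    (Complex.measurable_ofReal.comp (hU.meas _))

theorem measurable_crFun (m g : ℝ) {U : ∀ n, Conf n → ℝ} (hU : IsSymbol U) (ψ : Fock) (n : ℕ) :
    Measurable (crFun m g U ψ n) := by
  cases n with
  | zero => exact measurable_const
  | succ n =>
    exact (Finset.measurable_fun_sum _ fun j _ => measurable_crTerm m g hU ψ j).const_mul _

theorem crFun_symm (m g : ℝ) {U : ∀ n, Conf n → ℝ} (hU : IsSymbol U) (ψ : Fock) (n : ℕ)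
    (σ : Equiv.Perm (Fin n)) :
    (fun K => crFun m g U ψ n (K ∘ σ)) =ᵐ[volume] crFun m g U ψ n := by
  cases n with
  | zero => exact .of_forall fun _ => rfl
  | succ n =>
    have h : ∀ᵐ K : Conf (n + 1), ∀ j : Fin (n + 1),
        fn ψ n (j.removeNth (K ∘ σ)) = fn ψ n ((σ j).removeNth K) := by
      refine ae_all_iff.2 fun j => ?_
      obtain ⟨ρ, hρ⟩ := exists_perm_removeNth_comp j σ
      filter_upwards [ae_remove (σ j) (fn_symm ψ n ρ)] with K hK
      rw [hρ]; exact hK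
    filter_upwards [h] with K hK
    simp only [crFun, hK, hU.symm, Function.comp_apply]
    congr 1
    exact Equiv.sum_comp σ fun j => (v m g (K j) : ℂ) * fn ψ n (j.removeNth K) * (U (n + 1) K : ℂ)

section Bound

variable {m g : ℝ} {U : ∀ n, Conf n → ℝ} {n : ℕ} {B : Conf n → E3 → ENNReal}
  {p : Conf (n + 1) → Fin (n + 1) → ENNReal}

/-- The hypothesis bounds the squared coefficient by a weight `p`, to be summed over the created
particle, times a density `B` of the remaining and the created momenta. -/
theorem enorm_crTerm_sq_le
    (hUB : ∀ K j, ENNReal.ofReal (v m g (K j) ^ 2 * U (n + 1) K ^ 2)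
      ≤ p K j * B (j.removeNth K) (K j)) (ψ : Fock) (K : Conf (n + 1)) (j : Fin (n + 1)) :
    ‖(v m g (K j) : ℂ) * fn ψ n (j.removeNth K) * (U (n + 1) K : ℂ)‖ₑ ^ 2
      ≤ p K j * (B (j.removeNth K) (K j) * ‖fn ψ n (j.removeNth K)‖ₑ ^ 2) := by
  have e : ‖(v m g (K j) : ℂ) * fn ψ n (j.removeNth K) * (U (n + 1) K : ℂ)‖ₑ ^ 2
      = ENNReal.ofReal (v m g (K j) ^ 2 * U (n + 1) K ^ 2) * ‖fn ψ n (j.removeNth K)‖ₑ ^ 2 := by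
    rw [enorm_mul, enorm_mul, mul_pow, mul_pow, ENNReal.ofReal_mul (sq_nonneg _),
      ← sq_abs (v m g (K j)), ← sq_abs (U (n + 1) K), ENNReal.ofReal_pow (abs_nonneg _),
      ENNReal.ofReal_pow (abs_nonneg _), ← ofReal_norm ((v m g (K j) : ℂ)),
      ← ofReal_norm ((U (n + 1) K : ℂ)), Complex.norm_real, Complex.norm_real, Real.norm_eq_abs,
      Real.norm_eq_abs]
    ring
  rw [e, ← mul_assoc]
  gcongr
  exact hUB K j

theorem lintegral_removeNth_density (hB : Measurable fun z : Conf n × E3 => B z.1 z.2) (ψ : Fock)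
    (j : Fin (n + 1)) : ∫⁻ K : Conf (n + 1), B (j.removeNth K) (K j) *
      ‖fn ψ n (j.removeNth K)‖ₑ ^ 2 = ∫⁻ K, ‖fn ψ n K‖ₑ ^ 2 * ∫⁻ ξ, B K ξ := by
  rw [lintegral_removeNth j (f := fun K ξ => B K ξ * ‖fn ψ n K‖ₑ ^ 2)
    (hB.mul (((measurable_fn ψ n).comp measurable_fst).enorm.pow_const 2))]
  refine lintegral_congr fun K => ?_
  have hK : Measurable (B K) := hB.comp measurable_prodMk_left
  rw [lintegral_mul_const _ hK, mul_comm]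

/-- The basic estimate for creation operators: the Cauchy–Schwarz inequality in the sum over the
created particle, with weights `p` of total mass at most one. -/
theorem lintegral_crFun_le (hB : Measurable fun z : Conf n × E3 => B z.1 z.2)
    (hp : ∀ K, ∑ j, p K j ≤ 1)
    (hUB : ∀ K j, ENNReal.ofReal (v m g (K j) ^ 2 * U (n + 1) K ^ 2)
      ≤ p K j * B (j.removeNth K) (K j)) (ψ : Fock) :
    ∫⁻ K, ‖crFun m g U ψ (n + 1) K‖ₑ ^ 2 ≤ ∫⁻ K, ‖fn ψ n K‖ₑ ^ 2 * ∫⁻ ξ, B K ξ := by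
  have hn : (0 : ℝ) < n + 1 := by positivity
  have h1 : ∀ K : Conf (n + 1), ‖crFun m g U ψ (n + 1) K‖ₑ ^ 2 ≤ ENNReal.ofReal (n + 1 : ℝ)⁻¹ *
      ∑ j : Fin (n + 1), B (j.removeNth K) (K j) * ‖fn ψ n (j.removeNth K)‖ₑ ^ 2 := by
    intro K
    have h2 : ‖(((Real.sqrt (n + 1))⁻¹ : ℝ) : ℂ)‖ₑ ^ 2 = ENNReal.ofReal (n + 1 : ℝ)⁻¹ := by
      rw [← ofReal_norm, Complex.norm_real, Real.norm_of_nonneg (by positivity),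
        ← ENNReal.ofReal_pow (by positivity), inv_pow, Real.sq_sqrt hn.le]
    rw [crFun, enorm_mul, mul_pow, h2]
    gcongr
    calc _ ≤ (∑ j : Fin (n + 1),
          ‖(v m g (K j) : ℂ) * fn ψ n (j.removeNth K) * (U (n + 1) K : ℂ)‖ₑ) ^ 2 := by
          gcongr; exact enorm_sum_le _ _
      _ ≤ (∑ j, p K j) * _ := sq_sum_le _ _ _ _ fun j _ => enorm_crTerm_sq_le hUB ψ K j
      _ ≤ 1 * _ := by gcongr; exact hp K
      _ = _ := one_mul _
  have hm : ∀ j : Fin (n + 1), Measurable fun K : Conf (n + 1) =>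
      B (j.removeNth K) (K j) * ‖fn ψ n (j.removeNth K)‖ₑ ^ 2 := fun j =>
    (hB.comp ((measurable_removeNth j).prodMk (measurable_pi_apply j))).mul
      (((measurable_fn ψ n).comp (measurable_removeNth j)).enorm.pow_const 2)
  calc _ ≤ _ := lintegral_mono h1
    _ = ENNReal.ofReal (n + 1 : ℝ)⁻¹ * ∑ j : Fin (n + 1), ∫⁻ K : Conf (n + 1),
          B (j.removeNth K) (K j) * ‖fn ψ n (j.removeNth K)‖ₑ ^ 2 := by
        rw [lintegral_const_mul' _ _ ENNReal.ofReal_ne_top, lintegral_finsetSum _ fun j _ => hm j]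
    _ = ENNReal.ofReal (n + 1 : ℝ)⁻¹ * ((n + 1 : ENNReal) *
          ∫⁻ K, ‖fn ψ n K‖ₑ ^ 2 * ∫⁻ ξ, B K ξ) := by
        simp_rw [lintegral_removeNth_density hB ψ]
        simp
    _ = _ := by
        rw [← mul_assoc, show (n + 1 : ENNReal) = ENNReal.ofReal (n + 1 : ℝ) by
          rw [ENNReal.ofReal_add (by positivity) zero_le_one]; simp,
          ← ENNReal.ofReal_mul (by positivity), inv_mul_cancel₀ hn.ne', ENNReal.ofReal_one, one_mul]

/-- The single summands of `U a*(v) ψ` are square integrable, which allows the interchange of sum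
and integral in `inner_annFun_eq_inner_crFun`. -/
theorem memLp_crTerm (hU : IsSymbol U) (hB : Measurable fun z : Conf n × E3 => B z.1 z.2)
    (hp : ∀ K, ∑ j, p K j ≤ 1)
    (hUB : ∀ K j, ENNReal.ofReal (v m g (K j) ^ 2 * U (n + 1) K ^ 2)
      ≤ p K j * B (j.removeNth K) (K j)) {ψ : Fock}
    (hfin : ∫⁻ K, ‖fn ψ n K‖ₑ ^ 2 * ∫⁻ ξ, B K ξ ≠ ⊤) (j : Fin (n + 1)) :
    MemLp (fun K : Conf (n + 1) =>
      (v m g (K j) : ℂ) * fn ψ n (j.removeNth K) * (U (n + 1) K : ℂ)) 2 := by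
  refine ⟨(measurable_crTerm m g hU ψ j).aestronglyMeasurable, lt_top_iff_ne_top.2 fun h => ?_⟩
  have h1 : ∫⁻ K : Conf (n + 1),
      ‖(v m g (K j) : ℂ) * fn ψ n (j.removeNth K) * (U (n + 1) K : ℂ)‖ₑ ^ 2
        ≤ ∫⁻ K, ‖fn ψ n K‖ₑ ^ 2 * ∫⁻ ξ, B K ξ := by
    rw [← lintegral_removeNth_density hB ψ j]
    refine lintegral_mono fun K => (enorm_crTerm_sq_le hUB ψ K j).trans ?_
    refine mul_le_of_le_one_left' ((Finset.single_le_sum (fun i _ => zero_le) ?_).trans (hp K))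
    exact Finset.mem_univ j
  rw [← eLpNorm_two_sq, h] at h1
  exact hfin (top_le_iff.1 (by simpa using h1))

end Bound

theorem ofReal_omega_sq_inv_le (m : ℝ) {ξ : E3} (hξ : ξ ≠ 0) :
    (omega m ξ ^ 2)⁻¹ ≤ ‖ξ‖ ^ (-2 : ℝ) := by
  have hx := norm_pos_iff.2 hξ
  rw [Real.rpow_neg hx.le, Real.rpow_two]
  gcongr
  exact norm_le_omega m ξ

theorem norm_sq_le_L_snoc (m : ℝ) (P : E3) {n : ℕ} (K : Conf n) (ξ : E3) :
    ‖P - ∑ j, K j - ξ‖ ^ 2 ≤ L m P (n + 1) (Fin.snoc K ξ) := by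
  rw [L_snoc]
  linarith [Om_nonneg m n K, omega_nonneg m ξ]

/-- The square of the form factor against a power of the resolvent, integrated uniformly. -/
theorem lintegral_density_le (m : ℝ) (P : E3) {β : ℝ} (hβ : 0 ≤ β) {n : ℕ} (K : Conf n) :
    ∫⁻ ξ, ENNReal.ofReal ((omega m ξ ^ 2)⁻¹ * (L m P (n + 1) (Fin.snoc K ξ) + 1) ^ (-β))
      ≤ 2 * radialInt 2 β := by
  refine le_trans (lintegral_mono_ae ?_) (lintegral_two_centre two_pos.le hβ (P - ∑ j, K j))
  filter_upwards [ae_ne 0] with ξ hξ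
  refine ENNReal.ofReal_le_ofReal ?_
  have h1 := norm_sq_le_L_snoc m P K ξ
  exact mul_le_mul (ofReal_omega_sq_inv_le m hξ)
    (Real.rpow_le_rpow_of_nonpos (by positivity) (by linarith) (by linarith))
    (by have := L_nonneg m P (n + 1) (Fin.snoc K ξ); positivity) (by positivity)

/-- The density `g² C² ω(ξ)⁻² (L_P(K, ξ) + 1)^{-(1-2s)}` controlling `U a*(v)` for
`|U| ≤ C (L_P + 1)^{-1+s}`. -/
def crDensity (m g : ℝ) (P : E3) (C s : ℝ) {n : ℕ} (K : Conf n) (ξ : E3) : ENNReal :=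
  ENNReal.ofReal (g ^ 2 * C ^ 2) * ENNReal.ofReal
    ((omega m ξ ^ 2)⁻¹ * (L m P (n + 1) (Fin.snoc K ξ) + 1) ^ (-(1 - 2 * s)))

theorem measurable_crDensity (m g : ℝ) (P : E3) (C s : ℝ) (n : ℕ) :
    Measurable fun z : Conf n × E3 => crDensity m g P C s z.1 z.2 := by
  have h1 := measurable_L_snoc m P n
  have h3 : Measurable fun z : Conf n × E3 => omega m z.2 :=
    (measurable_omega m).comp measurable_snd
  unfold crDensity
  fun_prop

theorem lintegral_crDensity_le (m g : ℝ) (P : E3) (C : ℝ) {s : ℝ} (hs : s ≤ 1 / 2) {n : ℕ}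
    (K : Conf n) : ∫⁻ ξ, crDensity m g P C s K ξ
      ≤ ENNReal.ofReal (g ^ 2 * C ^ 2) * (2 * radialInt 2 (1 - 2 * s)) := by
  unfold crDensity
  rw [lintegral_const_mul' _ _ ENNReal.ofReal_ne_top]
  gcongr
  exact lintegral_density_le m P (by linarith) K

theorem crDensity_const_ne_top (g C : ℝ) {s : ℝ} (hs : s < 1 / 4) :
    ENNReal.ofReal (g ^ 2 * C ^ 2) * (2 * radialInt 2 (1 - 2 * s)) ≠ ⊤ := by
  have := radialInt_ne_top (α := 2) (β := 1 - 2 * s) (by norm_num) (by linarith)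
  finiteness

/-- The weights `ω(kⱼ) / (L_P(K) + 1)`. -/
theorem sum_omega_div_le (m : ℝ) (P : E3) {n : ℕ} (K : Conf n) :
    ∑ j, ENNReal.ofReal (omega m (K j) / (L m P n K + 1)) ≤ 1 := by
  have hL := L_nonneg m P n K
  rw [← ENNReal.ofReal_sum_of_nonneg fun j _ => div_nonneg (omega_nonneg m _) (by positivity),
    ← Finset.sum_div, ENNReal.ofReal_le_one]
  refine div_le_one_of_le₀ ?_ (by positivity)
  have := Om_le_L m P n K
  unfold Om at this
  linarith

/-- The hypothesis of `lintegral_crFun_le` with the weights `ω(kⱼ) / (L_P(K) + 1)`. -/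
theorem crDensity_spec {m g : ℝ} {P : E3} {C s : ℝ} {U : ∀ n, Conf n → ℝ}
    (hU : ∀ n K, |U n K| ≤ C * (L m P n K + 1) ^ (-1 + s)) {n : ℕ} (K : Conf (n + 1))
    (j : Fin (n + 1)) : ENNReal.ofReal (v m g (K j) ^ 2 * U (n + 1) K ^ 2) ≤
      ENNReal.ofReal (omega m (K j) / (L m P (n + 1) K + 1)) *
        crDensity m g P C s (j.removeNth K) (K j) := by
  have hL := L_nonneg m P (n + 1) K
  have hω := omega_nonneg m (K j)
  unfold crDensity
  rw [(isSymbol_L m P).removeNth j K, ← ENNReal.ofReal_mul (by positivity),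
    ← ENNReal.ofReal_mul (by positivity)]
  refine ENNReal.ofReal_le_ofReal ?_
  have h1 : U (n + 1) K ^ 2 ≤ (C * (L m P (n + 1) K + 1) ^ (-1 + s)) ^ 2 := by
    rw [← sq_abs]
    exact pow_le_pow_left₀ (abs_nonneg _) (hU _ _) 2
  have h2 : ((L m P (n + 1) K + 1) ^ (-1 + s)) ^ 2
      = (L m P (n + 1) K + 1)⁻¹ * (L m P (n + 1) K + 1) ^ (-(1 - 2 * s)) := by
    rw [← Real.rpow_natCast, ← Real.rpow_mul (by positivity), ← Real.rpow_neg_one,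
      ← Real.rpow_add (by positivity)]
    congr 1; push_cast; ring
  calc v m g (K j) ^ 2 * U (n + 1) K ^ 2
      ≤ omega m (K j) * (g ^ 2 * (omega m (K j) ^ 2)⁻¹) *
          (C ^ 2 * ((L m P (n + 1) K + 1)⁻¹ * (L m P (n + 1) K + 1) ^ (-(1 - 2 * s)))) := by
        rw [v_sq_eq, ← h2, ← mul_pow]
        gcongr
    _ = _ := by ring

/-- `U a*(v)` is bounded if `U` decays like `L_P^{-1+s}` with `s < 1/4`. -/
theorem nsq_crFun_ne_top {m g : ℝ} {P : E3} {C s : ℝ} (hs : s < 1 / 4) {U : ∀ n, Conf n → ℝ}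
    (hU : ∀ n K, |U n K| ≤ C * (L m P n K + 1) ^ (-1 + s)) (ψ : Fock) :
    nsq (crFun m g U ψ) ≠ ⊤ := by
  set A := ENNReal.ofReal (g ^ 2 * C ^ 2) * (2 * radialInt 2 (1 - 2 * s)) with hA
  have hAt : A ≠ ⊤ := crDensity_const_ne_top g C hs
  have h1 : ∀ n, ∫⁻ K, ‖crFun m g U ψ (n + 1) K‖ₑ ^ 2 ≤ A * ∫⁻ K, ‖fn ψ n K‖ₑ ^ 2 := by
    intro n
    refine (lintegral_crFun_le (measurable_crDensity m g P C s n) (sum_omega_div_le m P)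
      (crDensity_spec hU) ψ).trans ?_
    rw [← lintegral_const_mul' _ _ hAt]
    refine lintegral_mono fun K => ?_
    rw [mul_comm]
    gcongr
    exact lintegral_crDensity_le m g P C (by linarith) K
  unfold nsq
  rw [tsum_eq_zero_add' ENNReal.summable]
  have h0 : ∫⁻ K, ‖crFun m g U ψ 0 K‖ₑ ^ 2 = 0 := by simp [crFun]
  rw [h0, zero_add]
  refine ne_top_of_le_ne_top ?_ (ENNReal.tsum_le_tsum h1)
  rw [ENNReal.tsum_mul_left]
  exact ENNReal.mul_ne_top hAt (nsq_fn_ne_top ψ)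

theorem exists_cr {m g : ℝ} {P : E3} {C s : ℝ} (hs : s < 1 / 4) {U : ∀ n, Conf n → ℝ}
    (hU : IsSymbol U) (hUb : ∀ n K, |U n K| ≤ C * (L m P n K + 1) ^ (-1 + s)) (ψ : Fock) :
    ∃ γ : Fock, ∀ n, fn γ n =ᵐ[volume] crFun m g U ψ n :=
  exists_fock (measurable_crFun m g hU ψ) (crFun_symm m g hU ψ) (nsq_crFun_ne_top hs hUb ψ)

/-! ### Annihilation after a resolvent -/

/-- Symbols bounded below by a positive multiple of `L_P + 1`. -/
structure IsWeight (m : ℝ) (P : E3) (W : ∀ n, Conf n → ℝ) (c : ℝ) : Prop where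
  symbol : IsSymbol W
  pos : 0 < c
  le : ∀ n K, c * (L m P n K + 1) ≤ W n K

namespace IsWeight

variable {m : ℝ} {P : E3} {W : ∀ n, Conf n → ℝ} {c : ℝ}

theorem W_pos (hW : IsWeight m P W c) (n : ℕ) (K : Conf n) : 0 < W n K := by
  have := L_nonneg m P n K
  have := hW.pos
  exact lt_of_lt_of_le (by positivity) (hW.le n K)

theorem inv_le (hW : IsWeight m P W c) (n : ℕ) (K : Conf n) : (W n K)⁻¹ ≤ c⁻¹ * (L m P n K + 1)⁻¹ := by
  have := L_nonneg m P n K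
  have := hW.pos
  rw [← mul_inv]
  exact inv_anti₀ (by positivity) (hW.le n K)

theorem symbol_inv (hW : IsWeight m P W c) : IsSymbol fun n K => (W n K)⁻¹ := hW.symbol.comp measurable_inv

theorem abs_inv_le (hW : IsWeight m P W c) (n : ℕ) (K : Conf n) :
    |(W n K)⁻¹| ≤ c⁻¹ * (L m P n K + 1) ^ (-1 + (0 : ℝ)) := by
  rw [add_zero, Real.rpow_neg_one, abs_of_nonneg (inv_nonneg.2 (hW.W_pos n K).le)]
  exact hW.inv_le n K

end IsWeight

/-- The wavefunctions of `a(v) W⁻¹ η`. -/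
def annFun (m g : ℝ) (W : ∀ n, Conf n → ℝ) (η : Fock) (n : ℕ) (K : Conf n) : ℂ :=
  (Real.sqrt (n + 1) : ℂ) * ∫ ξ : E3, (v m g ξ : ℂ) *
    ((((W (n + 1) (Fin.snoc K ξ))⁻¹ : ℝ) : ℂ) * fn η (n + 1) (Fin.snoc K ξ))

theorem measurable_annIntegrand (m g : ℝ) {W : ∀ n, Conf n → ℝ} (hW : IsSymbol W) (η : Fock)
    (n : ℕ) : Measurable fun z : Conf n × E3 => (v m g z.2 : ℂ) *
      ((((W (n + 1) (Fin.snoc z.1 z.2))⁻¹ : ℝ) : ℂ) * fn η (n + 1) (Fin.snoc z.1 z.2)) :=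
  (Complex.measurable_ofReal.comp ((measurable_v m g).comp measurable_snd)).mul
    ((Complex.measurable_ofReal.comp ((hW.meas (n + 1)).comp measurable_snoc).inv).mul
      ((measurable_fn η (n + 1)).comp measurable_snoc))

theorem measurable_annFun (m g : ℝ) {W : ∀ n, Conf n → ℝ} (hW : IsSymbol W) (η : Fock)
    (n : ℕ) : Measurable (annFun m g W η n) :=
  ((measurable_annIntegrand m g hW η n).stronglyMeasurable.integral_prod_right').measurable.const_mul
    _

theorem annFun_symm (m g : ℝ) {W : ∀ n, Conf n → ℝ} (hW : IsSymbol W) (η : Fock)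
    (n : ℕ) (σ : Equiv.Perm (Fin n)) :
    (fun K => annFun m g W η n (K ∘ σ)) =ᵐ[volume] annFun m g W η n := by
  obtain ⟨σ', hσ'⟩ := exists_perm_snoc_comp σ
  filter_upwards [ae_slice (fn_symm η (n + 1) σ')] with K hK
  unfold annFun
  congr 1
  refine integral_congr_ae ?_
  filter_upwards [hK] with ξ hξ
  rw [hσ', hW.symm, hξ]

section

variable {m : ℝ} {P : E3} {W : ∀ n, Conf n → ℝ} {c : ℝ}

/-- The Cauchy–Schwarz inequality in the annihilated momentum, with the weight `ω(ξ)`: multiplied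
by `n + 1`, it is summed up to `dΓ(ω) ≤ L_P` in `lintegral_omega_div_le`. -/
theorem sq_lintegral_ann_le (hW : IsWeight m P W c) (g : ℝ) (η : Fock) (n : ℕ) (K : Conf n) :
    (∫⁻ ξ : E3, ‖(v m g ξ : ℂ) * ((((W (n + 1) (Fin.snoc K ξ))⁻¹ : ℝ) : ℂ) *
      fn η (n + 1) (Fin.snoc K ξ))‖ₑ) ^ 2 ≤
    (ENNReal.ofReal (g ^ 2 * c⁻¹ ^ 2) * (2 * radialInt 2 1)) * ∫⁻ ξ : E3,
      ENNReal.ofReal (omega m ξ) * (ENNReal.ofReal (L m P (n + 1) (Fin.snoc K ξ) + 1)⁻¹ *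
        ‖fn η (n + 1) (Fin.snoc K ξ)‖ₑ ^ 2) := by
  have hLm : Measurable fun ξ : E3 => L m P (n + 1) (Fin.snoc K ξ) :=
    ((isSymbol_L m P).meas (n + 1)).comp (measurable_snoc_right K)
  have hω := measurable_omega m
  have hf : Measurable fun ξ : E3 => ‖fn η (n + 1) (Fin.snoc K ξ)‖ₑ :=
    ((measurable_fn η (n + 1)).comp (measurable_snoc_right K)).enorm
  have hp : AEMeasurable (fun ξ => ENNReal.ofReal (g ^ 2 * c⁻¹ ^ 2) * ENNReal.ofReal
      ((omega m ξ ^ 2)⁻¹ * (L m P (n + 1) (Fin.snoc K ξ) + 1) ^ (-(1 : ℝ)))) :=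
    ((((hω.pow_const 2).inv).mul ((hLm.add_const 1).pow_const _)).ennreal_ofReal.const_mul
      _).aemeasurable
  have hy : AEMeasurable (fun ξ => ENNReal.ofReal (omega m ξ) * (ENNReal.ofReal
      (L m P (n + 1) (Fin.snoc K ξ) + 1)⁻¹ * ‖fn η (n + 1) (Fin.snoc K ξ)‖ₑ ^ 2)) :=
    (hω.ennreal_ofReal.mul ((hLm.add_const 1).inv.ennreal_ofReal.mul (hf.pow_const 2))).aemeasurable
  refine (sq_lintegral_le
    (p := fun ξ => ENNReal.ofReal (g ^ 2 * c⁻¹ ^ 2) *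
      ENNReal.ofReal ((omega m ξ ^ 2)⁻¹ * (L m P (n + 1) (Fin.snoc K ξ) + 1) ^ (-(1 : ℝ))))
    (y := fun ξ => ENNReal.ofReal (omega m ξ) * (ENNReal.ofReal
      (L m P (n + 1) (Fin.snoc K ξ) + 1)⁻¹ * ‖fn η (n + 1) (Fin.snoc K ξ)‖ₑ ^ 2))
    hp hy (.of_forall fun ξ => ?_)).trans ?_
  · have hL := L_nonneg m P (n + 1) (Fin.snoc K ξ)
    have hi := hW.inv_le (n + 1) (Fin.snoc K ξ)
    have hi0 := inv_nonneg.2 (hW.W_pos (n + 1) (Fin.snoc K ξ)).le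
    have h0 := omega_nonneg m ξ
    rw [enorm_mul, enorm_mul, ← ofReal_norm ((v m g ξ : ℂ)), Complex.norm_real, Real.norm_eq_abs,
      ← ofReal_norm (((W (n + 1) (Fin.snoc K ξ))⁻¹ : ℝ) : ℂ), Complex.norm_real,
      Real.norm_of_nonneg hi0, mul_pow, mul_pow, ← ENNReal.ofReal_pow (abs_nonneg _), sq_abs,
      ← ENNReal.ofReal_pow hi0, ← mul_assoc, ← mul_assoc, ← mul_assoc,
      ← ENNReal.ofReal_mul (by positivity), ← ENNReal.ofReal_mul (by positivity),
      ← ENNReal.ofReal_mul (by positivity), ← ENNReal.ofReal_mul (by positivity)]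
    refine mul_le_mul' (ENNReal.ofReal_le_ofReal ?_) le_rfl
    rw [v_sq_eq, Real.rpow_neg_one]
    calc omega m ξ * (g ^ 2 * (omega m ξ ^ 2)⁻¹) * (W (n + 1) (Fin.snoc K ξ))⁻¹ ^ 2
        ≤ omega m ξ * (g ^ 2 * (omega m ξ ^ 2)⁻¹) *
            (c⁻¹ * (L m P (n + 1) (Fin.snoc K ξ) + 1)⁻¹) ^ 2 := by gcongr
      _ = _ := by ring
  · refine mul_le_mul' ?_ le_rfl
    rw [lintegral_const_mul' _ _ ENNReal.ofReal_ne_top]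
    exact mul_le_mul' le_rfl (lintegral_density_le m P zero_le_one K)

/-- The total contribution of the last factor of the Cauchy–Schwarz inequality, by symmetry. -/
theorem lintegral_omega_div_le (m : ℝ) (P : E3) (η : Fock) (n : ℕ) :
    (n + 1 : ENNReal) * ∫⁻ K : Conf n, ∫⁻ ξ : E3, ENNReal.ofReal (omega m ξ) *
      (ENNReal.ofReal (L m P (n + 1) (Fin.snoc K ξ) + 1)⁻¹ *
        ‖fn η (n + 1) (Fin.snoc K ξ)‖ₑ ^ 2) ≤ ∫⁻ K, ‖fn η (n + 1) K‖ₑ ^ 2 := by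
  have hLm := (isSymbol_L m P).meas (n + 1)
  have hf := measurable_fn η (n + 1)
  rw [← lintegral_sum_mul (a := fun ξ => ENNReal.ofReal (omega m ξ))
    (H := fun K => ENNReal.ofReal (L m P (n + 1) K + 1)⁻¹ * ‖fn η (n + 1) K‖ₑ ^ 2)
    (measurable_omega m).ennreal_ofReal (by fun_prop) ?_]
  · refine lintegral_mono fun K => ?_
    rw [← mul_assoc, ← ENNReal.ofReal_sum_of_nonneg fun j _ => omega_nonneg m _,
      ← ENNReal.ofReal_mul (Finset.sum_nonneg fun j _ => omega_nonneg m _)]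
    refine mul_le_of_le_one_left' ?_
    rw [ENNReal.ofReal_le_one, ← div_eq_mul_inv]
    have hL := L_nonneg m P (n + 1) K
    refine div_le_one_of_le₀ ?_ (by positivity)
    have := Om_le_L m P (n + 1) K
    unfold Om at this
    linarith
  · intro σ
    filter_upwards [fn_symm η (n + 1) σ] with K hK
    simp only [(isSymbol_L m P).symm, hK]

theorem annConst_ne_top (g c : ℝ) :
    ENNReal.ofReal (g ^ 2 * c⁻¹ ^ 2) * (2 * radialInt 2 1) ≠ ⊤ := by
  have := radialInt_ne_top (α := 2) (β := 1) (by norm_num) (by norm_num)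
  finiteness

theorem integrable_ann (hW : IsWeight m P W c) (g : ℝ) (η : Fock) (n : ℕ) :
    ∀ᵐ K : Conf n, Integrable fun ξ : E3 => (v m g ξ : ℂ) *
      ((((W (n + 1) (Fin.snoc K ξ))⁻¹ : ℝ) : ℂ) * fn η (n + 1) (Fin.snoc K ξ)) := by
  have h1 := lintegral_omega_div_le m P η n
  have hη : ∫⁻ K, ‖fn η (n + 1) K‖ₑ ^ 2 ≠ ⊤ :=
    ENNReal.ne_top_of_tsum_ne_top (nsq_fn_ne_top η) (n + 1)
  have hω := measurable_omega m
  have hLm := measurable_L_snoc m P n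
  have hf : Measurable fun z : Conf n × E3 => ‖fn η (n + 1) (Fin.snoc z.1 z.2)‖ₑ :=
    ((measurable_fn η (n + 1)).comp measurable_snoc).enorm
  have hm : Measurable fun z : Conf n × E3 => ENNReal.ofReal (omega m z.2) *
      (ENNReal.ofReal (L m P (n + 1) (Fin.snoc z.1 z.2) + 1)⁻¹ *
        ‖fn η (n + 1) (Fin.snoc z.1 z.2)‖ₑ ^ 2) := by fun_prop
  have h2 : ∫⁻ K : Conf n, ∫⁻ ξ : E3, ENNReal.ofReal (omega m ξ) *
      (ENNReal.ofReal (L m P (n + 1) (Fin.snoc K ξ) + 1)⁻¹ *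
        ‖fn η (n + 1) (Fin.snoc K ξ)‖ₑ ^ 2) ≠ ⊤ := by
    refine ne_top_of_le_ne_top hη (le_trans ?_ h1)
    exact le_mul_of_one_le_left' le_add_self
  filter_upwards [ae_lt_top hm.lintegral_prod_right' h2] with K hK
  refine ⟨((measurable_annIntegrand m g hW.symbol η n).comp
    measurable_prodMk_left).aestronglyMeasurable, ?_⟩
  have h3 := (sq_lintegral_ann_le hW g η n K).trans_lt
    (ENNReal.mul_lt_top (annConst_ne_top g c).lt_top hK)
  exact lt_top_iff_ne_top.2 fun h => by
    simp only at h
    rw [h] at h3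
    simp at h3

theorem nsq_annFun_le (hW : IsWeight m P W c) (g : ℝ) (η : Fock) : nsq (annFun m g W η) ≤
    (ENNReal.ofReal (g ^ 2 * c⁻¹ ^ 2) * (2 * radialInt 2 1)) * nsq (fn η) := by
  set A := ENNReal.ofReal (g ^ 2 * c⁻¹ ^ 2) * (2 * radialInt 2 1) with hA
  have hAt : A ≠ ⊤ := annConst_ne_top g c
  have h1 : ∀ n, ∫⁻ K, ‖annFun m g W η n K‖ₑ ^ 2 ≤ A * ∫⁻ K, ‖fn η (n + 1) K‖ₑ ^ 2 := by
    intro n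
    refine le_trans ?_ (mul_le_mul' le_rfl (lintegral_omega_div_le m P η n))
    rw [← mul_assoc, ← lintegral_const_mul' _ _ (ENNReal.mul_ne_top hAt (by finiteness))]
    refine lintegral_mono fun K => ?_
    have h2 : ‖(Real.sqrt (n + 1) : ℂ)‖ₑ ^ 2 = (n + 1 : ENNReal) := by
      rw [← ofReal_norm, Complex.norm_real, Real.norm_of_nonneg (Real.sqrt_nonneg _),
        ← ENNReal.ofReal_pow (Real.sqrt_nonneg _), Real.sq_sqrt (by positivity),
        ENNReal.ofReal_add (by positivity) zero_le_one]
      simp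
    unfold annFun
    rw [enorm_mul, mul_pow, h2, mul_comm A, mul_assoc]
    refine mul_le_mul' le_rfl (le_trans ?_ (sq_lintegral_ann_le hW g η n K))
    gcongr
    exact enorm_integral_le_lintegral_enorm _
  unfold nsq
  calc ∑' n, ∫⁻ K, ‖annFun m g W η n K‖ₑ ^ 2 ≤ ∑' n, A * ∫⁻ K, ‖fn η (n + 1) K‖ₑ ^ 2 :=
        ENNReal.tsum_le_tsum h1
    _ = A * ∑' n, ∫⁻ K, ‖fn η (n + 1) K‖ₑ ^ 2 := ENNReal.tsum_mul_left
    _ ≤ _ := by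
        rw [tsum_eq_zero_add' (f := fun n => ∫⁻ K, ‖fn η n K‖ₑ ^ 2) ENNReal.summable]
        exact mul_le_mul' le_rfl le_add_self

theorem norm_le_of_nsq_le {η χ : Fock} {A : ENNReal} (hA : A ≠ ⊤)
    (h : nsq (fn χ) ≤ A * nsq (fn η)) : ‖χ‖ ≤ Real.sqrt A.toReal * ‖η‖ := by
  rw [nsq_fn, nsq_fn, ← ENNReal.ofReal_toReal hA, ← ENNReal.ofReal_mul ENNReal.toReal_nonneg,
    ENNReal.ofReal_le_ofReal_iff (by positivity)] at h
  refine le_of_sq_le_sq ?_ (by positivity)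
  rw [mul_pow, Real.sq_sqrt ENNReal.toReal_nonneg]
  exact h

/-- `a(v) W⁻¹` is everywhere defined, for every weight `W`. -/
theorem exists_annGraph (hW : IsWeight m P W c) (g : ℝ) (η : Fock) : ∃ θ χ : Fock,
    (η, θ) ∈ mulGraph (fun n K => (W n K)⁻¹) ∧ (θ, χ) ∈ annGraph (v m g) ∧
    (∀ n, fn χ n =ᵐ[volume] annFun m g W η n) := by
  obtain ⟨θ, hθ⟩ := exists_mul hW.symbol_inv (ψ := η) <| by
    refine ne_top_of_le_ne_top ?_ (nsq_mono (C := c⁻¹) (h := fn η) fun n => .of_forall fun K => ?_)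
    · exact ENNReal.mul_ne_top ENNReal.ofReal_ne_top (nsq_fn_ne_top η)
    · rw [norm_mul, Complex.norm_real, Real.norm_of_nonneg (inv_nonneg.2 (hW.W_pos n K).le)]
      refine mul_le_mul_of_nonneg_right ?_ (norm_nonneg _)
      refine (hW.inv_le n K).trans (mul_le_of_le_one_right (inv_nonneg.2 hW.pos.le) ?_)
      exact inv_le_one_of_one_le₀ (by linarith [L_nonneg m P n K])
  obtain ⟨χ, hχ⟩ := exists_fock (measurable_annFun m g hW.symbol η)
    (annFun_symm m g hW.symbol η) (ne_top_of_le_ne_top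
      (ENNReal.mul_ne_top (annConst_ne_top g c) (nsq_fn_ne_top η)) (nsq_annFun_le hW g η))
  refine ⟨θ, χ, hθ, fun n => ?_, hχ⟩
  have h : ∀ᵐ K : Conf n, (fun ξ : E3 => (v m g ξ : ℂ) * fn θ (n + 1) (Fin.snoc K ξ)) =ᵐ[volume]
      fun ξ : E3 => (v m g ξ : ℂ) * ((((W (n + 1) (Fin.snoc K ξ))⁻¹ : ℝ) : ℂ) *
        fn η (n + 1) (Fin.snoc K ξ)) := by
    filter_upwards [ae_slice (hθ (n + 1))] with K hK
    filter_upwards [hK] with ξ hξ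
    rw [hξ]
  refine ⟨?_, ?_⟩
  · filter_upwards [h, integrable_ann hW g η n] with K hK h1
    exact h1.congr hK.symm
  · filter_upwards [h, hχ n] with K hK h1
    rw [h1, annFun, integral_congr_ae hK]

end

/-! ### Calculus of graphs -/

theorem mem_graph_add {A B : Op} {ψ χ : Fock} : (ψ, χ) ∈ (A + B).graph ↔
    ∃ a b, (ψ, a) ∈ A.graph ∧ (ψ, b) ∈ B.graph ∧ χ = a + b := by
  constructor
  · intro h
    obtain ⟨⟨y, hy⟩, h1, h2⟩ := LinearPMap.mem_graph_iff _ |>.1 h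
    rw [LinearPMap.add_domain] at hy
    obtain rfl : y = ψ := h1
    exact ⟨A ⟨y, hy.1⟩, B ⟨y, hy.2⟩, A.mem_graph ⟨y, hy.1⟩, B.mem_graph ⟨y, hy.2⟩, h2.symm⟩
  · rintro ⟨a, b, ha, hb, rfl⟩
    obtain ⟨⟨y, hy⟩, h1, rfl⟩ := LinearPMap.mem_graph_iff _ |>.1 ha
    obtain ⟨⟨y', hy'⟩, h1', rfl⟩ := LinearPMap.mem_graph_iff _ |>.1 hb
    obtain rfl : y = ψ := h1
    obtain rfl : y' = y := h1'
    exact LinearPMap.mem_graph_iff _ |>.2 ⟨⟨y', hy, hy'⟩, rfl, rfl⟩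

theorem mem_graph_neg {A : Op} {ψ χ : Fock} : (ψ, χ) ∈ (-A).graph ↔ (ψ, -χ) ∈ A.graph := by
  constructor
  · intro h
    obtain ⟨⟨y, hy⟩, h1, h2⟩ := LinearPMap.mem_graph_iff _ |>.1 h
    refine LinearPMap.mem_graph_iff _ |>.2 ⟨⟨y, hy⟩, h1, ?_⟩
    have h3 : -(A ⟨y, hy⟩) = χ := h2
    rw [← h3, neg_neg]
  · intro h
    obtain ⟨⟨y, hy⟩, h1, h2⟩ := LinearPMap.mem_graph_iff _ |>.1 h
    refine LinearPMap.mem_graph_iff _ |>.2 ⟨⟨y, hy⟩, h1, ?_⟩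
    have h2' : A ⟨y, hy⟩ = -χ := h2
    have h3 : (-A) ⟨y, hy⟩ = -(A ⟨y, hy⟩) := rfl
    exact h3.trans (by rw [h2', neg_neg])

theorem mem_graph_sub {A B : Op} {ψ χ : Fock} : (ψ, χ) ∈ (A - B).graph ↔
    ∃ a b, (ψ, a) ∈ A.graph ∧ (ψ, b) ∈ B.graph ∧ χ = a - b := by
  rw [sub_eq_add_neg, mem_graph_add]
  constructor
  · rintro ⟨a, b, ha, hb, rfl⟩
    exact ⟨a, -b, ha, mem_graph_neg.1 hb, by abel⟩
  · rintro ⟨a, b, ha, hb, rfl⟩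
    exact ⟨a, -b, ha, mem_graph_neg.2 (by rwa [neg_neg]), by abel⟩

theorem mem_graph_smul_one {c : ℂ} {ψ χ : Fock} : (ψ, χ) ∈ (c • one).graph ↔ χ = c • ψ := by
  constructor
  · intro h
    obtain ⟨⟨y, hy⟩, h1, h2⟩ := LinearPMap.mem_graph_iff _ |>.1 h
    obtain rfl : y = ψ := h1
    exact h2.symm
  · rintro rfl
    exact LinearPMap.mem_graph_iff _ |>.2 ⟨⟨ψ, trivial⟩, rfl, rfl⟩

theorem mem_graph_comp {A B : Op} {ψ χ : Fock} : (ψ, χ) ∈ (comp A B).graph ↔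
    ∃ φ, (ψ, φ) ∈ B.graph ∧ (φ, χ) ∈ A.graph := by
  constructor
  · intro h
    obtain ⟨⟨y, hy⟩, h1, h2⟩ := LinearPMap.mem_graph_iff _ |>.1 h
    obtain rfl : y = ψ := h1
    obtain ⟨hB, hA⟩ := (mem_comp_domain A B y).1 hy
    exact ⟨B ⟨y, hB⟩, B.mem_graph ⟨y, hB⟩, LinearPMap.mem_graph_iff _ |>.2 ⟨⟨_, hA⟩, rfl, h2⟩⟩
  · rintro ⟨φ, hB, hA⟩
    obtain ⟨⟨y, hy⟩, h1, rfl⟩ := LinearPMap.mem_graph_iff _ |>.1 hB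
    obtain rfl : y = ψ := h1
    obtain ⟨⟨y', hy'⟩, h1', rfl⟩ := LinearPMap.mem_graph_iff _ |>.1 hA
    obtain rfl : y' = B ⟨y, hy⟩ := h1'
    exact LinearPMap.mem_graph_iff _ |>.2 ⟨⟨y, (mem_comp_domain A B y).2 ⟨hy, hy'⟩⟩, rfl, rfl⟩

theorem mem_graph_domRestrict {A : Op} {D : Submodule ℂ Fock} {ψ χ : Fock} :
    (ψ, χ) ∈ (A.domRestrict D).graph ↔ ψ ∈ D ∧ (ψ, χ) ∈ A.graph := by
  constructor
  · intro h
    obtain ⟨⟨y, hy⟩, h1, h2⟩ := LinearPMap.mem_graph_iff _ |>.1 h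
    obtain rfl : y = ψ := h1
    exact ⟨hy.1, LinearPMap.mem_graph_iff _ |>.2 ⟨⟨y, hy.2⟩, rfl, h2⟩⟩
  · rintro ⟨hD, h⟩
    obtain ⟨⟨y, hy⟩, h1, rfl⟩ := LinearPMap.mem_graph_iff _ |>.1 h
    obtain rfl : y = ψ := h1
    exact LinearPMap.mem_graph_iff _ |>.2 ⟨⟨y, hD, hy⟩, rfl, rfl⟩

/-- A bounded operator, regarded as an operator with domain the whole Fock space. -/
def ofCLM (A : Fock →L[ℂ] Fock) : Op := (A : Fock →ₗ[ℂ] Fock).toPMap ⊤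

theorem mem_graph_ofCLM {A : Fock →L[ℂ] Fock} {ψ χ : Fock} :
    (ψ, χ) ∈ (ofCLM A).graph ↔ χ = A ψ := by
  constructor
  · intro h
    obtain ⟨⟨y, hy⟩, h1, h2⟩ := LinearPMap.mem_graph_iff _ |>.1 h
    obtain rfl : y = ψ := h1
    exact h2.symm
  · rintro rfl
    exact LinearPMap.mem_graph_iff _ |>.2 ⟨⟨ψ, trivial⟩, rfl, rfl⟩

theorem isBoundedOp_ofCLM (A : Fock →L[ℂ] Fock) : IsBoundedOp (ofCLM A) :=
  ⟨rfl, ‖A‖, fun ψ => A.le_opNorm ψ⟩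

theorem adjoint_ofCLM (A : Fock →L[ℂ] Fock) :
    (ofCLM A).adjoint = ofCLM (ContinuousLinearMap.adjoint A) :=
  ContinuousLinearMap.toPMap_adjoint_eq_adjoint_toPMap_of_dense A dense_univ

theorem op_ext {A B : Op} (h : ∀ ψ χ, (ψ, χ) ∈ A.graph ↔ (ψ, χ) ∈ B.graph) : A = B :=
  LinearPMap.eq_of_eq_graph (by ext ⟨ψ, χ⟩; exact h ψ χ)

theorem one_sub_ofCLM (A : Fock →L[ℂ] Fock) : one - ofCLM A = ofCLM (1 - A) := by
  refine op_ext fun ψ χ => ?_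
  have h1 : ∀ a, (ψ, a) ∈ one.graph ↔ a = ψ := fun a => by
    have := mem_graph_smul_one (c := 1) (ψ := ψ) (χ := a)
    rwa [one_smul, one_smul] at this
  rw [mem_graph_sub, mem_graph_ofCLM]
  constructor
  · rintro ⟨a, b, ha, hb, rfl⟩
    rw [(h1 a).1 ha, mem_graph_ofCLM.1 hb]
    rfl
  · rintro rfl
    exact ⟨ψ, A ψ, (h1 ψ).2 rfl, mem_graph_ofCLM.2 rfl, rfl⟩

theorem exists_eq_ofCLM {A : Op} {C : ℝ}
    (h : ∀ ψ, ∃ χ, (ψ, χ) ∈ A.graph ∧ ‖χ‖ ≤ C * ‖ψ‖) : ∃ B, A = ofCLM B := by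
  have hd : ∀ ψ, ψ ∈ A.domain := fun ψ => by
    obtain ⟨χ, hχ, -⟩ := h ψ
    exact LinearPMap.mem_domain_iff.2 ⟨χ, hχ⟩
  let l : Fock →ₗ[ℂ] Fock :=
    { toFun := fun ψ => A ⟨ψ, hd ψ⟩
      map_add' := fun ψ φ => A.map_add ⟨ψ, hd ψ⟩ ⟨φ, hd φ⟩
      map_smul' := fun c ψ => A.map_smul c ⟨ψ, hd ψ⟩ }
  have hl : ∀ ψ χ, (ψ, χ) ∈ A.graph → l ψ = χ := by
    intro ψ χ hg
    obtain ⟨⟨y, hy⟩, h1, h2⟩ := LinearPMap.mem_graph_iff _ |>.1 hg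
    obtain rfl : y = ψ := h1
    exact h2
  have hC : ∀ ψ, ‖l ψ‖ ≤ C * ‖ψ‖ := by
    intro ψ
    obtain ⟨χ, hχ, hn⟩ := h ψ
    rw [hl ψ χ hχ]; exact hn
  refine ⟨l.mkContinuous C hC, op_ext fun ψ χ => ?_⟩
  rw [mem_graph_ofCLM, LinearMap.mkContinuous_apply]
  constructor
  · exact fun hg => (hl ψ χ hg).symm
  · rintro rfl
    exact A.mem_graph ⟨ψ, hd ψ⟩

/-! ### Adjoints -/

open scoped ComplexConjugate

theorem inner_sector (η ψ : Fock) (n : ℕ) :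
    inner ℂ (η n) (ψ n) = ∫ K, fn ψ n K * conj (fn η n K) := by
  rw [Submodule.coe_inner, L2.inner_def]
  rfl

theorem memLp_fn (ψ : Fock) (n : ℕ) : MemLp (fn ψ n) 2 := Lp.memLp _

section

variable {m : ℝ} {P : E3} {W : ∀ n, Conf n → ℝ} {c : ℝ}

/-- `⟨a(v) W⁻¹ η, ψ⟩ = ⟨η, W⁻¹ a*(v) ψ⟩`. By the symmetry of `η`, all summands of the creation
operator contribute equally. -/
theorem inner_annFun_eq_inner_crFun (hW : IsWeight m P W c) {g : ℝ} {η ψ χ γ : Fock}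
    (hχ : ∀ n, fn χ n =ᵐ[volume] annFun m g W η n)
    (hγ : ∀ n, fn γ n =ᵐ[volume] crFun m g (fun n K => (W n K)⁻¹) ψ n) :
    inner ℂ χ ψ = inner ℂ η γ := by
  have h0 : inner ℂ (η 0) (γ 0) = (0 : ℂ) := by
    rw [inner_sector, ← integral_zero (Conf 0) ℂ (μ := volume)]
    refine integral_congr_ae ?_
    filter_upwards [hγ 0] with K hK
    rw [hK]; simp [crFun]
  have hs : ∀ n, inner ℂ (χ n) (ψ n) = inner ℂ (η (n + 1)) (γ (n + 1)) := by
    intro n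
    rw [inner_sector, inner_sector]
    -- the summands of the creation operator, paired with `η`
    set h : Fin (n + 1) → Conf (n + 1) → ℂ := fun j K =>
      (v m g (K j) : ℂ) * fn ψ n (j.removeNth K) * (((W (n + 1) K)⁻¹ : ℝ) : ℂ)
        * conj (fn η (n + 1) K) with hh
    have hi : ∀ j, Integrable (h j) := by
      intro j
      have hfin : ∫⁻ K, ‖fn ψ n K‖ₑ ^ 2 * ∫⁻ ξ, crDensity m g P c⁻¹ 0 K ξ ≠ ⊤ := by
        have hA := crDensity_const_ne_top g c⁻¹ (s := 0) (by norm_num)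
        refine ne_top_of_le_ne_top ?_ (lintegral_mono fun K => mul_le_mul' le_rfl
          (lintegral_crDensity_le m g P c⁻¹ (s := 0) (by norm_num) K))
        rw [lintegral_mul_const' _ _ hA]
        exact ENNReal.mul_ne_top (ENNReal.ne_top_of_tsum_ne_top (nsq_fn_ne_top ψ) n) hA
      have h1 := memLp_crTerm hW.symbol_inv (measurable_crDensity m g P c⁻¹ 0 n)
        (sum_omega_div_le m P) (crDensity_spec hW.abs_inv_le) hfin j
      exact h1.integrable_mul (memLp_fn η (n + 1)).star
    let F : Conf n → E3 → ℂ := fun K ξ => (v m g ξ : ℂ) * fn ψ n K *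
      (((W (n + 1) (Fin.snoc K ξ))⁻¹ : ℝ) : ℂ) * conj (fn η (n + 1) (Fin.snoc K ξ))
    have hF : ∀ j, h j =ᵐ[volume] fun K => F (j.removeNth K) (K j) := by
      intro j
      obtain ⟨σ, hσ⟩ := exists_perm_snoc_removeNth j
      filter_upwards [fn_symm η (n + 1) σ] with K hK
      simp only [hh, F, hσ, hW.symbol.symm, hK]
    have hI : ∀ j, ∫ K, h j K = ∫ K, fn ψ n K * conj (∫ ξ : E3, (v m g ξ : ℂ) *
        ((((W (n + 1) (Fin.snoc K ξ))⁻¹ : ℝ) : ℂ) * fn η (n + 1) (Fin.snoc K ξ))) := by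
      intro j
      rw [integral_congr_ae (hF j), integral_removeNth j ((hi j).congr (hF j))]
      refine integral_congr_ae (.of_forall fun K => ?_)
      simp only
      rw [← integral_conj, ← integral_const_mul]
      refine integral_congr_ae (.of_forall fun ξ => ?_)
      simp only [F, map_mul, Complex.conj_ofReal]
      ring
    have hn : (0 : ℝ) < n + 1 := by positivity
    have e1 : ∫ K, fn ψ n K * conj (fn χ n K) = (Real.sqrt (n + 1) : ℂ) *
        ∫ K, fn ψ n K * conj (∫ ξ : E3, (v m g ξ : ℂ) *
        ((((W (n + 1) (Fin.snoc K ξ))⁻¹ : ℝ) : ℂ) * fn η (n + 1) (Fin.snoc K ξ))) := by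
      rw [← integral_const_mul]
      refine integral_congr_ae ?_
      filter_upwards [hχ n] with K hK
      rw [hK, annFun, map_mul, Complex.conj_ofReal]
      ring
    have e2 : ∫ K, fn γ (n + 1) K * conj (fn η (n + 1) K)
        = ((Real.sqrt (n + 1))⁻¹ : ℝ) * ∑ j, ∫ K, h j K := by
      rw [← integral_finsetSum _ fun j _ => hi j, ← integral_const_mul]
      refine integral_congr_ae ?_
      filter_upwards [hγ (n + 1)] with K hK
      rw [hK, crFun, mul_assoc, Finset.sum_mul]
    rw [e1, e2]
    simp_rw [hI]
    rw [Finset.sum_const, Finset.card_univ, Fintype.card_fin, nsmul_eq_mul, ← mul_assoc]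
    congr 1
    have h2 : Real.sqrt (n + 1) = (Real.sqrt (n + 1))⁻¹ * (n + 1) := by
      have := Real.sqrt_pos.2 hn
      field_simp
      rw [Real.sq_sqrt hn.le]
    conv_lhs => rw [h2]
    push_cast
    rfl
  have h1 : Summable fun n => (inner ℂ (η n) (γ n) : ℂ) := lp.summable_inner η γ
  have h2 : (∑' n, inner ℂ (η n) (γ n) : ℂ) = ∑' n, inner ℂ (η (n + 1)) (γ (n + 1)) := by
    rw [h1.tsum_eq_zero_add, h0, zero_add]
  calc (inner ℂ χ ψ : ℂ) = ∑' n, inner ℂ (χ n) (ψ n) := lp.inner_eq_tsum χ ψ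
    _ = ∑' n, inner ℂ (η (n + 1)) (γ (n + 1)) := tsum_congr hs
    _ = ∑' n, inner ℂ (η n) (γ n) := h2.symm
    _ = inner ℂ η γ := (lp.inner_eq_tsum η γ).symm

theorem apply_eq_of_mem_graph {T : Op} {A : Fock →L[ℂ] Fock} (h : T = ofCLM A) {ψ χ : Fock}
    (hg : (ψ, χ) ∈ T.graph) : A ψ = χ := by
  rw [h] at hg
  exact (mem_graph_ofCLM.1 hg).symm

/-- The operator `-a(v) W⁻¹`. -/
def resStar (m g : ℝ) (W : ∀ n, Conf n → ℝ) : Op :=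
  -comp (ann (v m g)) (mulOp fun n K => (W n K)⁻¹)

theorem mem_graph_resStar {g : ℝ} {η θ χ : Fock} (hθ : (η, θ) ∈ mulGraph (fun n K => (W n K)⁻¹))
    (hχ : (θ, χ) ∈ annGraph (v m g)) : (η, -χ) ∈ (resStar m g W).graph := by
  rw [← ann_graph] at hχ
  rw [← mulOp_graph] at hθ
  exact mem_graph_neg.2 ((neg_neg χ).symm ▸ mem_graph_comp.2 ⟨θ, hθ, hχ⟩)

theorem exists_resStar_eq_ofCLM (hW : IsWeight m P W c) (g : ℝ) :
    ∃ A : Fock →L[ℂ] Fock, resStar m g W = ofCLM A := by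
  refine exists_eq_ofCLM (A := resStar m g W)
    (C := Real.sqrt (ENNReal.ofReal (g ^ 2 * c⁻¹ ^ 2) * (2 * radialInt 2 1)).toReal) fun η => ?_
  obtain ⟨θ, χ, hθ, hχ, hf⟩ := exists_annGraph hW g η
  refine ⟨-χ, mem_graph_resStar hθ hχ, ?_⟩
  rw [norm_neg]
  refine norm_le_of_nsq_le (annConst_ne_top g c) ?_
  rw [nsq_congr hf]
  exact nsq_annFun_le hW g η

theorem inner_adjoint_resStar (hW : IsWeight m P W c) {g : ℝ} {A : Fock →L[ℂ] Fock}
    (hA : resStar m g W = ofCLM A) {ψ γ : Fock}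
    (hγ : ∀ n, fn γ n =ᵐ[volume] crFun m g (fun n K => (W n K)⁻¹) ψ n) (η : Fock) :
    inner ℂ η (ContinuousLinearMap.adjoint A ψ) = inner ℂ η (-γ) := by
  obtain ⟨θ, χ, hθ, hχ, hf⟩ := exists_annGraph hW g η
  have h1 : A η = -χ := apply_eq_of_mem_graph hA (mem_graph_resStar hθ hχ)
  calc inner ℂ η (ContinuousLinearMap.adjoint A ψ) = inner ℂ (A η) ψ :=
        ContinuousLinearMap.adjoint_inner_right A η ψ
    _ = inner ℂ (-χ) ψ := congrArg (fun x => inner ℂ x ψ) h1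
    _ = -inner ℂ χ ψ := inner_neg_left χ ψ
    _ = -inner ℂ η γ := congrArg Neg.neg (inner_annFun_eq_inner_crFun hW hf hγ)
    _ = inner ℂ η (-γ) := (inner_neg_right η γ).symm

/-- The adjoint of `-a(v) W⁻¹` is `-W⁻¹ a*(v)`. -/
theorem adjoint_resStar (hW : IsWeight m P W c) {g : ℝ} {A : Fock →L[ℂ] Fock}
    (hA : resStar m g W = ofCLM A) (ψ : Fock) (n : ℕ) :
    fn (ContinuousLinearMap.adjoint A ψ) n =ᵐ[volume]
      -crFun m g (fun n K => (W n K)⁻¹) ψ n := by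
  obtain ⟨γ, hγ⟩ := exists_cr (m := m) (g := g) (P := P) (C := c⁻¹) (s := 0) (by norm_num)
    hW.symbol_inv hW.abs_inv_le ψ
  have e : ContinuousLinearMap.adjoint A ψ = -γ :=
    ext_inner_left ℂ (inner_adjoint_resStar hW hA hγ)
  rw [e]
  filter_upwards [fn_neg γ n, hγ n] with K h1 h2
  rw [h1, Pi.neg_apply, Pi.neg_apply, h2]

/-- If `A = -a(v) W⁻¹` and `θ = W⁻¹ η`, then `θ ∈ D(a(v))` with `a(v) θ = -A η`. -/
theorem resStar_mem_annGraph (hW : IsWeight m P W c) {g : ℝ} {A : Fock →L[ℂ] Fock}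
    (hA : resStar m g W = ofCLM A) {η θ : Fock} (hθ : (η, θ) ∈ mulGraph (fun n K => (W n K)⁻¹)) :
    (θ, -A η) ∈ annGraph (v m g) := by
  obtain ⟨θ', χ, hθ', hχ, -⟩ := exists_annGraph hW g η
  have e : θ' = θ := fn_ext fun n => (hθ' n).trans (hθ n).symm
  rw [apply_eq_of_mem_graph hA (mem_graph_resStar hθ' hχ), neg_neg, ← e]
  exact hχ

end

/-! ### Off-diagonal operators -/

/-- The kernel `-v(ξ) v(kⱼ) / W(K, ξ)`. -/
def offKernel (m g : ℝ) (W : ∀ n, Conf n → ℝ) (n : ℕ) (K : Conf n) (j : Fin n) (ξ : E3) : ℝ :=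
  -(v m g ξ * v m g (K j) / W (n + 1) (Fin.snoc K ξ))

/-- The wavefunctions of the off-diagonal operator with kernel `offKernel`. -/
def offFun (m g : ℝ) (W : ∀ n, Conf n → ℝ) (ψ : Fock) : ∀ n, Conf n → ℂ
  | 0, _ => 0
  | n + 1, K => ∑ j, ∫ ξ : E3,
      (offKernel m g W (n + 1) K j ξ : ℂ) * fn ψ (n + 1) (Fin.snoc (j.removeNth K) ξ)

theorem measurable_offIntegrand (m g : ℝ) {W : ∀ n, Conf n → ℝ} (hW : IsSymbol W) (ψ : Fock)
    {n : ℕ} (j : Fin (n + 1)) : Measurable fun z : Conf (n + 1) × E3 =>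
      (offKernel m g W (n + 1) z.1 j z.2 : ℂ) *
        fn ψ (n + 1) (Fin.snoc (j.removeNth z.1) z.2) := by
  have h1 : Measurable fun z : Conf (n + 1) × E3 => v m g z.2 :=
    (measurable_v m g).comp measurable_snd
  have h2 : Measurable fun z : Conf (n + 1) × E3 => v m g (z.1 j) :=
    (measurable_v m g).comp ((measurable_pi_apply j).comp measurable_fst)
  have h3 : Measurable fun z : Conf (n + 1) × E3 => W (n + 2) (Fin.snoc z.1 z.2) :=
    (hW.meas (n + 2)).comp measurable_snoc
  have h4 : Measurable fun z : Conf (n + 1) × E3 =>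
      (Fin.snoc (j.removeNth z.1) z.2 : Conf (n + 1)) :=
    measurable_snoc.comp (((measurable_removeNth j).comp measurable_fst).prodMk measurable_snd)
  exact (Complex.measurable_ofReal.comp ((h1.mul h2).div h3).neg).mul
    ((measurable_fn ψ (n + 1)).comp h4)

theorem measurable_offFun (m g : ℝ) {W : ∀ n, Conf n → ℝ} (hW : IsSymbol W) (ψ : Fock) (n : ℕ) :
    Measurable (offFun m g W ψ n) := by
  cases n with
  | zero => exact measurable_const
  | succ n =>
    exact Finset.measurable_fun_sum _ fun j _ =>
      ((measurable_offIntegrand m g hW ψ j).stronglyMeasurable.integral_prod_right').measurable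

theorem offFun_symm (m g : ℝ) {W : ∀ n, Conf n → ℝ} (hW : IsSymbol W) (ψ : Fock) (n : ℕ)
    (σ : Equiv.Perm (Fin n)) :
    (fun K => offFun m g W ψ n (K ∘ σ)) =ᵐ[volume] offFun m g W ψ n := by
  cases n with
  | zero => exact .of_forall fun _ => rfl
  | succ n =>
    have h : ∀ᵐ K : Conf (n + 1), ∀ j : Fin (n + 1), ∀ᵐ ξ : E3,
        fn ψ (n + 1) (Fin.snoc (j.removeNth (K ∘ σ)) ξ)
          = fn ψ (n + 1) (Fin.snoc ((σ j).removeNth K) ξ) := by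
      refine ae_all_iff.2 fun j => ?_
      obtain ⟨ρ, hρ⟩ := exists_perm_removeNth_comp j σ
      obtain ⟨ρ', hρ'⟩ := exists_perm_snoc_comp ρ
      filter_upwards [ae_remove (σ j) (ae_slice (fn_symm ψ (n + 1) ρ'))] with K hK
      filter_upwards [hK] with ξ hξ
      rw [hρ, hρ', hξ]
    filter_upwards [h] with K hK
    simp only [offFun]
    rw [← Equiv.sum_comp σ fun j => ∫ ξ : E3,
      (offKernel m g W (n + 1) K j ξ : ℂ) * fn ψ (n + 1) (Fin.snoc (j.removeNth K) ξ)]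
    refine Finset.sum_congr rfl fun j _ => integral_congr_ae ?_
    filter_upwards [hK j] with ξ hξ
    rw [hξ, offKernel, offKernel, hW.snoc_symm, Function.comp_apply]

/-- A property that holds for almost every `ξ`, at every `K`, holds at `(K̂ⱼ, kⱼ)` for almost every
configuration. -/
theorem ae_removeNth {n : ℕ} (j : Fin (n + 1)) {p : Conf n → E3 → Prop}
    (hm : MeasurableSet {z : Conf n × E3 | p z.1 z.2}) (h : ∀ K, ∀ᵐ ξ, p K ξ) :
    ∀ᵐ K : Conf (n + 1), p (j.removeNth K) (K j) := by
  let S : Set (Conf n × E3) := {z | p z.1 z.2}ᶜ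
  let f : Conf n → E3 → ENNReal := fun K ξ => S.indicator 1 (K, ξ)
  have hf : Measurable fun z : Conf n × E3 => f z.1 z.2 := measurable_one.indicator hm.compl
  have h1 : ∫⁻ K, ∫⁻ ξ, f K ξ = 0 := by
    rw [← lintegral_zero (α := Conf n) (μ := volume)]
    refine lintegral_congr fun K => ?_
    rw [← lintegral_zero (α := E3) (μ := volume)]
    refine lintegral_congr_ae ?_
    filter_upwards [h K] with ξ hξ
    simp [f, S, hξ]
  have hm2 : Measurable fun K : Conf (n + 1) => f (j.removeNth K) (K j) :=
    hf.comp ((measurable_removeNth j).prodMk (measurable_pi_apply j))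
  rw [← lintegral_removeNth j hf, lintegral_eq_zero_iff hm2] at h1
  filter_upwards [h1] with K hK
  by_contra hc
  simp [f, S, hc] at hK

/-- The weights cancel in the product of the kernel with its transpose. -/
theorem schurKer_mul {q k ξ : E3} (hk : k ≠ 0) (hξ : ξ ≠ 0) (hqk : k ≠ q) (hqξ : ξ ≠ q)
    (h : ξ ≠ q - k) : schurKer q k ξ * schurKer q ξ k
      = (‖ξ‖ ^ 2)⁻¹ * (‖k‖ ^ 2)⁻¹ * (‖q - k - ξ‖ ^ 2)⁻¹ := by
  have h1 := norm_pos_iff.2 hk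
  have h2 := norm_pos_iff.2 hξ
  have h3 := norm_pos_iff.2 (sub_ne_zero.2 hqk.symm)
  have h4 := norm_pos_iff.2 (sub_ne_zero.2 hqξ.symm)
  have h5 := norm_pos_iff.2 (sub_ne_zero.2 h.symm)
  have e : q - ξ - k = q - k - ξ := by abel
  unfold schurKer
  rw [e, Real.rpow_neg h1.le, Real.rpow_neg h2.le, Real.rpow_neg h3.le, Real.rpow_neg h4.le,
    Real.rpow_neg h5.le, Real.rpow_two, Real.rpow_two, Real.rpow_one]
  have a3 := Real.rpow_pos_of_pos h3 (1 / 2)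
  have a4 := Real.rpow_pos_of_pos h4 (1 / 2)
  field_simp

theorem measurable_schurKer {α : Type*} [MeasurableSpace α] {q k ξ : α → E3} (hq : Measurable q)
    (hk : Measurable k) (hξ : Measurable ξ) :
    Measurable fun z => schurKer (q z) (k z) (ξ z) := by
  have h1 : Measurable fun z => ‖q z - k z‖ := (hq.sub hk).norm
  have h2 : Measurable fun z => ‖q z - ξ z‖ := (hq.sub hξ).norm
  have h3 : Measurable fun z => ‖q z - k z - ξ z‖ := ((hq.sub hk).sub hξ).norm
  have h4 : Measurable fun z => ‖ξ z‖ := hξ.norm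
  exact (h1.pow_const _).mul (((h4.pow_const _).mul (h2.pow_const _)).mul (h3.pow_const _))

section

variable {m g : ℝ} {P : E3} {W : ∀ n, Conf n → ℝ} {c : ℝ}

/-- The pointwise form of the Schur test. It combines `W(K, ξ)² ≥ c² Ω(K) |q - k - ξ|²`, where `Ω`
is the symbol of `dΓ(ω)`, with `ω(k)⁻¹ ≤ ω(k) / |k|²`. The factor `ω(kⱼ) / Ω(K)` has sum one over
`j`, and the factor `ω(ξ)` is controlled by the form of `dΓ(ω)`. -/
theorem offKernel_sq_le (hW : IsWeight m P W c) {n : ℕ} (K : Conf (n + 1)) (j : Fin (n + 1))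
    {ξ q : E3} (hq : q = P - ∑ i, j.removeNth K i) (hk : K j ≠ 0) (hqk : K j ≠ q) (hξ : ξ ≠ 0)
    (hqξ : ξ ≠ q) (h : ξ ≠ q - K j) :
    offKernel m g W (n + 1) K j ξ ^ 2 ≤
      (g ^ 2 * c⁻¹ * (omega m (K j) / Om m (n + 1) K) * schurKer q (K j) ξ) *
        (g ^ 2 * c⁻¹ * omega m ξ * schurKer q ξ (K j)) := by
  have hp : q - K j = P - ∑ i, K i := by
    rw [hq, Fin.sum_univ_succAbove K j, sub_sub, add_comm (K j)]; rfl
  have hwk := omega_pos m hk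
  have hwξ := omega_pos m hξ
  have hOm : 0 < Om m (n + 1) K := hwk.trans_le
    (Finset.single_le_sum (fun i _ => omega_nonneg m (K i)) (Finset.mem_univ j))
  have h1 := norm_pos_iff.2 hk
  have h2 := norm_pos_iff.2 hξ
  have h5 := norm_pos_iff.2 (sub_ne_zero.2 h.symm)
  have hc := hW.pos
  set ℓ := L m P (n + 2) (Fin.snoc K ξ) with hℓ
  have hℓe : ℓ = ‖q - K j - ξ‖ ^ 2 + Om m (n + 1) K + omega m ξ := by rw [hℓ, L_snoc, hp]
  have hWl : c * (ℓ + 1) ≤ W (n + 2) (Fin.snoc K ξ) := hW.le _ _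
  have hℓ0 : 0 < ℓ + 1 := by rw [hℓe]; positivity
  have hsq : c ^ 2 * (Om m (n + 1) K * ‖q - K j - ξ‖ ^ 2) ≤ W (n + 2) (Fin.snoc K ξ) ^ 2 := by
    calc c ^ 2 * (Om m (n + 1) K * ‖q - K j - ξ‖ ^ 2) ≤ c ^ 2 * ((ℓ + 1) * (ℓ + 1)) := by
          gcongr
          · rw [hℓe]; nlinarith
          · rw [hℓe]; linarith
      _ = (c * (ℓ + 1)) ^ 2 := by ring
      _ ≤ _ := by gcongr
  have hx : ∀ k : E3, k ≠ 0 → (omega m k)⁻¹ ≤ omega m k * (‖k‖ ^ 2)⁻¹ := by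
    intro k hk0
    have a1 := omega_pos m hk0
    have a2 := norm_pos_iff.2 hk0
    rw [← div_eq_mul_inv, le_div_iff₀ (by positivity), inv_mul_le_iff₀ a1, ← sq]
    gcongr
    exact norm_le_omega m k
  calc offKernel m g W (n + 1) K j ξ ^ 2
      = v m g ξ ^ 2 * v m g (K j) ^ 2 * (W (n + 2) (Fin.snoc K ξ) ^ 2)⁻¹ := by
        unfold offKernel; ring
    _ ≤ (g ^ 2 * (omega m ξ * (‖ξ‖ ^ 2)⁻¹)) * (g ^ 2 * (omega m (K j) * (‖K j‖ ^ 2)⁻¹)) *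
          (c ^ 2 * (Om m (n + 1) K * ‖q - K j - ξ‖ ^ 2))⁻¹ := by
        rw [v_sq, v_sq]
        gcongr
        · exact hx ξ hξ
        · exact hx _ hk
    _ = (g ^ 2 * c⁻¹) ^ 2 * (omega m (K j) / Om m (n + 1) K) * omega m ξ *
          ((‖ξ‖ ^ 2)⁻¹ * (‖K j‖ ^ 2)⁻¹ * (‖q - K j - ξ‖ ^ 2)⁻¹) := by
        field_simp
    _ = _ := by
        rw [← schurKer_mul hk hξ hqk hqξ h]; ring

/-- The second factor of the Cauchy–Schwarz inequality for the off-diagonal operator, as a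
function of the remaining momenta and the created momentum. -/
def offDensity (m g : ℝ) (P : E3) (c : ℝ) (ψ : Fock) (n : ℕ) (K : Conf n) (k : E3) : ENNReal :=
  ∫⁻ ξ : E3, ENNReal.ofReal (g ^ 2 * c⁻¹ * omega m ξ * schurKer (P - ∑ i, K i) ξ k) *
    ‖fn ψ (n + 1) (Fin.snoc K ξ)‖ₑ ^ 2

theorem measurable_offDensity_kernel (m g : ℝ) (P : E3) (c : ℝ) (n : ℕ) :
    Measurable fun z : (Conf n × E3) × E3 =>
      ENNReal.ofReal (g ^ 2 * c⁻¹ * omega m z.2 * schurKer (P - ∑ i, z.1.1 i) z.2 z.1.2) := by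
  have h0 : Measurable fun K : Conf n => P - ∑ i, K i :=
    (Finset.measurable_fun_sum _ fun i _ => measurable_pi_apply i).const_sub P
  have h1 : Measurable fun z : (Conf n × E3) × E3 => omega m z.2 :=
    (measurable_omega m).comp measurable_snd
  have h2 : Measurable fun z : (Conf n × E3) × E3 => schurKer (P - ∑ i, z.1.1 i) z.2 z.1.2 :=
    measurable_schurKer (h0.comp (measurable_fst.comp measurable_fst)) measurable_snd
      (measurable_snd.comp measurable_fst)
  exact ((h1.const_mul _).mul h2).ennreal_ofReal

theorem measurable_offDensity_integrand (m g : ℝ) (P : E3) (c : ℝ) (ψ : Fock) (n : ℕ) :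
    Measurable fun z : (Conf n × E3) × E3 =>
      ENNReal.ofReal (g ^ 2 * c⁻¹ * omega m z.2 * schurKer (P - ∑ i, z.1.1 i) z.2 z.1.2) *
        ‖fn ψ (n + 1) (Fin.snoc z.1.1 z.2)‖ₑ ^ 2 := by
  have h5 : Measurable fun z : (Conf n × E3) × E3 => (Fin.snoc z.1.1 z.2 : Conf (n + 1)) :=
    measurable_snoc.comp ((measurable_fst.comp measurable_fst).prodMk measurable_snd)
  have h3 : Measurable fun z : (Conf n × E3) × E3 => ‖fn ψ (n + 1) (Fin.snoc z.1.1 z.2)‖ₑ ^ 2 :=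
    ((measurable_fn ψ (n + 1)).comp h5).enorm.pow_const 2
  exact (measurable_offDensity_kernel m g P c n).mul h3

theorem measurable_offDensity (m g : ℝ) (P : E3) (c : ℝ) (ψ : Fock) (n : ℕ) :
    Measurable fun z : Conf n × E3 => offDensity m g P c ψ n z.1 z.2 :=
  (measurable_offDensity_integrand m g P c ψ n).lintegral_prod_right'

theorem lintegral_schurKer_mul_le (m g : ℝ) {c : ℝ} (hc : 0 < c) (q ξ : E3) (t : ENNReal) :
    ∫⁻ k : E3, ENNReal.ofReal (g ^ 2 * c⁻¹ * omega m ξ * schurKer q ξ k) * t ≤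
      ENNReal.ofReal (g ^ 2 * c⁻¹) * schurConst * (ENNReal.ofReal (omega m ξ) * t) := by
  have hω := omega_nonneg m ξ
  have hs : Measurable fun k : E3 => schurKer q ξ k :=
    measurable_schurKer measurable_const measurable_const measurable_id
  calc ∫⁻ k : E3, ENNReal.ofReal (g ^ 2 * c⁻¹ * omega m ξ * schurKer q ξ k) * t
      = ∫⁻ k : E3, (ENNReal.ofReal (g ^ 2 * c⁻¹) * ENNReal.ofReal (omega m ξ) * t) *
          ENNReal.ofReal (schurKer q ξ k) := by
        refine lintegral_congr fun k => ?_
        rw [ENNReal.ofReal_mul (by positivity), ENNReal.ofReal_mul (by positivity)]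
        ring
    _ = (ENNReal.ofReal (g ^ 2 * c⁻¹) * ENNReal.ofReal (omega m ξ) * t) *
          ∫⁻ k : E3, ENNReal.ofReal (schurKer q ξ k) := lintegral_const_mul _ hs.ennreal_ofReal
    _ ≤ (ENNReal.ofReal (g ^ 2 * c⁻¹) * ENNReal.ofReal (omega m ξ) * t) * schurConst :=
        mul_le_mul' le_rfl (lintegral_schurKer_le _ _)
    _ = _ := by ring

theorem offConst_ne_top (g c : ℝ) : ENNReal.ofReal (g ^ 2 * c⁻¹) * schurConst ≠ ⊤ :=
  ENNReal.mul_ne_top ENNReal.ofReal_ne_top schurConst_ne_top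

theorem lintegral_swap_slice {X : Type*} [MeasurableSpace X] {f : (X × E3) × E3 → ENNReal}
    (hf : Measurable f) (x : X) :
    ∫⁻ k, ∫⁻ ξ, f ((x, k), ξ) = ∫⁻ ξ, ∫⁻ k, f ((x, k), ξ) := by
  have hx : Measurable fun z : E3 × E3 => ((x, z.1), z.2) :=
    (measurable_const.prodMk measurable_fst).prodMk measurable_snd
  exact lintegral_lintegral_swap (f := fun k ξ => f ((x, k), ξ)) (hf.comp hx).aemeasurable

theorem lintegral_offDensity_slice_le (m g : ℝ) (P : E3) {c : ℝ} (hc : 0 < c) (ψ : Fock) (n : ℕ)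
    (K : Conf n) : ∫⁻ k, offDensity m g P c ψ n K k ≤
      ENNReal.ofReal (g ^ 2 * c⁻¹) * schurConst *
        ∫⁻ ξ : E3, ENNReal.ofReal (omega m ξ) * ‖fn ψ (n + 1) (Fin.snoc K ξ)‖ₑ ^ 2 := by
  have h := lintegral_swap_slice (measurable_offDensity_integrand m g P c ψ n) K
  rw [← lintegral_const_mul' _ _ (offConst_ne_top g c)]
  dsimp only at h
  unfold offDensity
  rw [h]
  exact lintegral_mono fun ξ => lintegral_schurKer_mul_le m g hc (P - ∑ i, K i) ξ _

/-- By symmetry the factor `n + 1` turns `ω(ξ)` into the symbol of `dΓ(ω)`. -/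
theorem lintegral_offDensity_le (m g : ℝ) (P : E3) {c : ℝ} (hc : 0 < c) (ψ : Fock) (n : ℕ) :
    (n + 1 : ENNReal) * ∫⁻ K : Conf n, ∫⁻ k, offDensity m g P c ψ n K k ≤
      ENNReal.ofReal (g ^ 2 * c⁻¹) * schurConst *
        ∫⁻ K, ENNReal.ofReal (Om m (n + 1) K) * ‖fn ψ (n + 1) K‖ₑ ^ 2 := by
  have hf := measurable_fn ψ (n + 1)
  have h2 := lintegral_sum_mul (n := n) (a := fun ξ => ENNReal.ofReal (omega m ξ))
    (H := fun K => ‖fn ψ (n + 1) K‖ₑ ^ 2) (measurable_omega m).ennreal_ofReal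
    (hf.enorm.pow_const 2) (fun σ => by
      filter_upwards [fn_symm ψ (n + 1) σ] with K hK
      rw [hK])
  have h3 : ∫⁻ K, ENNReal.ofReal (Om m (n + 1) K) * ‖fn ψ (n + 1) K‖ₑ ^ 2
      = ∫⁻ K : Conf (n + 1), (∑ j, ENNReal.ofReal (omega m (K j))) * ‖fn ψ (n + 1) K‖ₑ ^ 2 := by
    refine lintegral_congr fun K => ?_
    rw [← ENNReal.ofReal_sum_of_nonneg fun j _ => omega_nonneg m _]
    rfl
  rw [h3, h2]
  calc _ ≤ (n + 1 : ENNReal) * ∫⁻ K : Conf n, ENNReal.ofReal (g ^ 2 * c⁻¹) * schurConst *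
        ∫⁻ ξ : E3, ENNReal.ofReal (omega m ξ) * ‖fn ψ (n + 1) (Fin.snoc K ξ)‖ₑ ^ 2 :=
        mul_le_mul' le_rfl (lintegral_mono fun K => lintegral_offDensity_slice_le m g P hc ψ n K)
    _ = _ := by
        rw [lintegral_const_mul' _ _ (offConst_ne_top g c)]
        ring

/-- The Cauchy–Schwarz inequality with the two factors of `offKernel_sq_le`; the first is integrated
by the Schur test. -/
theorem ae_sq_lintegral_off_le (hW : IsWeight m P W c) (ψ : Fock) (n : ℕ) :
    ∀ᵐ K : Conf (n + 1), ∀ j : Fin (n + 1), (∫⁻ ξ : E3, ‖(offKernel m g W (n + 1) K j ξ : ℂ) *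
      fn ψ (n + 1) (Fin.snoc (j.removeNth K) ξ)‖ₑ) ^ 2 ≤
        ENNReal.ofReal (omega m (K j) / Om m (n + 1) K) *
          (ENNReal.ofReal (g ^ 2 * c⁻¹) * schurConst *
            offDensity m g P c ψ n (j.removeNth K) (K j)) := by
  have hne : ∀ᵐ K : Conf (n + 1), ∀ j : Fin (n + 1),
      K j ≠ 0 ∧ K j ≠ P - ∑ i, j.removeNth K i := by
    refine ae_all_iff.2 fun j => ?_
    refine ae_removeNth j (p := fun K ξ => ξ ≠ 0 ∧ ξ ≠ P - ∑ i, K i) ?_ fun K => ?_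
    · refine MeasurableSet.inter ?_ ?_
      · exact (isClosed_eq continuous_snd continuous_const).measurableSet.compl
      · exact (isClosed_eq (f := fun z : Conf n × E3 => z.2)
          (g := fun z : Conf n × E3 => P - ∑ i, z.1 i) continuous_snd
          (by fun_prop)).measurableSet.compl
    · exact (ae_ne 0).and (ae_ne _)
  filter_upwards [hne] with K hK j
  obtain ⟨hk, hqk⟩ := hK j
  set q := P - ∑ i, j.removeNth K i with hq
  have hc := hW.pos
  have hω := omega_nonneg m (K j)
  have hOm := Om_nonneg m (n + 1) K
  have hs1 : Measurable fun ξ : E3 => schurKer q (K j) ξ := by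
    unfold schurKer; fun_prop
  have hs2 : Measurable fun ξ : E3 => schurKer q ξ (K j) := by
    unfold schurKer; fun_prop
  have hf : Measurable fun ξ : E3 => ‖fn ψ (n + 1) (Fin.snoc (j.removeNth K) ξ)‖ₑ ^ 2 :=
    ((measurable_fn ψ (n + 1)).comp (measurable_snoc_right _)).enorm.pow_const 2
  refine (sq_lintegral_le
    (p := fun ξ => ENNReal.ofReal
      (g ^ 2 * c⁻¹ * (omega m (K j) / Om m (n + 1) K) * schurKer q (K j) ξ))
    (y := fun ξ => ENNReal.ofReal (g ^ 2 * c⁻¹ * omega m ξ * schurKer q ξ (K j)) *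
      ‖fn ψ (n + 1) (Fin.snoc (j.removeNth K) ξ)‖ₑ ^ 2)
    (hs1.const_mul _).ennreal_ofReal.aemeasurable
    ((((measurable_omega m).const_mul _).mul hs2).ennreal_ofReal.mul hf).aemeasurable ?_).trans ?_
  · filter_upwards [ae_ne 0, ae_ne q, ae_ne (q - K j)] with ξ h0 h1 h2
    have key := offKernel_sq_le (g := g) hW K j hq hk hqk h0 h1 h2
    rw [enorm_mul, mul_pow, ← ofReal_norm ((offKernel m g W (n + 1) K j ξ : ℂ)),
      Complex.norm_real, Real.norm_eq_abs, ← ENNReal.ofReal_pow (abs_nonneg _), sq_abs, ← mul_assoc,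
      ← ENNReal.ofReal_mul (mul_nonneg (by positivity) (schurKer_nonneg _ _ _))]
    exact mul_le_mul' (ENNReal.ofReal_le_ofReal key) le_rfl
  · have h1 : ∫⁻ ξ : E3, ENNReal.ofReal
        (g ^ 2 * c⁻¹ * (omega m (K j) / Om m (n + 1) K) * schurKer q (K j) ξ)
        ≤ ENNReal.ofReal (omega m (K j) / Om m (n + 1) K) *
          (ENNReal.ofReal (g ^ 2 * c⁻¹) * schurConst) := by
      calc _ = ∫⁻ ξ : E3, ENNReal.ofReal (g ^ 2 * c⁻¹ * (omega m (K j) / Om m (n + 1) K)) *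
            ENNReal.ofReal (schurKer q (K j) ξ) := by
            refine lintegral_congr fun ξ => ?_
            rw [ENNReal.ofReal_mul (by positivity)]
        _ = ENNReal.ofReal (g ^ 2 * c⁻¹ * (omega m (K j) / Om m (n + 1) K)) *
            ∫⁻ ξ : E3, ENNReal.ofReal (schurKer q (K j) ξ) :=
            lintegral_const_mul _ hs1.ennreal_ofReal
        _ ≤ ENNReal.ofReal (g ^ 2 * c⁻¹ * (omega m (K j) / Om m (n + 1) K)) * schurConst :=
            mul_le_mul' le_rfl (lintegral_schurKer_le _ _)
        _ = _ := by
            rw [ENNReal.ofReal_mul (by positivity)]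
            ring
    calc _ ≤ _ := mul_le_mul' h1 le_rfl
      _ = _ := by
        rw [mul_assoc, mul_assoc, mul_assoc]; rfl

theorem lintegral_sum_offDensity_le (m g : ℝ) (P : E3) {c : ℝ} (hc : 0 < c) (ψ : Fock) (n : ℕ) :
    ∫⁻ K : Conf (n + 1), ∑ j, ENNReal.ofReal (g ^ 2 * c⁻¹) * schurConst *
      offDensity m g P c ψ n (j.removeNth K) (K j) ≤
      (ENNReal.ofReal (g ^ 2 * c⁻¹) * schurConst) ^ 2 *
        ∫⁻ K, ENNReal.ofReal (Om m (n + 1) K) * ‖fn ψ (n + 1) K‖ₑ ^ 2 := by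
  have hCt : ENNReal.ofReal (g ^ 2 * c⁻¹) * schurConst ≠ ⊤ :=
    ENNReal.mul_ne_top ENNReal.ofReal_ne_top schurConst_ne_top
  set A := ENNReal.ofReal (g ^ 2 * c⁻¹) * schurConst with hA
  have hm := measurable_offDensity m g P c ψ n
  have hmj : ∀ j : Fin (n + 1), Measurable fun K : Conf (n + 1) =>
      A * offDensity m g P c ψ n (j.removeNth K) (K j) := fun j =>
    (hm.comp ((measurable_removeNth j).prodMk (measurable_pi_apply j))).const_mul _
  have hj : ∀ j : Fin (n + 1), ∫⁻ K : Conf (n + 1),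
      A * offDensity m g P c ψ n (j.removeNth K) (K j)
        = A * ∫⁻ K : Conf n, ∫⁻ k, offDensity m g P c ψ n K k := by
    intro j
    rw [lintegral_const_mul' _ _ hCt, lintegral_removeNth j hm]
  rw [lintegral_finsetSum _ fun j _ => hmj j]
  simp_rw [hj]
  rw [Finset.sum_const, Finset.card_univ, Fintype.card_fin, nsmul_eq_mul]
  calc _ = A * ((n + 1 : ENNReal) * ∫⁻ K : Conf n, ∫⁻ k, offDensity m g P c ψ n K k) := by
        push_cast; ring
    _ ≤ A * (A * ∫⁻ K, ENNReal.ofReal (Om m (n + 1) K) * ‖fn ψ (n + 1) K‖ₑ ^ 2) :=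
        mul_le_mul' le_rfl (lintegral_offDensity_le m g P hc ψ n)
    _ = _ := by ring

/-- The off-diagonal operator is defined on the form domain of `dΓ(ω)`. -/
theorem exists_offGraph (hW : IsWeight m P W c) {ψ : Fock}
    (hψ : ∑' n, ∫⁻ K, ENNReal.ofReal (Om m n K) * ‖fn ψ n K‖ₑ ^ 2 ≠ ⊤) :
    ∃ χ, (ψ, χ) ∈ offGraph (offKernel m g W) := by
  set A := ENNReal.ofReal (g ^ 2 * c⁻¹) * schurConst with hA
  have hCt : A ≠ ⊤ := ENNReal.mul_ne_top ENNReal.ofReal_ne_top schurConst_ne_top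
  have hfin : ∀ n, ∫⁻ K : Conf (n + 1), ∑ j, A * offDensity m g P c ψ n (j.removeNth K) (K j)
      ≠ ⊤ := fun n =>
    ne_top_of_le_ne_top (ENNReal.mul_ne_top (by finiteness)
      (ENNReal.ne_top_of_tsum_ne_top hψ (n + 1))) (lintegral_sum_offDensity_le m g P hW.pos ψ n)
  have hint : ∀ n, ∀ᵐ K : Conf (n + 1), ∀ j : Fin (n + 1), Integrable fun ξ : E3 =>
      (offKernel m g W (n + 1) K j ξ : ℂ) * fn ψ (n + 1) (Fin.snoc (j.removeNth K) ξ) := by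
    intro n
    have hm : Measurable fun K : Conf (n + 1) =>
        ∑ j, A * offDensity m g P c ψ n (j.removeNth K) (K j) :=
      Finset.measurable_fun_sum _ fun j _ => ((measurable_offDensity m g P c ψ n).comp
        ((measurable_removeNth j).prodMk (measurable_pi_apply j))).const_mul _
    filter_upwards [ae_sq_lintegral_off_le (g := g) hW ψ n, ae_lt_top hm (hfin n)] with K h1 h2 j
    refine ⟨((measurable_offIntegrand m g hW.symbol ψ j).comp
      measurable_prodMk_left).aestronglyMeasurable, ?_⟩
    have h3 : A * offDensity m g P c ψ n (j.removeNth K) (K j) < ⊤ :=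
      (ENNReal.sum_lt_top.1 h2) j (Finset.mem_univ j)
    have h4 := (h1 j).trans_lt (ENNReal.mul_lt_top ENNReal.ofReal_lt_top h3)
    exact lt_top_iff_ne_top.2 fun h => by
      simp only at h
      rw [h] at h4
      simp at h4
  have hb : ∀ n, ∫⁻ K, ‖offFun m g W ψ (n + 1) K‖ₑ ^ 2 ≤
      A ^ 2 * ∫⁻ K, ENNReal.ofReal (Om m (n + 1) K) * ‖fn ψ (n + 1) K‖ₑ ^ 2 := by
    intro n
    refine le_trans (lintegral_mono_ae ?_) (lintegral_sum_offDensity_le m g P hW.pos ψ n)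
    filter_upwards [ae_sq_lintegral_off_le (g := g) hW ψ n] with K h1
    have hp : ∑ j, ENNReal.ofReal (omega m (K j) / Om m (n + 1) K) ≤ 1 := by
      have hOm := Om_nonneg m (n + 1) K
      rw [← ENNReal.ofReal_sum_of_nonneg fun j _ => div_nonneg (omega_nonneg m _) hOm,
        ← Finset.sum_div, ENNReal.ofReal_le_one]
      exact div_self_le_one _
    calc ‖offFun m g W ψ (n + 1) K‖ₑ ^ 2
        ≤ (∑ j, ∫⁻ ξ : E3, ‖(offKernel m g W (n + 1) K j ξ : ℂ) *
            fn ψ (n + 1) (Fin.snoc (j.removeNth K) ξ)‖ₑ) ^ 2 := by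
          gcongr
          exact (enorm_sum_le _ _).trans
            (Finset.sum_le_sum fun j _ => enorm_integral_le_lintegral_enorm _)
      _ ≤ _ := sq_sum_le _ _ _ _ fun j _ => h1 j
      _ ≤ 1 * _ := mul_le_mul' hp le_rfl
      _ = _ := one_mul _
  have hnsq : nsq (offFun m g W ψ) ≠ ⊤ := by
    unfold nsq
    rw [tsum_eq_zero_add' ENNReal.summable]
    have h0 : ∫⁻ K, ‖offFun m g W ψ 0 K‖ₑ ^ 2 = 0 := by simp [offFun]
    rw [h0, zero_add]
    refine ne_top_of_le_ne_top ?_ (ENNReal.tsum_le_tsum hb)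
    rw [ENNReal.tsum_mul_left]
    refine ENNReal.mul_ne_top (by finiteness) (ne_top_of_le_ne_top hψ ?_)
    rw [tsum_eq_zero_add' (f := fun n => ∫⁻ K, ENNReal.ofReal (Om m n K) * ‖fn ψ n K‖ₑ ^ 2)
      ENNReal.summable]
    exact le_add_self
  obtain ⟨χ, hχ⟩ := exists_fock (measurable_offFun m g hW.symbol ψ)
    (offFun_symm m g hW.symbol ψ) hnsq
  exact ⟨χ, hχ 0, fun n => ⟨hint n, hχ (n + 1)⟩⟩

end

/-! ### The interior boundary condition and the domain of `T` -/

/-- `a*(v) ψ`, as a function that need not be square integrable. -/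
def formalCr (m g : ℝ) (ψ : Fock) : ∀ n, Conf n → ℂ := crFun m g (fun _ _ => 1) ψ

theorem crFun_eq_mul (m g : ℝ) (U : ∀ n, Conf n → ℝ) (ψ : Fock) (n : ℕ) (K : Conf n) :
    crFun m g U ψ n K = U n K * formalCr m g ψ n K := by
  cases n with
  | zero => simp [formalCr, crFun]
  | succ n =>
    simp only [formalCr, crFun, Complex.ofReal_one, mul_one]
    rw [← Finset.sum_mul]
    ring

section

variable {m g : ℝ} {P : E3} {W W' : ∀ n, Conf n → ℝ} {c c' : ℝ} {A A' : Fock →L[ℂ] Fock}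

theorem fn_sub_adjoint_resStar (hW : IsWeight m P W c) (hA : resStar m g W = ofCLM A) (ψ : Fock)
    (n : ℕ) : fn (ψ - ContinuousLinearMap.adjoint A ψ) n =ᵐ[volume]
      fun K => fn ψ n K + ((W n K)⁻¹ : ℝ) * formalCr m g ψ n K := by
  filter_upwards [fn_sub ψ (ContinuousLinearMap.adjoint A ψ) n, adjoint_resStar hW hA ψ n]
    with K h1 h2
  rw [h1, Pi.sub_apply, h2, Pi.neg_apply, sub_neg_eq_add, crFun_eq_mul]

/-- For the adjoint `G_W` of `-a(v) W⁻¹`, the vector `(1 - G_W) ψ` lies in the domain of `W` exactly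
if the function `W ψ + a*(v) ψ` is square integrable, and `W (1 - G_W) ψ` is this function. The
creation term no longer involves `W`. -/
theorem mem_mulGraph_iff (hW : IsWeight m P W c) (hA : resStar m g W = ofCLM A) {ψ χ : Fock} :
    (ψ - ContinuousLinearMap.adjoint A ψ, χ) ∈ mulGraph W ↔
      ∀ n, fn χ n =ᵐ[volume] fun K => (W n K : ℂ) * fn ψ n K + formalCr m g ψ n K := by
  refine forall_congr' fun n => ?_
  have h : (fun K => (W n K : ℂ) * fn (ψ - ContinuousLinearMap.adjoint A ψ) n K) =ᵐ[volume]
      fun K => (W n K : ℂ) * fn ψ n K + formalCr m g ψ n K := by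
    filter_upwards [fn_sub_adjoint_resStar hW hA ψ n] with K hK
    have h0 : (W n K : ℂ) ≠ 0 := Complex.ofReal_ne_zero.2 (hW.W_pos n K).ne'
    rw [hK, mul_add, Complex.ofReal_inv, ← mul_assoc (W n K : ℂ), mul_inv_cancel₀ h0, one_mul]
  exact ⟨fun h1 => h1.trans h, fun h1 => h1.trans h.symm⟩

/-- The interior boundary condition does not depend on the weight. -/
theorem mem_mulGraph_of_sub (hW : IsWeight m P W c) (hA : resStar m g W = ofCLM A)
    (hW' : IsWeight m P W' c') (hA' : resStar m g W' = ofCLM A') {ψ χ δ : Fock}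
    (hδ : ∀ n, fn δ n =ᵐ[volume] fun K => ((W' n K - W n K : ℝ) : ℂ) * fn ψ n K)
    (h : (ψ - ContinuousLinearMap.adjoint A ψ, χ) ∈ mulGraph W) :
    (ψ - ContinuousLinearMap.adjoint A' ψ, χ + δ) ∈ mulGraph W' := by
  rw [mem_mulGraph_iff hW hA] at h
  rw [mem_mulGraph_iff hW' hA']
  intro n
  filter_upwards [fn_add χ δ n, h n, hδ n] with K h1 h2 h3
  rw [h1, Pi.add_apply, h2, h3]
  push_cast
  ring

end

theorem isWeight_L_add (m : ℝ) (P : E3) {l : ℝ} (hl : 0 < l) :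
    IsWeight m P (fun n K => L m P n K + l) (min 1 l) :=
  ⟨(isSymbol_L m P).add_const l, lt_min one_pos hl, fun n K => min_one_mul_le (L_nonneg m P n K)⟩

/-! ### Regularity of vectors satisfying the boundary condition -/

theorem inv_L_add_le {x l : ℝ} (hx : 0 ≤ x) (hl : 1 ≤ l) :
    (x + l ^ 4)⁻¹ ≤ l⁻¹ * (x + 1) ^ (-(3 / 4) : ℝ) := by
  have h1 : (1 : ℝ) ≤ l ^ 4 := one_le_pow₀ hl
  have h0 : 0 < x + l ^ 4 := by linarith
  have e : (x + l ^ 4)⁻¹ = (x + l ^ 4) ^ (-(1 / 4) : ℝ) * (x + l ^ 4) ^ (-(3 / 4) : ℝ) := by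
    rw [← Real.rpow_add h0, ← Real.rpow_neg_one]; norm_num
  have h2 : (x + l ^ 4) ^ (-(1 / 4) : ℝ) ≤ l⁻¹ := by
    calc (x + l ^ 4) ^ (-(1 / 4) : ℝ) ≤ (l ^ 4) ^ (-(1 / 4) : ℝ) :=
          Real.rpow_le_rpow_of_nonpos (by positivity) (by linarith) (by norm_num)
      _ = l⁻¹ := by
          rw [← Real.rpow_natCast, ← Real.rpow_mul (by linarith), ← Real.rpow_neg_one]
          norm_num
  rw [e]
  exact mul_le_mul h2 (Real.rpow_le_rpow_of_nonpos (by linarith) (by linarith) (by norm_num))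
    (by positivity) (by positivity)

/-- The density controlling `Ω^{1/2} (L_P + l⁴)⁻¹ a*(v)` where `Ω` is the symbol of `dΓ(ω)`: the
first part is small compared to `Ω` for large `l`, the second part is bounded. -/
def omDensity (m g : ℝ) (P : E3) (l : ℝ) {n : ℕ} (K : Conf n) (ξ : E3) : ENNReal :=
  ENNReal.ofReal (2 * g ^ 2 * l⁻¹ * Om m n K) * ENNReal.ofReal
      ((omega m ξ ^ 2)⁻¹ * (L m P (n + 1) (Fin.snoc K ξ) + 1) ^ (-(3 / 4) : ℝ)) +
    ENNReal.ofReal (2 * g ^ 2) * ENNReal.ofReal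
      (‖ξ‖ ^ (-0 : ℝ) * (‖P - ∑ j, K j - ξ‖ ^ 2 + 1) ^ (-2 : ℝ))

theorem measurable_omDensity (m g : ℝ) (P : E3) (l : ℝ) (n : ℕ) :
    Measurable fun z : Conf n × E3 => omDensity m g P l z.1 z.2 := by
  have h1 := measurable_L_snoc m P n
  have h3 : Measurable fun z : Conf n × E3 => omega m z.2 :=
    (measurable_omega m).comp measurable_snd
  have h4 : Measurable fun z : Conf n × E3 => Om m n z.1 :=
    ((isSymbol_Om m).meas n).comp measurable_fst
  unfold omDensity
  fun_prop

theorem lintegral_omDensity_le (m g : ℝ) (P : E3) (l : ℝ) {n : ℕ} (K : Conf n) :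
    ∫⁻ ξ, omDensity m g P l K ξ ≤
      ENNReal.ofReal (2 * g ^ 2 * l⁻¹ * Om m n K) * (2 * radialInt 2 (3 / 4)) +
        ENNReal.ofReal (2 * g ^ 2) * (2 * radialInt 0 2) := by
  unfold omDensity
  rw [lintegral_add_right _ (by fun_prop), lintegral_const_mul' _ _ ENNReal.ofReal_ne_top,
    lintegral_const_mul' _ _ ENNReal.ofReal_ne_top]
  exact add_le_add
    (mul_le_mul' le_rfl (lintegral_density_le m P (by norm_num) K))
    (mul_le_mul' le_rfl (lintegral_two_centre le_rfl two_pos.le _))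

/-- The hypothesis of `lintegral_crFun_le` with the weights `ω(kⱼ) / Ω(K)`. The two parts of the
density come from `Ω(K)² ≤ 2 Ω(K̂ⱼ)² + 2 ω(kⱼ)²`; the factor `l⁻¹` is gained in
`inv_L_add_le`. -/
theorem omDensity_spec (m g : ℝ) (P : E3) {l : ℝ} (hl : 1 ≤ l) {n : ℕ} (K : Conf (n + 1))
    (j : Fin (n + 1)) :
    ENNReal.ofReal (v m g (K j) ^ 2 *
        (Real.sqrt (Om m (n + 1) K) * (L m P (n + 1) K + l ^ 4)⁻¹) ^ 2) ≤
      ENNReal.ofReal (omega m (K j) / Om m (n + 1) K) *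
        omDensity m g P l (j.removeNth K) (K j) := by
  have hL := L_nonneg m P (n + 1) K
  have hω := omega_nonneg m (K j)
  have hOm := Om_nonneg m (n + 1) K
  have hOm' := Om_nonneg m n (j.removeNth K)
  have hsum : Om m (n + 1) K = Om m n (j.removeNth K) + omega m (K j) := by
    rw [← Om_snoc, (isSymbol_Om m).removeNth j K]
  rcases hω.eq_or_lt with h0 | hpos
  -- where `ω(kⱼ) = 0`, also `v(kⱼ) = 0`
  · rw [v_sq_eq, ← h0]; simp
  have hOmpos : 0 < Om m (n + 1) K := by linarith
  have hl4 : (1 : ℝ) ≤ l ^ 4 := one_le_pow₀ hl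
  have hD : 0 < L m P (n + 1) K + l ^ 4 := by linarith
  have hq := norm_sq_le_L_snoc m P (j.removeNth K) (K j)
  rw [(isSymbol_L m P).removeNth j K] at hq
  unfold omDensity
  rw [(isSymbol_L m P).removeNth j K, ← ENNReal.ofReal_mul (by positivity),
    ← ENNReal.ofReal_mul (by positivity), ← ENNReal.ofReal_add (by positivity) (by positivity),
    ← ENNReal.ofReal_mul (by positivity)]
  refine ENNReal.ofReal_le_ofReal ?_
  set D := L m P (n + 1) K + l ^ 4 with hDdef
  set q := ‖P - ∑ i, j.removeNth K i - K j‖ with hqdef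
  have h1 : D⁻¹ ≤ l⁻¹ * (L m P (n + 1) K + 1) ^ (-(3 / 4) : ℝ) := inv_L_add_le hL hl
  have h2 : (D ^ 2)⁻¹ ≤ (q ^ 2 + 1) ^ (-2 : ℝ) := by
    rw [Real.rpow_neg (by positivity), Real.rpow_two]
    gcongr
    linarith
  have h3 : Om m n (j.removeNth K) ≤ D := by
    have := Om_le_L m P (n + 1) K
    linarith
  have h4 : Om m (n + 1) K ^ 2 ≤ 2 * (Om m n (j.removeNth K) * D) + 2 * omega m (K j) ^ 2 := by
    rw [hsum]
    nlinarith [sq_nonneg (Om m n (j.removeNth K) - omega m (K j))]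
  calc v m g (K j) ^ 2 * (Real.sqrt (Om m (n + 1) K) * D⁻¹) ^ 2
      = omega m (K j) / Om m (n + 1) K *
          (g ^ 2 * (omega m (K j) ^ 2)⁻¹ * (D ^ 2)⁻¹ * Om m (n + 1) K ^ 2) := by
        rw [v_sq_eq, mul_pow, Real.sq_sqrt hOm]
        field_simp
    _ ≤ omega m (K j) / Om m (n + 1) K * (g ^ 2 * (omega m (K j) ^ 2)⁻¹ * (D ^ 2)⁻¹ *
          (2 * (Om m n (j.removeNth K) * D) + 2 * omega m (K j) ^ 2)) := by gcongr
    _ = omega m (K j) / Om m (n + 1) K * (2 * g ^ 2 * Om m n (j.removeNth K) *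
          ((omega m (K j) ^ 2)⁻¹ * D⁻¹) + 2 * g ^ 2 * (D ^ 2)⁻¹) := by
        field_simp
    _ ≤ omega m (K j) / Om m (n + 1) K * (2 * g ^ 2 * Om m n (j.removeNth K) *
          ((omega m (K j) ^ 2)⁻¹ * (l⁻¹ * (L m P (n + 1) K + 1) ^ (-(3 / 4) : ℝ))) +
          2 * g ^ 2 * (q ^ 2 + 1) ^ (-2 : ℝ)) := by gcongr
    _ = _ := by
        rw [neg_zero, Real.rpow_zero]
        ring

theorem sum_omega_div_Om_le (m : ℝ) {n : ℕ} (K : Conf n) :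
    ∑ j, ENNReal.ofReal (omega m (K j) / Om m n K) ≤ 1 := by
  rw [← ENNReal.ofReal_sum_of_nonneg fun j _ => div_nonneg (omega_nonneg m _) (Om_nonneg m n K),
    ← Finset.sum_div, ENNReal.ofReal_le_one]
  exact div_self_le_one _

theorem ofReal_mul_enorm_sq {x : ℝ} (hx : 0 ≤ x) (z : ℂ) :
    ENNReal.ofReal x * ‖z‖ₑ ^ 2 = ‖(Real.sqrt x : ℂ) * z‖ₑ ^ 2 := by
  rw [enorm_mul, mul_pow, ← ofReal_norm ((Real.sqrt x : ℂ)), Complex.norm_real,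
    Real.norm_of_nonneg (Real.sqrt_nonneg x), ← ENNReal.ofReal_pow (Real.sqrt_nonneg x),
    Real.sq_sqrt hx]

/-- The `n`-particle part `∫ Ω(K) |f⁽ⁿ⁾(K)|² dK` of the form of `dΓ(ω)`. -/
def omMass (m : ℝ) (f : ∀ n, Conf n → ℂ) (n : ℕ) : ENNReal :=
  ∫⁻ K, ENNReal.ofReal (Om m n K) * ‖f n K‖ₑ ^ 2

theorem omMass_crFun_eq (m g : ℝ) (U : ∀ n, Conf n → ℝ) (ψ : Fock) (n : ℕ) :
    omMass m (crFun m g U ψ) n =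
      ∫⁻ K, ‖crFun m g (fun n K => Real.sqrt (Om m n K) * U n K) ψ n K‖ₑ ^ 2 := by
  refine lintegral_congr fun K => ?_
  rw [ofReal_mul_enorm_sq (Om_nonneg m _ K), crFun_eq_mul, crFun_eq_mul,
    Complex.ofReal_mul, mul_assoc]

theorem omMass_crFun_le_density (m g : ℝ) (P : E3) {l : ℝ} (hl : 1 ≤ l) (ψ : Fock) (n : ℕ) :
    omMass m (crFun m g (fun n K => (L m P n K + l ^ 4)⁻¹) ψ) (n + 1) ≤
      ∫⁻ K, ‖fn ψ n K‖ₑ ^ 2 * ∫⁻ ξ, omDensity m g P l K ξ := by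
  rw [omMass_crFun_eq]
  exact lintegral_crFun_le (U := fun n K => Real.sqrt (Om m n K) * (L m P n K + l ^ 4)⁻¹)
    (B := fun K ξ => omDensity m g P l K ξ)
    (p := fun K j => ENNReal.ofReal (omega m (K j) / Om m (n + 1) K))
    (measurable_omDensity m g P l n) (sum_omega_div_Om_le m) (omDensity_spec m g P hl) ψ

theorem omMass_crFun_le (m g : ℝ) (P : E3) {l : ℝ} (hl : 1 ≤ l) (ψ : Fock) (n : ℕ) :
    omMass m (crFun m g (fun n K => (L m P n K + l ^ 4)⁻¹) ψ) (n + 1) ≤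
      ENNReal.ofReal (2 * g ^ 2 * l⁻¹) * (2 * radialInt 2 (3 / 4)) * omMass m (fn ψ) n +
        ENNReal.ofReal (2 * g ^ 2) * (2 * radialInt 0 2) * ∫⁻ K, ‖fn ψ n K‖ₑ ^ 2 := by
  have hR : radialInt 2 (3 / 4) ≠ ⊤ := radialInt_ne_top (by norm_num) (by norm_num)
  have hR' : radialInt 0 2 ≠ ⊤ := radialInt_ne_top (by norm_num) (by norm_num)
  have hf : Measurable fun K => ‖fn ψ n K‖ₑ ^ 2 := (measurable_fn ψ n).enorm.pow_const 2
  have hl0 : 0 ≤ l⁻¹ := inv_nonneg.2 (zero_le_one.trans hl)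
  have hb := fun K => lintegral_omDensity_le m g P l (n := n) K
  refine (omMass_crFun_le_density m g P hl ψ n).trans ?_
  generalize radialInt 2 (3 / 4) = δ at *
  generalize radialInt 0 2 = B at *
  unfold omMass
  rw [← lintegral_const_mul' _ _ (by finiteness), ← lintegral_const_mul' _ _ (by finiteness),
    ← lintegral_add_right _ (hf.const_mul _)]
  refine lintegral_mono fun K => (mul_le_mul' le_rfl (hb K)).trans (le_of_eq ?_)
  rw [ENNReal.ofReal_mul (mul_nonneg (by positivity) hl0)]
  ring

/-- A recursive estimate with contraction factor `1/2`. Bounding the partial sums by induction avoids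
an a priori finiteness assumption on `x`. -/
theorem tsum_ne_top_of_le_half {x d : ℕ → ENNReal} (h0 : x 0 = 0) (hd : ∑' n, d n ≠ ⊤)
    (h : ∀ n, x (n + 1) ≤ d n + 2⁻¹ * x n) : ∑' n, x n ≠ ⊤ := by
  refine ne_top_of_le_ne_top (ENNReal.mul_ne_top ENNReal.ofNat_ne_top hd : 2 * ∑' n, d n ≠ ⊤) ?_
  refine ENNReal.tsum_le_of_sum_range_le fun N => ?_
  induction N with
  | zero => simp
  | succ N ih =>
    rw [Finset.sum_range_succ', h0, add_zero]
    calc ∑ i ∈ Finset.range N, x (i + 1)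
        ≤ ∑ i ∈ Finset.range N, (d i + 2⁻¹ * x i) := Finset.sum_le_sum fun i _ => h i
      _ = ∑ i ∈ Finset.range N, d i + 2⁻¹ * ∑ i ∈ Finset.range N, x i := by
          rw [Finset.sum_add_distrib, Finset.mul_sum]
      _ ≤ ∑' n, d n + 2⁻¹ * (2 * ∑' n, d n) := by
          gcongr
          exact ENNReal.sum_le_tsum _
      _ = 2 * ∑' n, d n := by
          rw [← mul_assoc, ENNReal.inv_mul_cancel two_ne_zero ENNReal.ofNat_ne_top]
          ring

theorem enorm_sq_sub_le (a b : ℂ) : ‖a - b‖ₑ ^ 2 ≤ 2 * ‖a‖ₑ ^ 2 + 2 * ‖b‖ₑ ^ 2 := by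
  have h : ‖a - b‖ ^ 2 ≤ 2 * ‖a‖ ^ 2 + 2 * ‖b‖ ^ 2 := by
    have := norm_sub_le a b
    nlinarith [sq_nonneg (‖a‖ - ‖b‖), norm_nonneg (a - b), norm_nonneg a, norm_nonneg b]
  have h2 := ENNReal.ofReal_le_ofReal h
  rw [ENNReal.ofReal_add (by positivity) (by positivity), ENNReal.ofReal_mul two_pos.le,
    ENNReal.ofReal_mul two_pos.le, ENNReal.ofReal_pow (norm_nonneg _),
    ENNReal.ofReal_pow (norm_nonneg _), ENNReal.ofReal_pow (norm_nonneg _), ofReal_norm,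
    ofReal_norm, ofReal_norm] at h2
  simpa using h2

theorem omMass_sub_le (m : ℝ) {f a b : ∀ n, Conf n → ℂ} (n : ℕ) (ha : Measurable (a n))
    (h : ∀ᵐ K, f n K = a n K - b n K) :
    omMass m f n ≤ 2 * omMass m a n + 2 * omMass m b n := by
  have hm : Measurable fun K => 2 * (ENNReal.ofReal (Om m n K) * ‖a n K‖ₑ ^ 2) :=
    (((isSymbol_Om m).meas n).ennreal_ofReal.mul (ha.enorm.pow_const 2)).const_mul 2
  unfold omMass
  rw [← lintegral_const_mul' _ _ ENNReal.ofNat_ne_top,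
    ← lintegral_const_mul' _ _ ENNReal.ofNat_ne_top, ← lintegral_add_left hm]
  refine lintegral_mono_ae ?_
  filter_upwards [h] with K hK
  rw [hK]
  refine (mul_le_mul' le_rfl (enorm_sq_sub_le _ _)).trans (le_of_eq ?_)
  ring

/-- A solution of `ψ + (L_P + l⁴)⁻¹ a*(v) ψ = φ` with `φ` in the form domain of `dΓ(ω)` is itself
in this form domain, for `l` large: the sectors are estimated recursively. -/
theorem tsum_omMass_ne_top {m g : ℝ} {P : E3} {l : ℝ} (hl : 1 ≤ l)
    (hl' : ENNReal.ofReal (2 * g ^ 2 * l⁻¹) * (2 * radialInt 2 (3 / 4)) ≤ 4⁻¹) {ψ φ : Fock}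
    (hφ : ∀ n, fn φ n =ᵐ[volume] fun K =>
      fn ψ n K + crFun m g (fun n K => (L m P n K + l ^ 4)⁻¹) ψ n K)
    (h : ∑' n, omMass m (fn φ) n ≠ ⊤) : ∑' n, omMass m (fn ψ) n ≠ ⊤ := by
  set B := ENNReal.ofReal (2 * g ^ 2) * (2 * radialInt 0 2) with hB
  have hR' : radialInt 0 2 ≠ ⊤ := radialInt_ne_top (by norm_num) (by norm_num)
  have hBt : B ≠ ⊤ := by finiteness
  refine tsum_ne_top_of_le_half (d := fun n => 2 * omMass m (fn φ) (n + 1) +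
    2 * (B * ∫⁻ K, ‖fn ψ n K‖ₑ ^ 2)) ?_ ?_ fun n => ?_
  · simp [omMass, Om]
  · rw [ENNReal.tsum_add, ENNReal.tsum_mul_left, ENNReal.tsum_mul_left, ENNReal.tsum_mul_left]
    refine ENNReal.add_ne_top.2 ⟨ENNReal.mul_ne_top ENNReal.ofNat_ne_top
      (ne_top_of_le_ne_top h ?_), ENNReal.mul_ne_top ENNReal.ofNat_ne_top
        (ENNReal.mul_ne_top hBt (nsq_fn_ne_top ψ))⟩
    rw [tsum_eq_zero_add' (f := fun n => omMass m (fn φ) n) ENNReal.summable]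
    exact le_add_self
  · have h1 : omMass m (fn ψ) (n + 1) ≤ 2 * omMass m (fn φ) (n + 1) +
        2 * omMass m (crFun m g (fun n K => (L m P n K + l ^ 4)⁻¹) ψ) (n + 1) := by
      refine omMass_sub_le m (n + 1) (measurable_fn φ _) ?_
      filter_upwards [hφ (n + 1)] with K hK
      rw [hK, add_sub_cancel_right]
    have h2 := (omMass_crFun_le m g P hl ψ n).trans (add_le_add (mul_le_mul' hl' le_rfl) le_rfl)
    have e : (2 : ENNReal) * 4⁻¹ = 2⁻¹ := by
      rw [show (4 : ENNReal) = 2 * 2 by norm_num,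
        ENNReal.mul_inv (Or.inl two_ne_zero) (Or.inl ENNReal.ofNat_ne_top), ← mul_assoc,
        ENNReal.mul_inv_cancel two_ne_zero ENNReal.ofNat_ne_top, one_mul]
    refine (h1.trans (add_le_add le_rfl (mul_le_mul' le_rfl h2))).trans (le_of_eq ?_)
    rw [mul_add, ← mul_assoc 2 4⁻¹, e]
    ring

/-- The smallness condition of `tsum_omMass_ne_top` holds for large `l`. -/
theorem exists_small_coupling (g : ℝ) : ∃ l : ℝ, 1 ≤ l ∧
    ENNReal.ofReal (2 * g ^ 2 * l⁻¹) * (2 * radialInt 2 (3 / 4)) ≤ 4⁻¹ := by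
  have hR : radialInt 2 (3 / 4) ≠ ⊤ := radialInt_ne_top (by norm_num) (by norm_num)
  set R := (radialInt 2 (3 / 4)).toReal with hRdef
  have hR0 : 0 ≤ R := ENNReal.toReal_nonneg
  refine ⟨max 1 (16 * g ^ 2 * R), le_max_left _ _, ?_⟩
  set l := max 1 (16 * g ^ 2 * R) with hl
  have hl0 : 0 < l := one_pos.trans_le (le_max_left _ _)
  have hl1 : 16 * g ^ 2 * R ≤ l := le_max_right _ _
  rw [← ENNReal.ofReal_toReal hR, ← hRdef, show (2 : ENNReal) = ENNReal.ofReal 2 by simp,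
    ← ENNReal.ofReal_mul two_pos.le, ← ENNReal.ofReal_mul (by positivity),
    show (4⁻¹ : ENNReal) = ENNReal.ofReal (1 / 4) by
      rw [one_div, ENNReal.ofReal_inv_of_pos (by norm_num)]; simp]
  refine ENNReal.ofReal_le_ofReal ?_
  rw [show 2 * g ^ 2 * l⁻¹ * (2 * R) = (4 * g ^ 2 * R) / l by ring, div_le_iff₀ hl0]
  linarith

theorem tsum_omMass_eq_nsq (m : ℝ) (ψ : Fock) :
    ∑' n, omMass m (fn ψ) n = nsq fun n K => (Real.sqrt (Om m n K) : ℂ) * fn ψ n K :=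
  tsum_congr fun n => lintegral_congr fun K => ofReal_mul_enorm_sq (Om_nonneg m n K) _

theorem mem_domain_iff_nsq {f : ∀ n, Conf n → ℝ} (hf : IsSymbol f) {ψ : Fock} :
    ψ ∈ (mulOp f).domain ↔ nsq (fun n K => (f n K : ℂ) * fn ψ n K) ≠ ⊤ := by
  rw [mem_mulOp_domain]
  exact ⟨fun ⟨χ, h⟩ => nsq_mul_ne_top h, exists_mul hf⟩

section

variable {m g : ℝ} {P : E3}

theorem tsum_omMass_ne_top_of_mem_domain {f : ∀ n, Conf n → ℝ}
    (hf : ∀ n K, Real.sqrt (Om m n K) ≤ |f n K|) {ψ : Fock} (hψ : ψ ∈ (mulOp f).domain) :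
    ∑' n, omMass m (fn ψ) n ≠ ⊤ := by
  rw [tsum_omMass_eq_nsq, ← mem_domain_iff_nsq ((isSymbol_Om m).comp Real.continuous_sqrt.measurable)]
  refine mulOp_domain_mono ((isSymbol_Om m).comp Real.continuous_sqrt.measurable) 1 (fun n K => ?_) hψ
  rw [one_mul, abs_of_nonneg (Real.sqrt_nonneg _)]
  exact hf n K

theorem sqrt_Om_le (m : ℝ) (P : E3) {l : ℝ} (hl : 1 ≤ l) (n : ℕ) (K : Conf n) :
    Real.sqrt (Om m n K) ≤ |L m P n K + l| := by
  have h1 := Om_le_L m P n K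
  have h0 := L_nonneg m P n K
  rw [abs_of_nonneg (by linarith), Real.sqrt_le_left (by linarith)]
  nlinarith

variable {mu : ℝ} {A : Fock →L[ℂ] Fock} {ψ χ : Fock}

/-- Vectors satisfying the interior boundary condition lie in the form domain of `dΓ(ω)`. -/
theorem tsum_omMass_ne_top_of_boundary (hmu : 0 < mu)
    (hA : resStar m g (fun n K => L m P n K + mu) = ofCLM A)
    (h : (ψ - ContinuousLinearMap.adjoint A ψ, χ) ∈ mulGraph fun n K => L m P n K + mu) :
    ∑' n, omMass m (fn ψ) n ≠ ⊤ := by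
  obtain ⟨l, hl, hsmall⟩ := exists_small_coupling g
  have hl4 : (1 : ℝ) ≤ l ^ 4 := one_le_pow₀ hl
  have hW := isWeight_L_add m P hmu
  have hW' := isWeight_L_add m P (zero_lt_one.trans_le hl4)
  obtain ⟨A', hA'⟩ := exists_resStar_eq_ofCLM hW' g
  have hδ : ∀ n, fn (((l ^ 4 - mu : ℝ) : ℂ) • ψ) n =ᵐ[volume]
      fun K => ((L m P n K + l ^ 4 - (L m P n K + mu) : ℝ) : ℂ) * fn ψ n K := by
    intro n
    filter_upwards [fn_smul ((l ^ 4 - mu : ℝ) : ℂ) ψ n] with K hK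
    rw [hK, Pi.smul_apply, smul_eq_mul, add_sub_add_left_eq_sub]
  -- the boundary condition for the weight `L_P + l⁴`, at which the recursion is a contraction
  have h' := mem_mulGraph_of_sub hW hA hW' hA' hδ h
  refine tsum_omMass_ne_top (P := P) hl hsmall (φ := ψ - ContinuousLinearMap.adjoint A' ψ) (fun n => ?_)
    (tsum_omMass_ne_top_of_mem_domain (sqrt_Om_le m P hl4) (mem_mulOp_domain.2 ⟨_, h'⟩))
  filter_upwards [fn_sub_adjoint_resStar hW' hA' ψ n] with K hK
  rw [hK, crFun_eq_mul]

theorem isSymbol_L_rpow (m : ℝ) (P : E3) (ε : ℝ) : IsSymbol fun n K => L m P n K ^ ε :=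
  (isSymbol_L m P).comp (φ := fun x => x ^ ε) (measurable_id.pow_const ε)

theorem abs_L_rpow_mul_inv_le {W : ∀ n, Conf n → ℝ} {c : ℝ} (hW : IsWeight m P W c) {ε : ℝ}
    (hε : 0 ≤ ε) (n : ℕ) (K : Conf n) :
    |L m P n K ^ ε * (W n K)⁻¹| ≤ c⁻¹ * (L m P n K + 1) ^ (-1 + ε) := by
  have hL := L_nonneg m P n K
  have hc := hW.pos
  have hWp := hW.W_pos n K
  rw [abs_of_nonneg (by positivity), Real.rpow_add (by positivity), Real.rpow_neg_one]
  calc L m P n K ^ ε * (W n K)⁻¹ ≤ (L m P n K + 1) ^ ε * (c⁻¹ * (L m P n K + 1)⁻¹) := by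
        gcongr
        · linarith
        · exact hW.inv_le n K
    _ = _ := by ring

/-- Vectors satisfying the interior boundary condition lie in `D(L_P^ε)` for `ε < 1/4`. -/
theorem nsq_L_rpow_ne_top_of_boundary {W : ∀ n, Conf n → ℝ} {c : ℝ} (hW : IsWeight m P W c)
    (hA : resStar m g W = ofCLM A) {ε : ℝ} (hε : 0 ≤ ε) (hε' : ε < 1 / 4)
    (h : (ψ - ContinuousLinearMap.adjoint A ψ, χ) ∈ mulGraph W) :
    nsq (fun n K => ((L m P n K ^ ε : ℝ) : ℂ) * fn ψ n K) ≠ ⊤ := by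
  have hφ : ψ - ContinuousLinearMap.adjoint A ψ ∈ (mulOp fun n K => L m P n K ^ ε).domain := by
    refine mulOp_domain_mono (isSymbol_L_rpow m P ε) c⁻¹ (fun n K => ?_)
      (mem_mulOp_domain.2 ⟨_, h⟩)
    have hL := L_nonneg m P n K
    have hc := hW.pos
    have hWp := hW.W_pos n K
    rw [abs_of_nonneg (by positivity), abs_of_nonneg hWp.le, ← div_eq_inv_mul, le_div_iff₀ hc]
    refine le_trans ?_ (hW.le n K)
    rw [mul_comm]
    gcongr
    calc L m P n K ^ ε ≤ (L m P n K + 1) ^ ε := by gcongr; linarith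
      _ ≤ (L m P n K + 1) ^ (1 : ℝ) := Real.rpow_le_rpow_of_exponent_le (by linarith) (by linarith)
      _ = _ := Real.rpow_one _
  rw [mem_domain_iff_nsq (isSymbol_L_rpow m P ε)] at hφ
  have hU : IsSymbol fun n K => -(L m P n K ^ ε * (W n K)⁻¹) := by
    refine ⟨fun n => ?_, fun n σ K => ?_⟩
    · exact (((isSymbol_L_rpow m P ε).meas n).mul (hW.symbol_inv.meas n)).neg
    · rw [(isSymbol_L_rpow m P ε).symm, hW.symbol_inv.symm]
  have hUb : ∀ n K, |-(L m P n K ^ ε * (W n K)⁻¹)| ≤ c⁻¹ * (L m P n K + 1) ^ (-1 + ε) :=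
    fun n K => (abs_neg _).trans_le (abs_L_rpow_mul_inv_le hW hε n K)
  have hsum := nsq_add_ne_top (measurable_crFun m g hU ψ) hφ (nsq_crFun_ne_top hε' hUb ψ)
  rw [nsq_congr] at hsum
  · exact hsum
  intro n
  filter_upwards [fn_sub_adjoint_resStar hW hA ψ n] with K hK
  rw [hK, crFun_eq_mul]
  push_cast
  ring

theorem isSymbol_DT (m : ℝ) (P : E3) (ε : ℝ) :
    IsSymbol fun n K => L m P n K ^ ε + Real.sqrt (Om m n K) :=
  (isSymbol_L_rpow m P ε).add ((isSymbol_Om m).comp Real.continuous_sqrt.measurable)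

/-- The interior boundary condition implies the regularity required by `T` and `S`. -/
theorem mem_DT_of_boundary (hmu : 0 < mu) {ε : ℝ} (hε : 0 ≤ ε) (hε' : ε < 1 / 4)
    (hA : resStar m g (fun n K => L m P n K + mu) = ofCLM A)
    (h : (ψ - ContinuousLinearMap.adjoint A ψ, χ) ∈ mulGraph fun n K => L m P n K + mu) :
    ψ ∈ DT m P ε := by
  have h1 := nsq_L_rpow_ne_top_of_boundary (isWeight_L_add m P hmu) hA hε hε' h
  have h2 := tsum_omMass_ne_top_of_boundary hmu hA h
  rw [tsum_omMass_eq_nsq] at h2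
  rw [DT, mem_domain_iff_nsq (isSymbol_DT m P ε)]
  have hm : ∀ n, Measurable fun K => (Real.sqrt (Om m n K) : ℂ) * fn ψ n K := fun n =>
    (Complex.measurable_ofReal.comp (((isSymbol_Om m).meas n).sqrt)).mul (measurable_fn ψ n)
  have h3 := nsq_add_ne_top hm h1 h2
  rw [nsq_congr] at h3
  · exact h3
  refine fun n => .of_forall fun K => ?_
  simp only
  push_cast
  ring

theorem tsum_omMass_ne_top_of_mem_DT {ε : ℝ} (h : ψ ∈ DT m P ε) :
    ∑' n, omMass m (fn ψ) n ≠ ⊤ :=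
  tsum_omMass_ne_top_of_mem_domain (fun n K => le_trans (le_add_of_nonneg_left
    (Real.rpow_nonneg (L_nonneg m P n K) ε)) (le_abs_self _)) h

/-- Multiplication by functions of size `(L_P + 1)^ε` is defined on `DT`. -/
theorem mem_domain_of_mem_DT {ε : ℝ} (hε : 0 ≤ ε) (hε' : ε ≤ 1) (h : ψ ∈ DT m P ε)
    {f : ∀ n, Conf n → ℝ} (hf : IsSymbol f) {C : ℝ}
    (hC : ∀ n K, |f n K| ≤ C * (L m P n K + 1) ^ ε) : ψ ∈ (mulOp f).domain := by
  have hL := L_nonneg m P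
  have h1 : ψ ∈ (mulOp fun n K => L m P n K ^ ε).domain := by
    refine mulOp_domain_mono (isSymbol_L_rpow m P ε) 1 (fun n K => ?_) h
    have h2 := Real.rpow_nonneg (hL n K) ε
    have h3 := Real.sqrt_nonneg (Om m n K)
    rw [one_mul, abs_of_nonneg h2, abs_of_nonneg (by positivity)]
    linarith
  rw [mem_domain_iff_nsq (isSymbol_L_rpow m P ε)] at h1
  have h4 := nsq_add_ne_top (measurable_fn ψ) h1 (nsq_fn_ne_top ψ)
  have h5 : ψ ∈ (mulOp fun n K => L m P n K ^ ε + 1).domain := by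
    rw [mem_domain_iff_nsq ((isSymbol_L_rpow m P ε).add_const 1), nsq_congr]
    · exact h4
    refine fun n => .of_forall fun K => ?_
    simp only
    push_cast
    ring
  refine mulOp_domain_mono hf |C| (fun n K => (hC n K).trans ?_) h5
  have h6 := Real.rpow_add_le_add_rpow (hL n K) zero_le_one hε hε'
  rw [Real.one_rpow] at h6
  have h7 := Real.rpow_nonneg (hL n K) ε
  have h8 := Real.rpow_nonneg (add_nonneg (hL n K) zero_le_one) ε
  rw [abs_of_nonneg (a := L m P n K ^ ε + 1) (by positivity)]
  exact mul_le_mul (le_abs_self C) h6 h8 (abs_nonneg C)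

end

/-! ### Annihilation after creation -/

section

variable {m g : ℝ} {P : E3} {U : ∀ n, Conf n → ℝ} {ψ θ χ : Fock}

theorem sqrt_mul_crFun_snoc (m g : ℝ) (U : ∀ n, Conf n → ℝ) (ψ : Fock) (n : ℕ) (K : Conf n)
    (ξ : E3) : (Real.sqrt (n + 1) : ℂ) * ((v m g ξ : ℂ) * crFun m g U ψ (n + 1) (Fin.snoc K ξ)) =
      ((v m g ξ ^ 2 * U (n + 1) (Fin.snoc K ξ) : ℝ) : ℂ) * fn ψ n K +
        ∑ i : Fin n, ((v m g ξ * v m g (K i) * U (n + 1) (Fin.snoc K ξ) : ℝ) : ℂ) *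
          fn ψ n (i.castSucc.removeNth (Fin.snoc K ξ : Conf (n + 1))) := by
  have h : (Real.sqrt (n + 1) : ℂ) ≠ 0 :=
    Complex.ofReal_ne_zero.2 (Real.sqrt_pos.2 (by positivity)).ne'
  rw [crFun, Fin.sum_univ_castSucc, removeNth_last_snoc, Fin.snoc_last]
  simp only [Fin.snoc_castSucc]
  rw [Complex.ofReal_inv, mul_left_comm (v m g ξ : ℂ), ← mul_assoc, mul_inv_cancel₀ h, one_mul,
    mul_add, Finset.mul_sum, add_comm]
  congr 1
  · push_cast; ring
  · refine Finset.sum_congr rfl fun i _ => ?_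
    push_cast; ring

theorem fn_ann_crFun (hχ : (θ, χ) ∈ annGraph (v m g))
    (hθ : ∀ n, fn θ n =ᵐ[volume] crFun m g U ψ n) (n : ℕ) : fn χ n =ᵐ[volume] fun K => ∫ ξ : E3,
      (((v m g ξ ^ 2 * U (n + 1) (Fin.snoc K ξ) : ℝ) : ℂ) * fn ψ n K +
        ∑ i : Fin n, ((v m g ξ * v m g (K i) * U (n + 1) (Fin.snoc K ξ) : ℝ) : ℂ) *
          fn ψ n (i.castSucc.removeNth (Fin.snoc K ξ : Conf (n + 1)))) := by
  filter_upwards [(hχ n).2, ae_slice (hθ (n + 1))] with K h1 h2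
  rw [h1, ← integral_const_mul]
  refine integral_congr_ae ?_
  filter_upwards [h2] with ξ hξ
  rw [hξ, sqrt_mul_crFun_snoc]

/-- The vacuum component of `a(v) U a*(v) ψ`. -/
theorem fn_ann_crFun_zero (hχ : (θ, χ) ∈ annGraph (v m g))
    (hθ : ∀ n, fn θ n =ᵐ[volume] crFun m g U ψ n) : fn χ 0 =ᵐ[volume] fun K =>
      ((∫ ξ : E3, v m g ξ ^ 2 * U 1 (Fin.snoc K ξ) : ℝ) : ℂ) * fn ψ 0 K := by
  filter_upwards [fn_ann_crFun hχ hθ 0] with K hK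
  rw [hK]
  simp only [Finset.univ_eq_empty, Finset.sum_empty, add_zero]
  rw [integral_mul_const, integral_complex_ofReal]

/-- The normal ordering of `a(v) U a*(v)`: the diagonal term is multiplication by
`∫ v(ξ)² U(K, ξ) dξ`, the other terms form an off-diagonal integral operator. -/
theorem fn_ann_crFun_succ (hχ : (θ, χ) ∈ annGraph (v m g))
    (hθ : ∀ n, fn θ n =ᵐ[volume] crFun m g U ψ n)
    (hd : ∀ n (K : Conf n), Integrable fun ξ : E3 => v m g ξ ^ 2 * U (n + 1) (Fin.snoc K ξ))
    {n : ℕ} (ho : ∀ᵐ K : Conf (n + 1), ∀ j, Integrable fun ξ : E3 =>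
      ((v m g ξ * v m g (K j) * U (n + 2) (Fin.snoc K ξ) : ℝ) : ℂ) *
        fn ψ (n + 1) (Fin.snoc (j.removeNth K) ξ)) :
    fn χ (n + 1) =ᵐ[volume] fun K =>
      ((∫ ξ : E3, v m g ξ ^ 2 * U (n + 2) (Fin.snoc K ξ) : ℝ) : ℂ) * fn ψ (n + 1) K +
      ∑ j, ∫ ξ : E3, ((v m g ξ * v m g (K j) * U (n + 2) (Fin.snoc K ξ) : ℝ) : ℂ) *
        fn ψ (n + 1) (Fin.snoc (j.removeNth K) ξ) := by
  filter_upwards [fn_ann_crFun hχ hθ (n + 1), ho] with K hK hoK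
  rw [hK]
  simp only [removeNth_castSucc_snoc]
  have hd' : Integrable fun ξ : E3 =>
      ((v m g ξ ^ 2 * U (n + 2) (Fin.snoc K ξ) : ℝ) : ℂ) * fn ψ (n + 1) K :=
    (hd (n + 1) K).ofReal.mul_const _
  have e := integral_add hd' (integrable_finsetSum Finset.univ fun j _ => hoK j)
  rw [integral_mul_const, integral_complex_ofReal, integral_finsetSum _ fun j _ => hoK j] at e
  exact e

end

/-! ### Comparison of the two representations -/

section

variable {m g : ℝ} {P : E3} {mu lam : ℝ}

theorem isWeight_L_tau (m g : ℝ) (P : E3) (hlam : 0 < lam) :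
    IsWeight m P (fun n K => L m P n K + tauPos m g P lam n K + lam) (min 1 lam) :=
  ⟨((isSymbol_L m P).add (isSymbol_tauPos m g P lam)).add_const lam, lt_min one_pos hlam,
    fun n K => (min_one_mul_le (L_nonneg m P n K)).trans (by
      linarith [tauPos_nonneg m g P lam n K])⟩

/-- The difference of the inverses of the weights `L_P + μ` and `L_P + τ₊ + λ`. -/
def invDiff (m g : ℝ) (P : E3) (mu lam : ℝ) (n : ℕ) (K : Conf n) : ℝ :=
  (L m P n K + mu)⁻¹ - (L m P n K + tauPos m g P lam n K + lam)⁻¹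

/-- The reference terms `1 / (ξ² + ω(ξ))` cancel between `T_{d,λ}` and `T_{d,μ}`. -/
theorem v_sq_mul_invDiff (m g : ℝ) (P : E3) (hlam : 0 < lam) (n : ℕ) (K : Conf n)
    (ξ : E3) : v m g ξ ^ 2 * invDiff m g P mu lam (n + 1) (Fin.snoc K ξ) =
      TdIntegrand m g P lam n K ξ - TdIntegrand m g P mu n K ξ + SdIntegrand m g P lam n K ξ := by
  have h1 := L_nonneg m P (n + 1) (Fin.snoc K ξ)
  have h2 := tauPos_nonneg m g P lam (n + 1) (Fin.snoc K ξ)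
  have h4 : L m P (n + 1) (Fin.snoc K ξ) + lam ≠ 0 := by positivity
  have h5 : L m P (n + 1) (Fin.snoc K ξ) + tauPos m g P lam (n + 1) (Fin.snoc K ξ) + lam ≠ 0 := by
    positivity
  have e : tauPos m g P lam (n + 1) (Fin.snoc K ξ) / ((L m P (n + 1) (Fin.snoc K ξ) + lam) *
      (L m P (n + 1) (Fin.snoc K ξ) + tauPos m g P lam (n + 1) (Fin.snoc K ξ) + lam)) =
      (L m P (n + 1) (Fin.snoc K ξ) + lam)⁻¹ -
      (L m P (n + 1) (Fin.snoc K ξ) + tauPos m g P lam (n + 1) (Fin.snoc K ξ) + lam)⁻¹ := by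
    field_simp
    ring
  unfold invDiff TdIntegrand SdIntegrand
  rw [sq_abs, mul_div_assoc, e]
  ring

theorem integrable_v_sq_mul_invDiff (m g : ℝ) (P : E3) (hmu : 0 < mu) (hlam : 0 < lam) (n : ℕ)
    (K : Conf n) :
    Integrable fun ξ : E3 => v m g ξ ^ 2 * invDiff m g P mu lam (n + 1) (Fin.snoc K ξ) := by
  simp only [v_sq_mul_invDiff m g P hlam]
  exact ((integrable_TdIntegrand m g P hlam n K).sub (integrable_TdIntegrand m g P hmu n K)).add
    (integrable_SdIntegrand m g P hlam n K)

/-- The diagonal parts of `T` and `S` differ by the diagonal part of the difference of the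
formal operators `a(v) W⁻¹ a*(v)`, up to `τ₊`. -/
theorem integral_v_sq_mul_invDiff (m g : ℝ) (P : E3) (hmu : 0 < mu) (hlam : 0 < lam) (n : ℕ)
    (K : Conf n) : ∫ ξ : E3, v m g ξ ^ 2 * invDiff m g P mu lam (n + 1) (Fin.snoc K ξ) =
      Sd m g P lam n K + tauPos m g P lam n K - Td m g P mu n K := by
  have h1 := integrable_TdIntegrand m g P hlam n K
  have h2 := integrable_TdIntegrand m g P hmu n K
  simp only [v_sq_mul_invDiff m g P hlam]
  have e := integral_add (h1.sub h2) (integrable_SdIntegrand m g P hlam n K)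
  have e' := integral_sub h1 h2
  simp only [Pi.sub_apply] at e
  rw [e, e', Sd, tauNeg]
  simp only [Td]
  ring

/-- The off-diagonal counterpart of `integral_v_sq_mul_invDiff`. -/
theorem offKernel_sub (m g : ℝ) (P : E3) (mu lam : ℝ) (n : ℕ) (K : Conf n) (j : Fin n) (ξ : E3) :
    v m g ξ * v m g (K j) * invDiff m g P mu lam (n + 1) (Fin.snoc K ξ) =
      SodKernel m g P lam n K j ξ - TodKernel m g P mu n K j ξ := by
  unfold invDiff SodKernel TodKernel
  ring

/-- The operator identity behind the theorem, for `θ = (1 - G) ψ - (1 - F) ψ`: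
`a(v) θ + T ψ = τ₊ ψ + S ψ`. -/
theorem ann_sub_eq (hmu : 0 < mu) (hlam : 0 < lam) {ψ θ χ d o d' o' τ : Fock}
    (hχ : (θ, χ) ∈ annGraph (v m g))
    (hθ : ∀ n, fn θ n =ᵐ[volume] crFun m g (invDiff m g P mu lam) ψ n)
    (hd : (ψ, d) ∈ mulGraph (Td m g P mu)) (ho : (ψ, o) ∈ offGraph (TodKernel m g P mu))
    (hd' : (ψ, d') ∈ mulGraph (Sd m g P lam)) (ho' : (ψ, o') ∈ offGraph (SodKernel m g P lam))
    (hτ : (ψ, τ) ∈ mulGraph (tauPos m g P lam)) : χ + (d + o) = τ + (d' + o') := by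
  refine fn_ext fun n => ?_
  have hadd : ∀ a b c : Fock, fn (a + (b + c)) n =ᵐ[volume]
      fun K => fn a n K + (fn b n K + fn c n K) := by
    intro a b c
    filter_upwards [fn_add a (b + c) n, fn_add b c n] with K h1 h2
    rw [h1, Pi.add_apply, h2, Pi.add_apply]
  refine (hadd _ _ _).trans (EventuallyEq.trans ?_ (hadd _ _ _).symm)
  cases n with
  | zero =>
    filter_upwards [fn_ann_crFun_zero hχ hθ, hd 0, ho.1, hd' 0, ho'.1, hτ 0] with K h1 h2 h3 h4 h5 h6
    have e := integral_v_sq_mul_invDiff m g P hmu hlam 0 K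
    rw [h1, h2, h3, h4, h5, h6, e]
    push_cast
    simp only [Pi.zero_apply]
    ring
  | succ n =>
    obtain ⟨io, eo⟩ := ho.2 n
    obtain ⟨io', eo'⟩ := ho'.2 n
    have hi : ∀ᵐ K : Conf (n + 1), ∀ j, Integrable fun ξ : E3 =>
        ((v m g ξ * v m g (K j) * invDiff m g P mu lam (n + 2) (Fin.snoc K ξ) : ℝ) : ℂ) *
          fn ψ (n + 1) (Fin.snoc (j.removeNth K) ξ) := by
      filter_upwards [io, io'] with K h1 h2 j
      refine ((h2 j).sub (h1 j)).congr (.of_forall fun ξ => ?_)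
      simp only [Pi.sub_apply]
      rw [offKernel_sub]
      push_cast
      ring
    filter_upwards [fn_ann_crFun_succ hχ hθ (integrable_v_sq_mul_invDiff m g P hmu hlam) hi,
      hd (n + 1), eo, hd' (n + 1), eo', hτ (n + 1), io, io'] with K h1 h2 h3 h4 h5 h6 h7 h8
    have e := integral_v_sq_mul_invDiff m g P hmu hlam (n + 1) K
    have e2 : ∀ j, ∫ ξ : E3, ((v m g ξ * v m g (K j) *
          invDiff m g P mu lam (n + 2) (Fin.snoc K ξ) : ℝ) : ℂ) *
          fn ψ (n + 1) (Fin.snoc (j.removeNth K) ξ) =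
        (∫ ξ : E3, (SodKernel m g P lam (n + 1) K j ξ : ℂ) *
          fn ψ (n + 1) (Fin.snoc (j.removeNth K) ξ)) -
        ∫ ξ : E3, (TodKernel m g P mu (n + 1) K j ξ : ℂ) *
          fn ψ (n + 1) (Fin.snoc (j.removeNth K) ξ) := by
      intro j
      rw [← integral_sub (h8 j) (h7 j)]
      refine integral_congr_ae (.of_forall fun ξ => ?_)
      simp only
      rw [offKernel_sub]
      push_cast
      ring
    rw [h1, h2, h3, h4, h5, h6, e, Finset.sum_congr rfl fun j _ => e2 j, Finset.sum_sub_distrib]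
    push_cast
    ring

end

/-! ### Operators with a renormalised weight -/

theorem adjoint_one_sub_adjoint {E : Type*} [NormedAddCommGroup E] [InnerProductSpace ℂ E]
    [CompleteSpace E] (A : E →L[ℂ] E) :
    ContinuousLinearMap.adjoint (1 - ContinuousLinearMap.adjoint A) = 1 - A := by
  rw [map_sub, ContinuousLinearMap.adjoint_adjoint]
  congr 1
  exact ContinuousLinearMap.adjoint_id

theorem one_sub_apply {E : Type*} [NormedAddCommGroup E] [NormedSpace ℂ E] (A : E →L[ℂ] E)
    (x : E) : (1 - A) x = x - A x := rfl

theorem mem_graph_comp_ofCLM {Q Q' : Fock →L[ℂ] Fock} {M T : Op} {c : ℂ} {ψ χ : Fock} :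
    (ψ, χ) ∈ (comp (ofCLM Q') (comp M (ofCLM Q)) + T - c • one).graph ↔
      ∃ a t, (Q ψ, a) ∈ M.graph ∧ (ψ, t) ∈ T.graph ∧ χ = Q' a + t - c • ψ := by
  constructor
  · intro h
    obtain ⟨x, y, hx, hy, rfl⟩ := mem_graph_sub.1 h
    obtain ⟨b, t, hb, ht, rfl⟩ := mem_graph_add.1 hx
    obtain ⟨a, ha, hba⟩ := mem_graph_comp.1 hb
    obtain ⟨φ, hφ, hφa⟩ := mem_graph_comp.1 ha
    rw [mem_graph_smul_one.1 hy, mem_graph_ofCLM.1 hba]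
    rw [mem_graph_ofCLM.1 hφ] at hφa
    exact ⟨a, t, hφa, ht, rfl⟩
  · rintro ⟨a, t, ha, ht, rfl⟩
    have h1 := mem_graph_comp.2 ⟨Q ψ, mem_graph_ofCLM.2 rfl, ha⟩
    have h2 := mem_graph_comp.2 ⟨a, h1, mem_graph_ofCLM.2 (rfl : Q' a = Q' a)⟩
    exact mem_graph_sub.2 ⟨_, _, mem_graph_add.2 ⟨_, t, h2, ht, rfl⟩, mem_graph_smul_one.2 rfl, rfl⟩

set_option maxHeartbeats 2000000 in
/-- `1 - R` and its adjoint as bounded operators, with their values. -/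
theorem exists_one_sub_eq_ofCLM {A : Fock →L[ℂ] Fock} {R : Op}
    (hR : R = ofCLM (ContinuousLinearMap.adjoint A)) : ∃ Q Q' : Fock →L[ℂ] Fock,
      one - R = ofCLM Q ∧ (one - R).adjoint = ofCLM Q' ∧
      (∀ ψ, Q ψ = ψ - ContinuousLinearMap.adjoint A ψ) ∧ ∀ ψ, Q' ψ = ψ - A ψ := by
  obtain ⟨Q, hQ⟩ : ∃ Q : Fock →L[ℂ] Fock, Q = 1 - ContinuousLinearMap.adjoint A := ⟨_, rfl⟩
  have e1 : one - R = ofCLM Q := by rw [hR, one_sub_ofCLM, hQ]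
  have e3 : ContinuousLinearMap.adjoint Q = 1 - A := by
    rw [hQ]; exact adjoint_one_sub_adjoint A
  refine ⟨Q, ContinuousLinearMap.adjoint Q, e1, ?_, fun ψ => ?_, fun ψ => ?_⟩
  · rw [e1, adjoint_ofCLM]
  · rw [hQ]; exact one_sub_apply _ ψ
  · rw [e3]; exact one_sub_apply _ ψ

set_option maxHeartbeats 2000000 in
/-- The graph of `(1 - R)^* M (1 - R) + T - c` for bounded `R` with adjoint `A`. -/
theorem mem_graph_sandwich {A : Fock →L[ℂ] Fock} {R M T : Op}
    (hR : R = ofCLM (ContinuousLinearMap.adjoint A)) {c : ℂ} {ψ χ : Fock} :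
    (ψ, χ) ∈ (comp (one - R).adjoint (comp M (one - R)) + T - c • one).graph ↔
    ∃ a t, (ψ - ContinuousLinearMap.adjoint A ψ, a) ∈ M.graph ∧ (ψ, t) ∈ T.graph ∧
      χ = a - A a + t - c • ψ := by
  obtain ⟨Q, Q', e1, e2, h1, h2⟩ := exists_one_sub_eq_ofCLM hR
  rw [e2, e1, mem_graph_comp_ofCLM]
  simp only [h1, h2]

theorem mem_mulGraph_add {f h k : ∀ n, Conf n → ℝ} (hk : ∀ n K, k n K = f n K + h n K)
    {φ a b : Fock} (ha : (φ, a) ∈ mulGraph f) (hb : (φ, b) ∈ mulGraph h) :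
    (φ, a + b) ∈ mulGraph k := by
  intro n
  filter_upwards [fn_add a b n, ha n, hb n] with K h1 h2 h3
  rw [h1, Pi.add_apply, h2, h3, hk]
  push_cast
  ring

theorem mem_mulGraph_const (c : ℝ) (φ : Fock) : (φ, (c : ℂ) • φ) ∈ mulGraph fun _ _ => c := by
  intro n
  filter_upwards [fn_smul (c : ℂ) φ n] with K h1
  rw [h1, Pi.smul_apply, smul_eq_mul]

theorem mulGraph_unique {f : ∀ n, Conf n → ℝ} {φ a b : Fock} (ha : (φ, a) ∈ mulGraph f)
    (hb : (φ, b) ∈ mulGraph f) : a = b :=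
  fn_ext fun n => (ha n).trans (hb n).symm

section

variable {m g : ℝ} {P : E3} {lam : ℝ}

theorem LOp_add_tauPos_graph (hlam : 0 < lam) :
    (LOp m P + tauPosOp m g P lam + (lam : ℂ) • one).graph =
      mulGraph fun n K => L m P n K + tauPos m g P lam n K + lam := by
  have hsum : ∀ {φ a b : Fock}, (φ, a) ∈ mulGraph (L m P) → (φ, b) ∈ mulGraph (tauPos m g P lam) →
      (φ, a + b + (lam : ℂ) • φ) ∈
        mulGraph fun n K => L m P n K + tauPos m g P lam n K + lam := fun ha hb =>
    mem_mulGraph_add (fun _ _ => rfl)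
      (mem_mulGraph_add (k := fun n K => L m P n K + tauPos m g P lam n K) (fun _ _ => rfl) ha hb)
      (mem_mulGraph_const lam _)
  have hnn := fun n K => tauPos_nonneg m g P lam n K
  have hL := L_nonneg m P
  ext ⟨φ, χ⟩
  rw [mem_graph_add]
  simp only [mem_graph_add, mem_graph_smul_one, LOp, tauPosOp, mulOp_graph]
  constructor
  · rintro ⟨_, _, ⟨a, b, ha, hb, rfl⟩, rfl, rfl⟩
    exact hsum ha hb
  · intro h
    have hdom := mem_mulOp_domain.2 ⟨χ, h⟩
    obtain ⟨a, ha⟩ := mem_mulOp_domain.1 (mulOp_domain_mono (isSymbol_L m P) 1 (fun n K => by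
      rw [one_mul, abs_of_nonneg (hL n K), abs_of_nonneg (by linarith [hL n K, hnn n K])]
      linarith [hnn n K]) hdom)
    obtain ⟨b, hb⟩ := mem_mulOp_domain.1 (mulOp_domain_mono (isSymbol_tauPos m g P lam) 1
      (fun n K => by
        rw [one_mul, abs_of_nonneg (hnn n K), abs_of_nonneg (by linarith [hL n K, hnn n K])]
        linarith [hL n K]) hdom)
    exact ⟨_, _, ⟨a, b, ha, hb, rfl⟩, rfl, mulGraph_unique h (hsum ha hb)⟩

theorem LOp_add_const_graph (m : ℝ) (P : E3) (c : ℝ) :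
    (LOp m P + (c : ℂ) • one).graph = mulGraph fun n K => L m P n K + c := by
  ext ⟨φ, χ⟩
  simp only [mem_graph_add, mem_graph_smul_one, LOp, mulOp_graph]
  constructor
  · rintro ⟨a, _, ha, rfl, rfl⟩
    exact mem_mulGraph_add (fun _ _ => rfl) ha (mem_mulGraph_const c _)
  · intro h
    refine ⟨χ - (c : ℂ) • φ, _, ?_, rfl, (sub_add_cancel _ _).symm⟩
    rw [sub_eq_add_neg, ← neg_smul, ← Complex.ofReal_neg]
    exact mem_mulGraph_add (fun n K => by simp) h (mem_mulGraph_const (-c) _)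

theorem mem_T_graph {ε : ℝ} {ψ t : Fock} : (ψ, t) ∈ (T m g P ε lam).graph ↔ ψ ∈ DT m P ε ∧
    ∃ d o, (ψ, d) ∈ mulGraph (Td m g P lam) ∧ (ψ, o) ∈ offGraph (TodKernel m g P lam) ∧
      t = d + o := by
  simp only [T, mem_graph_domRestrict, mem_graph_add, mulOp_graph, offOp_graph]

theorem mem_S_graph {ε : ℝ} {ψ t : Fock} : (ψ, t) ∈ (S m g P ε lam).graph ↔ ψ ∈ DT m P ε ∧
    ∃ d o, (ψ, d) ∈ mulGraph (Sd m g P lam) ∧ (ψ, o) ∈ offGraph (SodKernel m g P lam) ∧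
      t = d + o := by
  simp only [S, mem_graph_domRestrict, mem_graph_add, mulOp_graph, offOp_graph]

theorem exists_T_graph {ε : ℝ} (hε : 0 < ε) (hε' : ε < 1 / 4) (hlam : 0 < lam) {ψ : Fock}
    (h : ψ ∈ DT m P ε) : ∃ t, (ψ, t) ∈ (T m g P ε lam).graph := by
  obtain ⟨C, -, hC⟩ := exists_abs_Td_le m g P hlam hε (by linarith)
  obtain ⟨d, hd⟩ := mem_mulOp_domain.1
    (mem_domain_of_mem_DT hε.le (by linarith) h (isSymbol_Td m g P lam) hC)
  obtain ⟨o, ho⟩ := exists_offGraph (g := g) (isWeight_L_add m P hlam)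
    (tsum_omMass_ne_top_of_mem_DT h)
  exact ⟨d + o, mem_T_graph.2 ⟨h, d, o, hd, ho, rfl⟩⟩

theorem exists_S_graph {ε : ℝ} (hε : 0 < ε) (hε' : ε < 1 / 4) (hlam : 0 < lam) {ψ : Fock}
    (h : ψ ∈ DT m P ε) : ∃ t, (ψ, t) ∈ (S m g P ε lam).graph := by
  obtain ⟨C, -, hC⟩ := exists_abs_Sd_le m g P hlam hε (by linarith)
  obtain ⟨d, hd⟩ := mem_mulOp_domain.1
    (mem_domain_of_mem_DT hε.le (by linarith) h (isSymbol_Sd m g P lam) hC)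
  obtain ⟨o, ho⟩ := exists_offGraph (g := g) (isWeight_L_tau m g P hlam)
    (tsum_omMass_ne_top_of_mem_DT h)
  exact ⟨d + o, mem_S_graph.2 ⟨h, d, o, hd, ho, rfl⟩⟩

theorem domain_eq_of_graph {A : Op} {D : Submodule ℂ Fock}
    (h1 : ∀ ψ ∈ D, ∃ χ, (ψ, χ) ∈ A.graph) (h2 : ∀ ψ χ, (ψ, χ) ∈ A.graph → ψ ∈ D) :
    A.domain = D := by
  ext ψ
  rw [LinearPMap.mem_domain_iff]
  exact ⟨fun ⟨χ, h⟩ => h2 ψ χ h, h1 ψ⟩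

theorem T_domain {ε : ℝ} (hε : 0 < ε) (hε' : ε < 1 / 4) (hlam : 0 < lam) :
    (T m g P ε lam).domain = DT m P ε :=
  domain_eq_of_graph (fun _ => exists_T_graph hε hε' hlam) fun _ _ h => (mem_T_graph.1 h).1

theorem S_domain {ε : ℝ} (hε : 0 < ε) (hε' : ε < 1 / 4) (hlam : 0 < lam) :
    (S m g P ε lam).domain = DT m P ε :=
  domain_eq_of_graph (fun _ => exists_S_graph hε hε' hlam) fun _ _ h => (mem_S_graph.1 h).1

theorem isBoundedOp_resStar {W : ∀ n, Conf n → ℝ} {c : ℝ} (hW : IsWeight m P W c) (g : ℝ) :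
    IsBoundedOp (resStar m g W) ∧ IsBoundedOp (resStar m g W).adjoint := by
  obtain ⟨A, hA⟩ := exists_resStar_eq_ofCLM hW g
  rw [hA, adjoint_ofCLM]
  exact ⟨isBoundedOp_ofCLM A, isBoundedOp_ofCLM _⟩

/-! ### The two representations of the Hamiltonian -/

variable {ε mu : ℝ} {A B : Fock →L[ℂ] Fock} {ψ χ : Fock}

theorem H_graph (hA : resStar m g (fun n K => L m P n K + mu) = ofCLM A) :
    (ψ, χ) ∈ (H m g P ε mu).graph ↔ ∃ a t,
      (ψ - ContinuousLinearMap.adjoint A ψ, a) ∈ mulGraph (fun n K => L m P n K + mu) ∧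
      (ψ, t) ∈ (T m g P ε mu).graph ∧ χ = a - A a + t - (mu : ℂ) • ψ := by
  have hG : G m g P mu = ofCLM (ContinuousLinearMap.adjoint A) := by
    rw [← adjoint_ofCLM, ← hA]; rfl
  rw [← LOp_add_const_graph]
  exact mem_graph_sandwich hG

theorem HF_graph (hlam : 0 < lam)
    (hB : resStar m g (fun n K => L m P n K + tauPos m g P lam n K + lam) = ofCLM B) :
    (ψ, χ) ∈ (HF m g P ε lam).graph ↔ ∃ b s, (ψ - ContinuousLinearMap.adjoint B ψ, b) ∈
        mulGraph (fun n K => L m P n K + tauPos m g P lam n K + lam) ∧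
      (ψ, s) ∈ (S m g P ε lam).graph ∧ χ = b - B b + s - (lam : ℂ) • ψ := by
  have hF : F m g P lam = ofCLM (ContinuousLinearMap.adjoint B) := by
    rw [← adjoint_ofCLM, ← hB]; rfl
  rw [← LOp_add_tauPos_graph hlam]
  exact mem_graph_sandwich hF

set_option maxHeartbeats 2000000 in
theorem mem_DH_iff (hA : resStar m g (fun n K => L m P n K + mu) = ofCLM A) :
    ψ ∈ DH m g P mu ↔ ∃ a,
      (ψ - ContinuousLinearMap.adjoint A ψ, a) ∈ mulGraph fun n K => L m P n K + mu := by
  have hG : G m g P mu = ofCLM (ContinuousLinearMap.adjoint A) := by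
    rw [← adjoint_ofCLM, ← hA]; rfl
  obtain ⟨Q, -, e1, -, h1, -⟩ := exists_one_sub_eq_ofCLM hG
  rw [DH, LinearPMap.mem_domain_iff, e1]
  constructor
  · rintro ⟨χ, h⟩
    obtain ⟨φ, hφ, h⟩ := mem_graph_comp.1 h
    rw [LOp, mulOp_graph, mem_graph_ofCLM.1 hφ, h1] at h
    exact ⟨_, mem_mulGraph_add (fun _ _ => rfl) h (mem_mulGraph_const mu _)⟩
  · rintro ⟨a, ha⟩
    rw [← h1] at ha
    have h : (Q ψ, a + ((-mu : ℝ) : ℂ) • Q ψ) ∈ (LOp m P).graph := by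
      rw [LOp, mulOp_graph]
      exact mem_mulGraph_add (fun n K => by simp) ha (mem_mulGraph_const (-mu) _)
    exact ⟨_, mem_graph_comp.2 ⟨_, mem_graph_ofCLM.2 rfl, h⟩⟩

theorem H_domain (hmu : 0 < mu) (hε : 0 < ε) (hε' : ε < 1 / 4) :
    (H m g P ε mu).domain = DH m g P mu := by
  obtain ⟨A, hA⟩ := exists_resStar_eq_ofCLM (isWeight_L_add m P hmu) g
  refine domain_eq_of_graph (fun ψ hψ => ?_) fun ψ χ h => ?_
  · obtain ⟨a, ha⟩ := (mem_DH_iff hA).1 hψ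
    obtain ⟨t, ht⟩ := exists_T_graph (g := g) hε hε' hmu (mem_DT_of_boundary hmu hε.le hε' hA ha)
    exact ⟨_, (H_graph hA).2 ⟨a, t, ha, ht, rfl⟩⟩
  · obtain ⟨a, t, ha, -⟩ := (H_graph hA).1 h
    exact (mem_DH_iff hA).2 ⟨a, ha⟩

theorem mem_mulGraph_inv {W : ∀ n, Conf n → ℝ} {c : ℝ} (hW : IsWeight m P W c) {φ a : Fock}
    (h : (φ, a) ∈ mulGraph W) : (a, φ) ∈ mulGraph fun n K => (W n K)⁻¹ := by
  intro n
  filter_upwards [h n] with K hK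
  have h0 : (W n K : ℂ) ≠ 0 := Complex.ofReal_ne_zero.2 (hW.W_pos n K).ne'
  rw [hK, Complex.ofReal_inv, ← mul_assoc, inv_mul_cancel₀ h0, one_mul]

set_option maxHeartbeats 2000000 in
/-- The values of the two representations agree. -/
theorem sandwich_eq (hmu : 0 < mu) (hlam : 0 < lam)
    (hA : resStar m g (fun n K => L m P n K + mu) = ofCLM A)
    (hB : resStar m g (fun n K => L m P n K + tauPos m g P lam n K + lam) = ofCLM B)
    {a t s τ : Fock} (hτ : (ψ, τ) ∈ mulGraph (tauPos m g P lam))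
    (ha : (ψ - ContinuousLinearMap.adjoint A ψ, a) ∈ mulGraph fun n K => L m P n K + mu)
    (hb : (ψ - ContinuousLinearMap.adjoint B ψ, a + (τ + ((lam - mu : ℝ) : ℂ) • ψ)) ∈
      mulGraph fun n K => L m P n K + tauPos m g P lam n K + lam)
    (ht : (ψ, t) ∈ (T m g P ε mu).graph) (hs : (ψ, s) ∈ (S m g P ε lam).graph) :
    a - A a + t - (mu : ℂ) • ψ = a + (τ + ((lam - mu : ℝ) : ℂ) • ψ) -
      B (a + (τ + ((lam - mu : ℝ) : ℂ) • ψ)) + s - (lam : ℂ) • ψ := by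
  obtain ⟨-, d, o, hd, ho, rfl⟩ := mem_T_graph.1 ht
  obtain ⟨-, d', o', hd', ho', rfl⟩ := mem_S_graph.1 hs
  have hW := isWeight_L_add m P hmu
  have hW' := isWeight_L_tau m g P hlam
  set b := a + (τ + ((lam - mu : ℝ) : ℂ) • ψ) with hbdef
  have h1 := resStar_mem_annGraph hW hA (mem_mulGraph_inv hW ha)
  have h2 := resStar_mem_annGraph hW' hB (mem_mulGraph_inv hW' hb)
  have h3 := (annGraph (v m g)).sub_mem h1 h2
  have key := ann_sub_eq hmu hlam h3 (fun n => by
    filter_upwards [fn_sub (ψ - ContinuousLinearMap.adjoint A ψ)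
      (ψ - ContinuousLinearMap.adjoint B ψ) n, fn_sub_adjoint_resStar hW hA ψ n,
      fn_sub_adjoint_resStar hW' hB ψ n] with K e1 e2 e3
    rw [e1, Pi.sub_apply, e2, e3, crFun_eq_mul, invDiff]
    push_cast
    ring) hd ho hd' ho' hτ
  simp only at key
  have key' : -A a + (d + o) = -B b + (τ + (d' + o')) := by
    rw [← key]; abel
  calc a - A a + (d + o) - (mu : ℂ) • ψ = a + (-A a + (d + o)) - (mu : ℂ) • ψ := by abel
    _ = a + (-B b + (τ + (d' + o'))) - (mu : ℂ) • ψ := by rw [key']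
    _ = _ := by
        rw [hbdef, Complex.ofReal_sub, sub_smul]
        abel

theorem exists_tauPos_graph (hε : 0 < ε) (hε' : ε < 1 / 4) (hlam : 0 < lam) (h : ψ ∈ DT m P ε) :
    ∃ τ, (ψ, τ) ∈ mulGraph (tauPos m g P lam) := by
  obtain ⟨C, -, hC⟩ := exists_abs_Td_le m g P hlam hε (by linarith)
  refine mem_mulOp_domain.1 (mem_domain_of_mem_DT hε.le (by linarith) h
    (isSymbol_tauPos m g P lam) (C := C) fun n K => ?_)
  rw [abs_of_nonneg (tauPos_nonneg m g P lam n K)]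
  exact (tauPos_le_abs m g P lam n K).trans (hC n K)

set_option maxHeartbeats 2000000 in
theorem H_eq_HF (hmu : 0 < mu) (hlam : 0 < lam) (hε : 0 < ε) (hε' : ε < 1 / 4) :
    H m g P ε mu = HF m g P ε lam := by
  have hW := isWeight_L_add m P hmu
  have hW' := isWeight_L_tau m g P hlam
  obtain ⟨A, hA⟩ := exists_resStar_eq_ofCLM hW g
  obtain ⟨B, hB⟩ := exists_resStar_eq_ofCLM hW' g
  have hδ : ∀ {ψ τ : Fock}, (ψ, τ) ∈ mulGraph (tauPos m g P lam) → ∀ n,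
      fn (τ + ((lam - mu : ℝ) : ℂ) • ψ) n =ᵐ[volume] fun K =>
        ((L m P n K + tauPos m g P lam n K + lam - (L m P n K + mu) : ℝ) : ℂ) * fn ψ n K :=
    fun hτ => mem_mulGraph_add
      (k := fun n K => L m P n K + tauPos m g P lam n K + lam - (L m P n K + mu))
      (fun n K => by ring) hτ (mem_mulGraph_const (lam - mu) _)
  refine op_ext fun ψ χ => ?_
  rw [H_graph hA, HF_graph hlam hB]
  constructor
  · rintro ⟨a, t, ha, ht, rfl⟩
    have hDT := (mem_T_graph.1 ht).1
    obtain ⟨τ, hτ⟩ := exists_tauPos_graph (g := g) hε hε' hlam hDT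
    obtain ⟨s, hs⟩ := exists_S_graph (g := g) hε hε' hlam hDT
    have hb := mem_mulGraph_of_sub hW hA hW' hB (hδ hτ) ha
    exact ⟨_, s, hb, hs, sandwich_eq hmu hlam hA hB hτ ha hb ht hs⟩
  · rintro ⟨b, s, hb, hs, rfl⟩
    have hDT := (mem_S_graph.1 hs).1
    obtain ⟨τ, hτ⟩ := exists_tauPos_graph (g := g) hε hε' hlam hDT
    obtain ⟨t, ht⟩ := exists_T_graph (g := g) hε hε' hmu hDT
    have ha := mem_mulGraph_of_sub hW' hB hW hA
      (δ := -(τ + ((lam - mu : ℝ) : ℂ) • ψ)) (fun n => by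
        filter_upwards [fn_neg (τ + ((lam - mu : ℝ) : ℂ) • ψ) n, hδ hτ n] with K h1 h2
        rw [h1, Pi.neg_apply, h2]
        push_cast
        ring) hb
    have e : b = b + -(τ + ((lam - mu : ℝ) : ℂ) • ψ) + (τ + ((lam - mu : ℝ) : ℂ) • ψ) :=
      (neg_add_cancel_right _ _).symm
    rw [e] at hb
    refine ⟨_, t, ha, ht, ?_⟩
    rw [sandwich_eq hmu hlam hA hB hτ ha hb ht hs, ← e]

/-! ### The sign of the off-diagonal kernel -/

theorem v_mul_v (m g : ℝ) (k ξ : E3) :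
    v m g ξ * v m g k = g ^ 2 * (omega m ξ ^ (-(1 / 2) : ℝ) * omega m k ^ (-(1 / 2) : ℝ)) := by
  unfold v; ring

theorem SodKernel_nonpos (m g : ℝ) (P : E3) (hlam : 0 < lam) (n : ℕ) (K : Conf n) (j : Fin n)
    (ξ : E3) : SodKernel m g P lam n K j ξ ≤ 0 := by
  have h1 := omega_nonneg m ξ
  have h2 := omega_nonneg m (K j)
  have h3 := (isWeight_L_tau m g P hlam).W_pos (n + 1) (Fin.snoc K ξ)
  rw [SodKernel, v_mul_v, neg_nonpos]
  positivity

theorem SodKernel_neg (m : ℝ) (P : E3) (hlam : 0 < lam) (hg : g ≠ 0) (n : ℕ) (K : Conf n)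
    (j : Fin n) (ξ : E3) (hξ : ξ ≠ 0) (hk : K j ≠ 0) : SodKernel m g P lam n K j ξ < 0 := by
  have h1 := omega_pos m hξ
  have h2 := omega_pos m hk
  have h3 := (isWeight_L_tau m g P hlam).W_pos (n + 1) (Fin.snoc K ξ)
  rw [SodKernel, v_mul_v, neg_lt_zero]
  positivity

end

end Nelson

end

theorem proposition1 (m g : ℝ) (hm : 0 ≤ m) (P : Nelson.E3)
    (ε : ℝ) (hε : 0 < ε) (hε' : ε < 1 / 4)
    (mu : ℝ) (hmu : 0 < mu) (lam : ℝ) (hlam : 0 < lam) :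
    -- the integrals defining the diagonal terms converge absolutely
    (∀ n K, Integrable (Nelson.TdIntegrand m g P lam n K)) ∧
    (∀ n K, Integrable (Nelson.SdIntegrand m g P lam n K)) ∧
    -- the operators `G_λ`, `F_λ` and their adjoints are bounded and everywhere defined
    Nelson.IsBoundedOp (Nelson.GStar m g P lam) ∧ Nelson.IsBoundedOp (Nelson.G m g P lam) ∧
    Nelson.IsBoundedOp (Nelson.FStar m g P lam) ∧ Nelson.IsBoundedOp (Nelson.F m g P lam) ∧
    -- the integral formulas define `T_λ` and `S_λ` on all of `D(L_P^ε + dΓ(ω)^{1/2})`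
    (Nelson.T m g P ε lam).domain = Nelson.DT m P ε ∧
    (Nelson.S m g P ε lam).domain = Nelson.DT m P ε ∧
    -- `H_P`, defined with any auxiliary parameter `μ > 0`, has domain `D(H_P)`
    (Nelson.H m g P ε mu).domain = Nelson.DH m g P mu ∧
    -- the representation of `H_P`, as an identity of unbounded operators with their domains
    Nelson.H m g P ε mu = Nelson.HF m g P ε lam ∧
    -- the off-diagonal kernel is negative
    (∀ n K j ξ, Nelson.SodKernel m g P lam n K j ξ ≤ 0) ∧
    (g ≠ 0 → ∀ n (K : Nelson.Conf n) j ξ, ξ ≠ 0 → K j ≠ 0 →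
      Nelson.SodKernel m g P lam n K j ξ < 0) := by
  obtain ⟨hG, hG'⟩ := Nelson.isBoundedOp_resStar (Nelson.isWeight_L_add m P hlam) g
  obtain ⟨hF, hF'⟩ := Nelson.isBoundedOp_resStar (Nelson.isWeight_L_tau m g P hlam) g
  exact ⟨Nelson.integrable_TdIntegrand m g P hlam, Nelson.integrable_SdIntegrand m g P hlam,
    hG, hG', hF, hF', Nelson.T_domain hε hε' hlam, Nelson.S_domain hε hε' hlam,
    Nelson.H_domain hmu hε hε', Nelson.H_eq_HF hmu hlam hε hε',
    Nelson.SodKernel_nonpos m g P hlam, Nelson.SodKernel_neg m P hlam⟩
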